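/- There are universal constants $C>0$ and $c>0$ such that the following holds for all $K\ge 1$, $T\ge 2$ and every fixed sequence of preference matrices $P_1,\dots,P_T\in[0,1]^{K\times K}$ (so $P_t(a,b)=1-P_t(b,a)$). Write $\delta_t(a,b)=P_t(a,b)-\tfrac12$. Assume that every $P_t$ has a Condorcet winner $a_t^*$ ($\delta_t(a_t^*,b)>0$ for all $b\ne a_t^*$) and satisfies, for all arms $a,b,c$ with $\delta_t(a,b)\ge 0$ and $\delta_t(b,c)\ge 0$, Strong Stochastic Transitivity, $\delta_t(a,c)\ge\max\{\delta_t(a,b),\delta_t(b,c)\}$, and the Stochastic Triangle Inequality, $\delta_t(a,c)\le\delta_t(a,b)+\delta_t(b,c)$. Let $S^{CW}=\sum_{t=2}^T\mathbf 1\{a_t^*\ne a_{t-1}^*\}$. Let $\tilde\tau_0=1$, and let $\tilde\tau_{i+1}$ be the first round $r\in[\tilde\tau_i,T)$ such that for every arm $a$ there are rounds $\tilde\tau_i\le s_1<s_2<r$ with $\sum_{t=s_1}^{s_2}\delta_t(a_t^*,a)\ge\sqrt{K(s_2-s_1)}$. Let $\tilde S$ be the number of these significant Condorcet winner switches $\tilde\tau_1,\dots,\tilde\tau_{\tilde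 S}$, and let $\tilde\tau_{\tilde S+1}=T$. ANACONDA is the following algorithm. In round $t$ two arms $a_t,b_t$ are drawn independently and uniformly from an active set $\mathcal A_t$, and $o_t\sim\mathrm{Ber}(P_t(a_t,b_t))$ is observed; set $\hat\delta_t(a,b)=|\mathcal A_t|^2\mathbf 1\{a_t=a,b_t=b\}o_t-\tfrac12$. An arm $a$ is *bad* on $[u,v)$ if there are rounds $u\le s_1<s_2<v$ with $\max_{a'}\sum_{t=s_1}^{s_2}\hat\delta_t(a',a)>C\log(T)\,K\sqrt{\max\{s_2-s_1,K^2\}}$. An episode that starts in round $t_\ell$ (the first one in round $1$) sets $\mathcal A_{\rm good}=[K]$, samples independent $B_{s,m}\sim\mathrm{Ber}(1/\sqrt{m(s-t_\ell)})$ for $s\in\{t_\ell+1,\dots,T\}$ and $m\in\{2,4,8,\dots,2^{\lceil\log_2T\rceil}\}$, and runs $\mathrm{CondaLet}(t_\ell,T+1-t_\ell)$. A run of $\mathrm{CondaLet}(t_0,m_0)$ starts with $\mathcal A_{t_0}=[K]$ and, while $t\le T$, $t\le t_0+m_0$ and $\mathcal A_{\rm good}\ne\emptyset$, repeats: play round $t$;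 remove from $\mathcal A_{\rm good}$ the arms that are bad on $[t_\ell,t)$; save $\mathcal A_{\rm local}=\mathcal A_t$; increase $t$ by one; if some $B_{t,m}=1$, run $\mathrm{CondaLet}(t,m)$ for the largest such $m$ (which may increase $t$ further); let $\mathcal A_t$ be $\mathcal A_{\rm local}$ without the arms that are bad on $[t_0,t)$. When $\mathcal A_{\rm good}=\emptyset$ and $t\le T$, a new episode starts. (If a round has to be played with $\mathcal A_t=\emptyset$, which happens at most in the last round of an episode, the two arms are drawn uniformly from $[K]$.) Then $\tilde S\le S^{CW}$, and the dynamic regret $\mathrm{DR}(T)=\mathbb E\Big[\sum_{t=1}^T\tfrac12\big(\delta_t(a_t^*,a_t)+\delta_t(a_t^*,b_t)\big)\Big]$ of ANACONDA satisfies $$\mathrm{DR}(T)\le c\,K\log^3(T)\sum_{i=0}^{\tilde S}\sqrt{\tilde\tau_{i+1}-\tilde\tau_i}\qquad\text{and}\qquad \mathrm{DR}(T)\le c\,K\log^3(T)\sqrt{\max\{\tilde S,1\}\,T}.$$ -/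

import Mathlib

noncomputable section

namespace DuelingBandit

/-! ## Preference matrices, Condorcet winners and non-stationarity -/

/-- A preference matrix on the arms `Fin K`: `prob a b ∈ [0,1]` is the probability that `a` wins a
duel against `b`. -/
structure PrefMatrix (K : ℕ) where
  prob : Fin K → Fin K → unitInterval
  symm : ∀ a b, (prob a b : ℝ) = 1 - (prob b a : ℝ)
  diag : ∀ a, (prob a a : ℝ) = 1 / 2

/-- The gap `δ(a, b) = P(a, b) - 1/2`. -/
def PrefMatrix.gap {K : ℕ} (P : PrefMatrix K) (a b : Fin K) : ℝ := (P.prob a b : ℝ) - 1 / 2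

/-- `a` is a Condorcet winner: it beats every other arm with probability larger than `1/2`. -/
def PrefMatrix.IsCondorcetWinner {K : ℕ} (P : PrefMatrix K) (a : Fin K) : Prop :=
  ∀ b, b ≠ a → 1 / 2 < (P.prob a b : ℝ)

/-- `a` is (weakly) preferred over `b`. -/
def PrefMatrix.Pref {K : ℕ} (P : PrefMatrix K) (a b : Fin K) : Prop := 1 / 2 ≤ (P.prob a b : ℝ)

/-- Strong Stochastic Transitivity. -/
def PrefMatrix.SST {K : ℕ} (P : PrefMatrix K) : Prop :=
  ∀ a b c, P.Pref a b → P.Pref b c → max (P.gap a b) (P.gap b c) ≤ P.gap a c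

/-- Stochastic Triangle Inequality. -/
def PrefMatrix.STI {K : ℕ} (P : PrefMatrix K) : Prop :=
  ∀ a b c, P.Pref a b → P.Pref b c → P.gap a c ≤ P.gap a b + P.gap b c

/-- The number `∑_{t=2}^T 1{a_t^* ≠ a_{t-1}^*}` of Condorcet winner switches. -/
def numCWSwitches {K : ℕ} (T : ℕ) (cw : ℕ → Fin K) : ℕ :=
  ((Finset.Icc 2 T).filter fun t => cw t ≠ cw (t - 1)).card

/-- Every arm suffers large dynamic regret on some interval `[s₁, s₂]` with `τ ≤ s₁ < s₂ < r`. -/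
def NoSafeArm {K : ℕ} (P : ℕ → PrefMatrix K) (cw : ℕ → Fin K) (τ r : ℕ) : Prop :=
  ∀ a : Fin K, ∃ s₁ s₂ : ℕ, τ ≤ s₁ ∧ s₁ < s₂ ∧ s₂ < r ∧
    √((K : ℝ) * ((s₂ : ℝ) - (s₁ : ℝ))) ≤ ∑ t ∈ Finset.Icc s₁ s₂, (P t).gap (cw t) a

/-- The significant Condorcet winner switches: `sigSwitch 0 = 1`, and `sigSwitch (i + 1)` is the
first round `r ∈ [sigSwitch i, T)` before which no arm stayed safe, or `T` if there is none. -/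
def sigSwitch {K : ℕ} (T : ℕ) (P : ℕ → PrefMatrix K) (cw : ℕ → Fin K) : ℕ → ℕ
  | 0 => 1
  | i + 1 => sInf ({r | sigSwitch T P cw i ≤ r ∧ r < T ∧ NoSafeArm P cw (sigSwitch T P cw i) r}
      ∪ {T})

/-- The number of significant Condorcet winner switches. (The switches increase strictly as long
as they are smaller than `T`, and stay at `T` afterwards. So these are exactly the first ones.) -/
def numSigSwitches {K : ℕ} (T : ℕ) (P : ℕ → PrefMatrix K) (cw : ℕ → Fin K) : ℕ :=
  ((Finset.range T).filter fun i => sigSwitch T P cw (i + 1) < T).card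

/-! ## Elementary random choices -/

/-- A Bernoulli variable with success probability `p`. -/
def coin (p : unitInterval) : PMF Bool :=
  PMF.ofFintype
    (fun b => cond b (ENNReal.ofReal (p : ℝ)) (ENNReal.ofReal (1 - (p : ℝ)))) (by
    rw [Fintype.sum_bool, cond_true, cond_false,
      ← ENNReal.ofReal_add p.2.1 (sub_nonneg.2 p.2.2)]
    simp)

/-- A finite family of independent Bernoulli variables. -/
def independentCoins {ι : Type} [Fintype ι] [DecidableEq ι] (p : ι → unitInterval) :
    PMF (ι → Bool) :=
  PMF.ofFintype (fun B => ∏ i, coin (p i) (B i)) (by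
    have h := Finset.prod_univ_sum (fun _ : ι => (Finset.univ : Finset Bool))
      (fun i b => coin (p i) b)
    rw [Fintype.piFinset_univ] at h
    rw [← h]
    refine Finset.prod_eq_one fun i _ => ?_
    rw [← tsum_fintype (L := .unconditional _)]
    exact (coin (p i)).tsum_coe)

/-- The number `1 / √n`, as a probability (`0` for `n = 0`). -/
def invSqrt (n : ℕ) : unitInterval :=
  ⟨1 / √(n : ℝ), by positivity, by
    rcases Nat.eq_zero_or_pos n with h | h
    · simp [h]
    · have h1 : (1 : ℝ) ≤ √(n : ℝ) := Real.one_le_sqrt.2 (by exact_mod_cast h)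
      exact (div_le_one (by positivity)).2 h1⟩

/-- A uniformly random arm of `A`. For `A = ∅`, where the choice is not determined, a uniformly
random arm of `[K]`. -/
def uniformArm {K : ℕ} [NeZero K] (A : Finset (Fin K)) : PMF (Fin K) :=
  if h : A.Nonempty then PMF.uniformOfFinset A h
  else PMF.uniformOfFinset Finset.univ Finset.univ_nonempty

/-! ## The algorithm -/

/-- What is recorded in one round: the active set `A_t`, the arms `a_t` and `b_t`, and the feedback
`o_t` (`true` if `a_t` won). -/
structure Obs (K : ℕ) where
  active : Finset (Fin K)
  fst : Fin K
  snd : Fin K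
  won : Bool

/-- The importance weighted estimate `|A_t|² 1{a_t = a, b_t = b} o_t - 1/2` of `δ_t(a, b)`. -/
def Obs.estimate {K : ℕ} (o : Obs K) (a b : Fin K) : ℝ :=
  (o.active.card : ℝ) ^ 2 * (if o.fst = a ∧ o.snd = b ∧ o.won = true then 1 else 0) - 1 / 2

/-- The elimination rule for arm `a` on intervals `[s₁, s₂] ⊆ [lo, t)`: the largest sum
`∑_{s=s₁}^{s₂} δ̂_s(a', a)` over `a'` exceeds `C log(T) K √((s₂ - s₁) ∨ K²)`. -/
def Eliminated {K : ℕ} (C : ℝ) (T : ℕ) (obs : ℕ → Obs K) (lo t : ℕ) (a : Fin K) : Prop :=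
  ∃ s₁ s₂ : ℕ, lo ≤ s₁ ∧ s₁ < s₂ ∧ s₂ < t ∧ ∃ a' : Fin K,
    C * Real.log T * K * √(max ((s₂ : ℝ) - (s₁ : ℝ)) ((K : ℝ) ^ 2)) <
      ∑ s ∈ Finset.Icc s₁ s₂, (obs s).estimate a' a

open Classical in
/-- The arms of `A` which are not eliminated on an interval inside `[lo, t)`. -/
def survivors {K : ℕ} (C : ℝ) (T : ℕ) (obs : ℕ → Obs K) (lo t : ℕ) (A : Finset (Fin K)) :
    Finset (Fin K) :=
  A.filter fun a => ¬ Eliminated C T obs lo t a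

/-- A replay schedule: the entry at `(s, j)` is `B_{s,m}` for `m = 2 ^ (j + 1)`, so that `m` runs
through the powers of two `2, 4, …, 2 ^ ⌈log₂ T⌉`. -/
abbrev Schedule (T : ℕ) : Type := Fin (T + 1) × Fin (Nat.clog 2 T) → Bool

/-- The schedule of an episode that starts in round `tl`: independent
`B_{s,m} ~ Bern(1 / √(m (s - tl)))` for the rounds `s ∈ {tl + 1, …, T}`. -/
def sampleSchedule (T tl : ℕ) : PMF (Schedule T) :=
  independentCoins fun p =>
    if tl < (p.1 : ℕ) then invSqrt (2 ^ ((p.2 : ℕ) + 1) * ((p.1 : ℕ) - tl)) else 0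

/-- The largest duration `m` with `B_{t,m} = 1`, if there is one. -/
def scheduledChild {T : ℕ} (B : Schedule T) (t : ℕ) : Option ℕ :=
  let ms : Finset ℕ := (Finset.univ.filter fun p : Fin (T + 1) × Fin (Nat.clog 2 T) =>
      (p.1 : ℕ) = t ∧ B p = true).image fun p => 2 ^ ((p.2 : ℕ) + 1)
  if h : ms.Nonempty then some (ms.max' h) else none

/-- A call `CondaLet(start, dur)` with its local set of arms. -/
structure Call (K : ℕ) where
  start : ℕ
  dur : ℕ
  loc : Finset (Fin K)

/-- The memory of the algorithm at the moment when a round is about to be played. -/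
structure State (K T : ℕ) where
  /-- first round `t_ℓ` of the current episode -/
  epStart : ℕ
  /-- the good set `A_good` -/
  good : Finset (Fin K)
  /-- the replay schedule of the current episode -/
  sched : Schedule T
  /-- the running call of `CondaLet`, followed by the calls it interrupts, innermost first -/
  stack : List (Call K)
  /-- the active set `A_t` -/
  active : Finset (Fin K)
  /-- the rounds played so far -/
  obs : ℕ → Obs K

/-- Start of an episode in round `t`: reset the good set, sample a fresh schedule, and run
`CondaLet(t, T + 1 - t)`. -/
def newEpisode {K T : ℕ} (t : ℕ) (obs : ℕ → Obs K) : PMF (State K T) :=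
  (sampleSchedule T t).map fun B =>
    { epStart := t
      good := Finset.univ
      sched := B
      stack := [⟨t, T + 1 - t, Finset.univ⟩]
      active := Finset.univ
      obs := obs }

/-- Return to the innermost call which still runs in round `t` (a call `CondaLet(t₀, m₀)` runs while
`t ≤ t₀ + m₀`). Every call that regains control sets `A_t` to its local set without the arms which
are eliminated on an interval inside `[t₀, t)`. -/
def resume {K : ℕ} (C : ℝ) (T : ℕ) (obs : ℕ → Obs K) (t : ℕ) :
    List (Call K) → List (Call K) × Finset (Fin K)
  | [] => ([], Finset.univ)
  | f :: fs =>
    if t ≤ f.start + f.dur then (f :: fs, survivors C T obs f.start t f.loc)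
    else resume C T obs t fs

/-- The innermost call saves the active set locally. -/
def saveLocal {K : ℕ} (A : Finset (Fin K)) : List (Call K) → List (Call K)
  | [] => []
  | f :: fs => { f with loc := A } :: fs

/-- What follows the duel of round `t`: update the good set, save the active set, increment the
round, and then start a new episode if no good arm is left, run a scheduled child replay on all
arms, or continue. -/
def afterDuel {K T : ℕ} (C : ℝ) (t : ℕ) (σ : State K T) (o : Obs K) : PMF (State K T) :=
  let obs' : ℕ → Obs K := Function.update σ.obs t o
  let good' := survivors C T obs' σ.epStart t σ.good
  let stack' := saveLocal σ.active σ.stack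
  if good' = ∅ then newEpisode (t + 1) obs'
  else
    match scheduledChild σ.sched (t + 1) with
    | some m =>
      PMF.pure
        { epStart := σ.epStart
          good := good'
          sched := σ.sched
          stack := ⟨t + 1, m, Finset.univ⟩ :: stack'
          active := Finset.univ
          obs := obs' }
    | none =>
      let next := resume C T obs' (t + 1) stack'
      PMF.pure
        { epStart := σ.epStart
          good := good'
          sched := σ.sched
          stack := next.1
          active := next.2
          obs := obs' }

/-- Round `t`: the arms `a_t` and `b_t` are drawn independently and uniformly from `A_t`, and the
feedback is `o_t ~ Ber(P_t(a_t, b_t))`. -/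
def playRound {K T : ℕ} [NeZero K] (C : ℝ) (P : ℕ → PrefMatrix K) (t : ℕ) (σ : State K T) :
    PMF (State K T) :=
  (uniformArm σ.active).bind fun a =>
    (uniformArm σ.active).bind fun b =>
      (coin ((P t).prob a b)).bind fun o =>
        afterDuel C t σ ⟨σ.active, a, b, o⟩

/-- The law of the state of ANACONDA (with horizon `T` and elimination constant `C`) after `n`
rounds; the rounds are `1, 2, …, T`. Nothing is recorded before round `1`. -/
def anaconda {K : ℕ} [NeZero K] (C : ℝ) (T : ℕ) (P : ℕ → PrefMatrix K) : ℕ → PMF (State K T)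
  | 0 => newEpisode 1 fun _ => ⟨∅, 0, 0, false⟩
  | n + 1 => (anaconda C T P n).bind (playRound C P (n + 1))

/-- The law of the sequence of played pairs; entry `i` is `(a_t, b_t)` for the round `t = i + 1`. -/
def playLaw {K : ℕ} [NeZero K] (C : ℝ) (T : ℕ) (P : ℕ → PrefMatrix K) :
    PMF (Fin T → Fin K × Fin K) :=
  (anaconda C T P T).map fun σ i => ((σ.obs (i + 1)).fst, (σ.obs (i + 1)).snd)

/-- The dynamic regret `∑_{t=1}^T (δ_t(a_t^*, a_t) + δ_t(a_t^*, b_t)) / 2` of a sequence of pairs. -/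
def dynamicRegret {K T : ℕ} (P : ℕ → PrefMatrix K) (cw : ℕ → Fin K)
    (h : Fin T → Fin K × Fin K) : ℝ :=
  ∑ i : Fin T, ((P (i + 1)).gap (cw (i + 1)) (h i).1 + (P (i + 1)).gap (cw (i + 1)) (h i).2) / 2

/-- The expected dynamic regret `DR(T)` of ANACONDA. -/
def expectedRegret {K : ℕ} [NeZero K] (C : ℝ) (T : ℕ) (P : ℕ → PrefMatrix K)
    (cw : ℕ → Fin K) : ℝ :=
  ∑ h : Fin T → Fin K × Fin K, (playLaw C T P h).toReal * dynamicRegret P cw h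

end DuelingBandit

end

noncomputable section

namespace DuelingBandit

open scoped ENNReal

/-! ## Summation lemmas -/

/-! The analysis compares everything to an arm `b` that is not eliminated during an episode. Strong
transitivity and the triangle inequality give δ(w,a) ≤ 2 δ(w,b) + δ(b,a) for the Condorcet winner
`w`, so the regret of an episode splits into the regret of `b` and the average gap of the active
arms to `b`.

Gaps to `b`: the active set of a round consists of the arms not eliminated since the start of the
call that plays it. Calls are nested, so the average over this set telescopes along the chain of
calls running in that round. Over the span of one call the sets of arms alive for it, or for its
parent, only shrink, and these arms are active together with `b`, so no sum of gaps to `b` is large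
in either direction. Averaging over shrinking sets costs a harmonic number (`sum_average_le`), and
each call contributes about log²T · K · √span (`Episode.sum_average_active_le`). A typical schedule
keeps the sum of √span of order log T · √n for an episode of length n (`Episode.sum_sqrt_span_le`).

Regret of `b`: each phase between significant switches has a safe arm, which no replay inside the
phase can eliminate. If `b` loses clearly to it over a segment of length l, every replay that starts
in the first quarter of the segment and covers the rest would eliminate `b`; such replays have total
probability of order √(l/n) (`sqrt_le_replayMass`). Fixed sets of replays with weight above 5 log T
are hit with high probability, so the segments on which `b` loses have total weight O(log T), and
their cost is of order log²T · K · √n (`sum_le_add_replayMass`, `Episode.sum_wellTimed_le`).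

Finally √n is at most twice the sum of √length over the phases met by the episode, and each phase
meets at most two episodes: an episode lying inside a phase would leave no arm safe and thereby end
it (`IsPath.card_episodes_le_two`). The exceptional events are an estimate far from its conditional
mean (`prob_not_concentrated_le`) and an untypical schedule (`prob_badSchedule_le`); both have
probability O(T⁻²). The bound by `numCWSwitches` holds because an arm that remains the winner
throughout a phase has no regret there. -/

lemma sum_Icc_eq_add_sum_Icc_succ {p v : ℕ} (h : p ≤ v) (f : ℕ → ℝ) :
    ∑ t ∈ Finset.Icc p v, f t = f p + ∑ t ∈ Finset.Icc (p + 1) v, f t := by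
  rw [← Finset.insert_Icc_succ_left_eq_Icc h, Finset.sum_insert (by simp)]
  rfl

/-- Abel summation: a nondecreasing nonnegative weight costs at most its last value. -/
lemma sum_mul_le_of_suffix_le (x : ℕ → ℝ) (M : ℝ) (n : ℕ) : ∀ (p : ℕ) (u : ℕ → ℝ),
    (∀ t, p ≤ t → t ≤ p + n → 0 ≤ u t) →
    (∀ t t', p ≤ t → t ≤ t' → t' ≤ p + n → u t ≤ u t') →
    (∀ r, p ≤ r → r ≤ p + n → ∑ t ∈ Finset.Icc r (p + n), x t ≤ M) →
    ∑ t ∈ Finset.Icc p (p + n), u t * x t ≤ u (p + n) * M := by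
  induction n with
  | zero =>
    intro p u hu _ hx
    simpa using mul_le_mul_of_nonneg_left (by simpa using hx p le_rfl (by simp))
      (hu p le_rfl (by simp))
  | succ n ih =>
    intro p u hu hm hx
    have e : p + (n + 1) = p + 1 + n := by ring
    rw [e] at hu hm hx ⊢
    -- Peel off the constant weight `u p`: the remaining weight `u - u p` vanishes at `p` and is
    -- again nonnegative and nondecreasing, so the induction hypothesis applies from `p + 1` on.
    have key : ∑ t ∈ Finset.Icc p (p + 1 + n), u t * x t =
        u p * ∑ t ∈ Finset.Icc p (p + 1 + n), x t +
          ∑ t ∈ Finset.Icc (p + 1) (p + 1 + n), (u t - u p) * x t := by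
      rw [sum_Icc_eq_add_sum_Icc_succ (by omega), sum_Icc_eq_add_sum_Icc_succ (f := x) (by omega),
        mul_add, Finset.mul_sum, add_assoc (u p * x p), ← Finset.sum_add_distrib]
      congr 1
      exact Finset.sum_congr rfl fun t _ => by ring
    have h1 := ih (p + 1) (fun t => u t - u p)
      (fun t h1 h2 => sub_nonneg.2 (hm p t le_rfl (by omega) h2))
      (fun t t' h1 h2 h3 => sub_le_sub_right (hm t t' (by omega) h2 h3) _)
      (fun r h1 h2 => hx r (by omega) h2)
    have h2 := mul_le_mul_of_nonneg_left (hx p le_rfl (by omega)) (hu p le_rfl (by omega))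
    rw [key]
    linarith

/-- Summing the reciprocals of the ranks of the elements of a finite set, ties being broken in
favour of a larger rank, gives at most a harmonic number. -/
lemma sum_inv_rank_le_harmonic {ι : Type*} [DecidableEq ι] (v : ι → ℕ) (S : Finset ι) :
    ∑ a ∈ S, ((S.filter fun b => v a ≤ v b).card : ℝ)⁻¹ ≤ (harmonic S.card : ℝ) := by
  induction S using Finset.induction_on_min_value v with
  | empty => simp
  | insert a s ha hmin ih =>
    rw [Finset.sum_insert ha, Finset.card_insert_of_notMem ha, harmonic_succ]
    push_cast
    have h1 : (insert a s).filter (fun b => v a ≤ v b) = insert a s := by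
      apply Finset.filter_true_of_mem
      intro b hb
      rcases Finset.mem_insert.1 hb with rfl | hb
      exacts [le_rfl, hmin b hb]
    rw [h1, Finset.card_insert_of_notMem ha]
    push_cast
    -- The new element has minimal rank, so it enters the other sets only through ties, which
    -- decreases the reciprocals.
    have h2 : ∑ x ∈ s, (((insert a s).filter fun b => v x ≤ v b).card : ℝ)⁻¹ ≤
        ∑ x ∈ s, ((s.filter fun b => v x ≤ v b).card : ℝ)⁻¹ := by
      refine Finset.sum_le_sum fun x hx => ?_
      apply inv_anti₀
      · exact_mod_cast Finset.card_pos.2 ⟨x, by simp [hx]⟩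
      · exact_mod_cast Finset.card_le_card (Finset.filter_subset_filter _ (Finset.subset_insert _ _))
    linarith

/-- Averages over a decreasing family of sets: if every element has partial sums of at most `M`
while it is a member, then the sum of the averages is at most `M` times a harmonic number. -/
lemma sum_average_le {ι : Type*} [DecidableEq ι] (D : ℕ → Finset ι) (x : ι → ℕ → ℝ) {M : ℝ}
    (hM : 0 ≤ M) {p q : ℕ}
    (hD : ∀ t t', p ≤ t → t ≤ t' → t' ≤ q → D t' ⊆ D t)
    (hx : ∀ a r v, p ≤ r → r ≤ v → v ≤ q → a ∈ D v → ∑ t ∈ Finset.Icc r v, x a t ≤ M) :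
    ∑ t ∈ Finset.Icc p q, (∑ a ∈ D t, x a t) / (D t).card ≤ M * (harmonic (D p).card : ℝ) := by
  classical
  rcases lt_or_ge q p with hqp | hpq
  · rw [Finset.Icc_eq_empty (by omega), Finset.sum_empty]
    have : (0 : ℚ) ≤ harmonic (D p).card := by unfold harmonic; positivity
    have : (0 : ℝ) ≤ (harmonic (D p).card : ℝ) := by exact_mod_cast this
    positivity
  -- `v a` is the last time at which `a` is a member. On `[p, v a]` the weight `1 / |D t|` is
  -- nondecreasing, so Abel summation bounds the share of `a` by `M / |D (v a)|`; and `D (v a)`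
  -- contains every element that leaves no earlier than `a`.
  let v : ι → ℕ := fun a => ((Finset.Icc p q).filter fun t => a ∈ D t).sup id
  have hne : ∀ a ∈ D p, ((Finset.Icc p q).filter fun t => a ∈ D t).Nonempty := fun a ha =>
    ⟨p, by simp [ha, hpq]⟩
  have hv : ∀ a ∈ D p, p ≤ v a ∧ v a ≤ q ∧ a ∈ D (v a) := by
    intro a ha
    obtain ⟨t, ht, htv⟩ := Finset.exists_mem_eq_sup _ (hne a ha) id
    simp only [Finset.mem_filter, Finset.mem_Icc, id] at ht htv
    have e : v a = t := htv
    rw [e]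
    exact ⟨ht.1.1, ht.1.2, ht.2⟩
  have hvt : ∀ a ∈ D p, ∀ t ∈ Finset.Icc p q, (a ∈ D t ↔ t ∈ Finset.Icc p (v a)) := by
    intro a ha t ht
    rw [Finset.mem_Icc] at ht ⊢
    constructor
    · intro h
      exact ⟨ht.1, Finset.le_sup (f := id) (by simp [ht, h])⟩
    · intro h
      exact hD t (v a) h.1 h.2 (hv a ha).2.1 (hv a ha).2.2
  have h1 : ∑ t ∈ Finset.Icc p q, (∑ a ∈ D t, x a t) / (D t).card =
      ∑ a ∈ D p, ∑ t ∈ Finset.Icc p (v a), ((D t).card : ℝ)⁻¹ * x a t := by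
    have : ∀ t ∈ Finset.Icc p q, (∑ a ∈ D t, x a t) / (D t).card =
        ∑ a ∈ D p, if a ∈ D t then ((D t).card : ℝ)⁻¹ * x a t else 0 := by
      intro t ht
      rw [Finset.mem_Icc] at ht
      rw [← Finset.sum_filter, Finset.filter_mem_eq_inter,
        Finset.inter_eq_right.2 (hD p t le_rfl ht.1 ht.2), ← Finset.mul_sum, div_eq_inv_mul]
    rw [Finset.sum_congr rfl this, Finset.sum_comm]
    refine Finset.sum_congr rfl fun a ha => ?_
    rw [← Finset.sum_filter]
    congr 1
    ext t
    rw [Finset.mem_filter]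
    constructor
    · rintro ⟨h, h'⟩
      exact (hvt a ha t h).1 h'
    · intro h
      have : t ∈ Finset.Icc p q := by
        rw [Finset.mem_Icc] at h ⊢
        exact ⟨h.1, h.2.trans (hv a ha).2.1⟩
      exact ⟨this, (hvt a ha t this).2 h⟩
  have h2 : ∀ a ∈ D p, ∑ t ∈ Finset.Icc p (v a), ((D t).card : ℝ)⁻¹ * x a t ≤
      ((D (v a)).card : ℝ)⁻¹ * M := by
    intro a ha
    obtain ⟨h1, h2, h3⟩ := hv a ha
    obtain ⟨n, hn⟩ := Nat.exists_eq_add_of_le h1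
    have := sum_mul_le_of_suffix_le (x a) M n p (fun t => ((D t).card : ℝ)⁻¹)
      (fun t _ _ => by positivity)
      (fun t t' ht ht' ht'' => by
        apply inv_anti₀
        · have : a ∈ D t' := (hvt a ha t' (by rw [Finset.mem_Icc]; omega)).2
            (by rw [Finset.mem_Icc]; omega)
          exact_mod_cast Finset.card_pos.2 ⟨a, this⟩
        · exact_mod_cast Finset.card_le_card (hD t t' ht ht' (by omega)))
      (fun r hr hr' => by
        rw [← hn] at hr' ⊢
        exact hx a r (v a) hr hr' h2 h3)
    rwa [← hn] at this
  rw [h1]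
  calc _ ≤ ∑ a ∈ D p, ((D (v a)).card : ℝ)⁻¹ * M := Finset.sum_le_sum h2
    _ ≤ ∑ a ∈ D p, (((D p).filter fun b => v a ≤ v b).card : ℝ)⁻¹ * M := by
      refine Finset.sum_le_sum fun a ha => mul_le_mul_of_nonneg_right ?_ hM
      apply inv_anti₀
      · exact_mod_cast Finset.card_pos.2 ⟨a, by simp [ha]⟩
      · have : (D p).filter (fun b => v a ≤ v b) ⊆ D (v a) := by
          intro b hb
          rw [Finset.mem_filter] at hb
          exact hD (v a) (v b) (hv a ha).1 hb.2 (hv b hb.1).2.1 (hv b hb.1).2.2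
        exact_mod_cast Finset.card_le_card this
    _ = (∑ a ∈ D p, (((D p).filter fun b => v a ≤ v b).card : ℝ)⁻¹) * M := by
      rw [Finset.sum_mul]
    _ ≤ _ := by
      rw [mul_comm]
      exact mul_le_mul_of_nonneg_left (sum_inv_rank_le_harmonic v (D p)) hM

/-- Telescoping along the elements of a finite set of naturals. -/
lemma sum_sub_pred_eq (G : ℕ → ℝ) (S : Finset ℕ) (hS : S.Nonempty) :
    ∑ s ∈ S, (G s - if h : (S.filter (· < s)).Nonempty then G ((S.filter (· < s)).max' h) else 0) =
      G (S.max' hS) := by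
  induction S using Finset.induction_on_max with
  | empty => exact absurd hS (by simp)
  | insert a s ha ih =>
    have has : a ∉ s := fun h => lt_irrefl _ (ha a h)
    rw [Finset.sum_insert has]
    have hmax : (insert a s).max' hS = a := by
      apply le_antisymm
      · apply Finset.max'_le
        intro y hy
        rcases Finset.mem_insert.1 hy with rfl | hy
        exacts [le_rfl, (ha y hy).le]
      · exact Finset.le_max' _ _ (Finset.mem_insert_self _ _)
    have hfa : (insert a s).filter (· < a) = s := by
      ext y
      simp only [Finset.mem_filter, Finset.mem_insert]
      constructor
      · rintro ⟨rfl | h, h'⟩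
        exacts [absurd h' (lt_irrefl _), h]
      · exact fun h => ⟨Or.inr h, ha y h⟩
    have hfs : ∀ y ∈ s, (insert a s).filter (· < y) = s.filter (· < y) := by
      intro y hy
      rw [Finset.filter_insert, if_neg (not_lt.2 (ha y hy).le)]
    have hsum : ∑ y ∈ s, (G y - if h : ((insert a s).filter (· < y)).Nonempty then
        G (((insert a s).filter (· < y)).max' h) else 0) =
        ∑ y ∈ s, (G y - if h : (s.filter (· < y)).Nonempty then
          G ((s.filter (· < y)).max' h) else 0) := by
      refine Finset.sum_congr rfl fun y hy => ?_
      simp only [hfs y hy]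
    rw [hsum, hmax]
    simp only [hfa]
    rcases s.eq_empty_or_nonempty with rfl | hs
    · simp
    · rw [ih hs, dif_pos hs]
      ring

/-! ## Gaps -/

namespace PrefMatrix
variable {K : ℕ} (P : PrefMatrix K)

lemma gap_neg (a b : Fin K) : P.gap a b = -P.gap b a := by
  have := P.symm a b
  unfold gap
  linarith

lemma gap_le (a b : Fin K) : P.gap a b ≤ 1 / 2 := by
  have := (P.prob a b).2.2
  unfold gap
  linarith

lemma abs_gap_le (a b : Fin K) : |P.gap a b| ≤ 1 / 2 :=
  abs_le.2 ⟨by linarith [P.gap_neg a b, P.gap_le b a], P.gap_le a b⟩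

variable {P}

lemma IsCondorcetWinner.pref {w : Fin K} (h : P.IsCondorcetWinner w) (a : Fin K) : P.Pref w a := by
  unfold Pref
  rcases eq_or_ne a w with rfl | ha
  · exact (P.diag a).ge
  · exact (h a ha).le

lemma IsCondorcetWinner.gap_nonneg {w : Fin K} (h : P.IsCondorcetWinner w) (a : Fin K) :
    0 ≤ P.gap w a :=
  sub_nonneg.2 (h.pref a)

/-- If `a` is preferred over `b`, this is transitivity through `a`; otherwise the left side is
negative and the right side is not. -/
lemma IsCondorcetWinner.gap_le_gap {w : Fin K} (h : P.IsCondorcetWinner w) (hs : P.SST)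
    (a b : Fin K) : P.gap a b ≤ P.gap w b := by
  by_cases hab : P.Pref a b
  · exact (le_max_right _ _).trans (hs w a b (h.pref a) hab)
  · have : P.gap a b < 0 := sub_neg.2 (not_le.1 hab)
    exact this.le.trans (h.gap_nonneg b)

/-- The triangle inequality through an arm `b` which need not lie between the two others. -/
lemma IsCondorcetWinner.gap_le_two_mul_gap_add {w : Fin K} (h : P.IsCondorcetWinner w) (hs : P.SST)
    (ht : P.STI) (a b : Fin K) : P.gap w a ≤ 2 * P.gap w b + P.gap b a := by
  -- If `a` lies between `w` and `b`, transitivity bounds both δ(w,a) and δ(a,b) by δ(w,b); this is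
  -- where the factor two is needed.
  by_cases hba : P.Pref b a
  · linarith [ht w b a (h.pref b) hba, h.gap_nonneg b]
  · have hab : P.Pref a b := by
      have := P.symm a b
      unfold Pref at *
      linarith
    have := hs w a b (h.pref a) hab
    linarith [(le_max_left _ _).trans this, (le_max_right _ _).trans this, P.gap_neg b a]

end PrefMatrix

/-! ## Significant switches -/

section Switches
variable {K : ℕ} {T : ℕ} {P : ℕ → PrefMatrix K} {cw : ℕ → Fin K}

lemma NoSafeArm.mono {τ r τ' r' : ℕ} (h : NoSafeArm P cw τ r) (h1 : τ' ≤ τ) (h2 : r ≤ r') :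
    NoSafeArm P cw τ' r' := fun a => by
  obtain ⟨s₁, s₂, h3, h4, h5, h6⟩ := h a
  exact ⟨s₁, s₂, h1.trans h3, h4, h5.trans_le h2, h6⟩

lemma sigSwitch_succ_mem (i : ℕ) : sigSwitch T P cw (i + 1) ∈
    ({r | sigSwitch T P cw i ≤ r ∧ r < T ∧ NoSafeArm P cw (sigSwitch T P cw i) r} ∪ {T} : Set ℕ) := by
  rw [sigSwitch]
  exact Nat.sInf_mem ⟨T, by simp⟩

lemma sigSwitch_succ_le (i : ℕ) : sigSwitch T P cw (i + 1) ≤ T := by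
  rw [sigSwitch]
  exact Nat.sInf_le (by simp)

lemma sigSwitch_succ_le_of_noSafeArm {i r : ℕ} (h1 : sigSwitch T P cw i ≤ r) (h2 : r < T)
    (h : NoSafeArm P cw (sigSwitch T P cw i) r) : sigSwitch T P cw (i + 1) ≤ r := by
  rw [sigSwitch]
  exact Nat.sInf_le (Or.inl ⟨h1, h2, h⟩)

lemma noSafeArm_of_sigSwitch_succ_lt {i : ℕ} (h : sigSwitch T P cw (i + 1) < T) :
    NoSafeArm P cw (sigSwitch T P cw i) (sigSwitch T P cw (i + 1)) := by
  rcases sigSwitch_succ_mem (T := T) (P := P) (cw := cw) i with h1 | h1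
  · exact h1.2.2
  · exact absurd h1 h.ne

lemma sigSwitch_le (hT : 1 ≤ T) (i : ℕ) : sigSwitch T P cw i ≤ T := by
  cases i with
  | zero => simpa [sigSwitch] using hT
  | succ i => exact sigSwitch_succ_le i

lemma one_le_sigSwitch (hT : 1 ≤ T) (i : ℕ) : 1 ≤ sigSwitch T P cw i := by
  induction i with
  | zero => simp [sigSwitch]
  | succ i ih =>
    rcases sigSwitch_succ_mem (T := T) (P := P) (cw := cw) i with h1 | h1
    · exact ih.trans h1.1
    · rw [h1]; exact hT

lemma sigSwitch_lt_succ [NeZero K] {i : ℕ} (h : sigSwitch T P cw i < T) :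
    sigSwitch T P cw i < sigSwitch T P cw (i + 1) := by
  rcases sigSwitch_succ_mem (T := T) (P := P) (cw := cw) i with h1 | h1
  · obtain ⟨s₁, s₂, h3, h4, h5, -⟩ := h1.2.2 0
    omega
  · rw [h1]; exact h

lemma sigSwitch_eq_of_eq {i : ℕ} (h : sigSwitch T P cw i = T) : sigSwitch T P cw (i + 1) = T := by
  rcases sigSwitch_succ_mem (T := T) (P := P) (cw := cw) i with h1 | h1
  · have := h1.1; have := h1.2.1; omega
  · exact h1

lemma sigSwitch_lt_of_succ_lt (hT : 1 ≤ T) {i : ℕ} (h : sigSwitch T P cw (i + 1) < T) :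
    sigSwitch T P cw i < T := by
  refine lt_of_le_of_ne (sigSwitch_le hT i) fun h1 => ?_
  have := sigSwitch_eq_of_eq h1
  omega

lemma sigSwitch_lt_of_le (hT : 1 ≤ T) {i j : ℕ} (hij : i ≤ j) (h : sigSwitch T P cw j < T) :
    sigSwitch T P cw i < T := by
  induction j, hij using Nat.le_induction with
  | base => exact h
  | succ j _ ih => exact ih (sigSwitch_lt_of_succ_lt hT h)

lemma lt_sigSwitch [NeZero K] (hT : 1 ≤ T) {i : ℕ} (h : sigSwitch T P cw i < T) :
    i < sigSwitch T P cw i := by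
  induction i with
  | zero => simp [sigSwitch]
  | succ i ih =>
    have h1 := sigSwitch_lt_of_succ_lt hT h
    have := ih h1
    have := sigSwitch_lt_succ h1
    omega

/-- The indices on the left form an initial segment of ℕ, and strict growth of the switches keeps it
below `T`. The counted set is therefore this whole segment, and its cardinality is its length. -/
lemma sigSwitch_succ_lt_iff [NeZero K] (hT : 1 ≤ T) (i : ℕ) :
    sigSwitch T P cw (i + 1) < T ↔ i < numSigSwitches T P cw := by
  have hlt : ∀ i, sigSwitch T P cw (i + 1) < T → i < T := fun i h => by
    have := lt_sigSwitch hT h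
    omega
  set F := (Finset.range T).filter fun i => sigSwitch T P cw (i + 1) < T with hF
  have hFm : ∀ i, i ∈ F ↔ sigSwitch T P cw (i + 1) < T := fun i => by
    rw [hF, Finset.mem_filter, Finset.mem_range]
    exact ⟨fun h => h.2, fun h => ⟨hlt i h, h⟩⟩
  have hcard : numSigSwitches T P cw = F.card := rfl
  rw [hcard]
  constructor
  · intro h
    have : Finset.range (i + 1) ⊆ F := fun j hj => by
      rw [Finset.mem_range] at hj
      exact (hFm j).2 (sigSwitch_lt_of_le hT (by omega) h)
    have := Finset.card_le_card this
    rw [Finset.card_range] at this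
    omega
  · intro h
    by_contra h1
    have : F ⊆ Finset.range i := fun j hj => by
      rw [Finset.mem_range]
      by_contra h2
      exact h1 (sigSwitch_lt_of_le hT (by omega) ((hFm j).1 hj))
    have := Finset.card_le_card this
    rw [Finset.card_range] at this
    omega

lemma sigSwitch_lt [NeZero K] (hT : 2 ≤ T) {i : ℕ} (hi : i ≤ numSigSwitches T P cw) :
    sigSwitch T P cw i < T := by
  cases i with
  | zero => rw [sigSwitch]; omega
  | succ i => exact (sigSwitch_succ_lt_iff (by omega) i).2 (by omega)

lemma sigSwitch_numSigSwitches_succ [NeZero K] (hT : 1 ≤ T) :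
    sigSwitch T P cw (numSigSwitches T P cw + 1) = T := by
  have := (sigSwitch_succ_lt_iff (P := P) (cw := cw) hT (numSigSwitches T P cw)).not.2 (lt_irrefl _)
  have := sigSwitch_succ_le (T := T) (P := P) (cw := cw) (numSigSwitches T P cw)
  omega

lemma sigSwitch_strictMono [NeZero K] (hT : 2 ≤ T) {i j : ℕ} (hij : i < j)
    (hj : j ≤ numSigSwitches T P cw + 1) : sigSwitch T P cw i < sigSwitch T P cw j := by
  induction j, hij using Nat.le_induction with
  | base => exact sigSwitch_lt_succ (sigSwitch_lt hT (by omega))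
  | succ j _ ih => exact (ih (by omega)).trans (sigSwitch_lt_succ (sigSwitch_lt hT (by omega)))

/-- Every round lies between two consecutive significant switches. -/
lemma exists_phase [NeZero K] (hT : 2 ≤ T) {t : ℕ} (h1 : 1 ≤ t) (h2 : t ≤ T) :
    ∃ i ∈ Finset.range (numSigSwitches T P cw + 1),
      sigSwitch T P cw i ≤ t ∧ t ≤ sigSwitch T P cw (i + 1) := by
  by_contra! h
  have : ∀ i, i ≤ numSigSwitches T P cw + 1 → sigSwitch T P cw i ≤ t := by
    intro i
    induction i with
    | zero => intro _; simpa [sigSwitch] using h1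
    | succ i ih =>
      intro hi
      exact (h i (by rw [Finset.mem_range]; omega) (ih (by omega))).le
  have h3 := h (numSigSwitches T P cw) (by simp) (this _ (by omega))
  rw [sigSwitch_numSigSwitches_succ (by omega)] at h3
  omega

/-- In every phase some arm stays safe until the round before the last one. -/
lemma exists_safeArm [NeZero K] (hT : 2 ≤ T) {i : ℕ} (hi : i ≤ numSigSwitches T P cw) :
    ∃ a : Fin K, ∀ s₁ s₂ : ℕ, sigSwitch T P cw i ≤ s₁ → s₁ < s₂ →
      s₂ < sigSwitch T P cw (i + 1) - 1 →
      ∑ t ∈ Finset.Icc s₁ s₂, (P t).gap (cw t) a < √((K : ℝ) * ((s₂ : ℝ) - (s₁ : ℝ))) := by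
  by_contra! h
  have h1 := sigSwitch_lt_succ (sigSwitch_lt (P := P) (cw := cw) hT hi)
  have h2 := sigSwitch_succ_le (T := T) (P := P) (cw := cw) i
  -- The negated claim is `NoSafeArm` one round before the next switch. That round is below `T` even
  -- in the last phase, so it contradicts minimality.
  have := sigSwitch_succ_le_of_noSafeArm (T := T) (P := P) (cw := cw) (i := i)
    (r := sigSwitch T P cw (i + 1) - 1) (by omega) (by omega) h
  omega

/-- Between two significant switches the Condorcet winner changes. -/
lemma numSigSwitches_le_numCWSwitches [NeZero K] (hT : 2 ≤ T) :
    numSigSwitches T P cw ≤ numCWSwitches T cw := by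
  have key : ∀ i, i < numSigSwitches T P cw → ∃ t, sigSwitch T P cw i < t ∧
      t < sigSwitch T P cw (i + 1) ∧ cw t ≠ cw (t - 1) := by
    intro i hi
    by_contra! h
    have h1 := (sigSwitch_succ_lt_iff (P := P) (cw := cw) (by omega) i).2 hi
    have hconst : ∀ t, sigSwitch T P cw i ≤ t → t < sigSwitch T P cw (i + 1) →
        cw t = cw (sigSwitch T P cw i) := by
      intro t ht
      induction t, ht using Nat.le_induction with
      | base => intro _; rfl
      | succ t ht ih =>
        intro h2
        rw [h (t + 1) (by omega) h2, Nat.add_sub_cancel, ih (by omega)]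
    -- A winner that never changes has zero regret in the phase, whereas the threshold is positive.
    obtain ⟨s₁, s₂, h3, h4, h5, h6⟩ := noSafeArm_of_sigSwitch_succ_lt h1 (cw (sigSwitch T P cw i))
    rw [Finset.sum_eq_zero] at h6
    · have hK : (0 : ℝ) < K := by exact_mod_cast NeZero.pos K
      have h7 : (s₁ : ℝ) < s₂ := by exact_mod_cast h4
      exact absurd h6 (not_le.2 (Real.sqrt_pos.2 (mul_pos hK (sub_pos.2 h7))))
    · intro t ht
      rw [Finset.mem_Icc] at ht
      rw [hconst t (by omega) (by omega)]
      simp [PrefMatrix.gap, (P t).diag]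
  choose! f hf using key
  have hle : ∀ i, i < numSigSwitches T P cw → ∀ j, j < numSigSwitches T P cw → i < j → f i < f j := by
    intro i hi j hj hij
    have h1 := hf i hi
    have h2 := hf j hj
    have h3 : sigSwitch T P cw (i + 1) ≤ sigSwitch T P cw j := by
      rcases eq_or_lt_of_le (Nat.succ_le_of_lt hij) with h | h
      · exact (congrArg _ h).le
      · exact (sigSwitch_strictMono hT h (by omega)).le
    omega
  calc numSigSwitches T P cw = (Finset.range (numSigSwitches T P cw)).card := by simp
    _ ≤ _ := by
      refine Finset.card_le_card_of_injOn f ?_ ?_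
      · intro i hi
        rw [Finset.mem_coe, Finset.mem_range] at hi
        have h1 := hf i hi
        have h2 := one_le_sigSwitch (T := T) (P := P) (cw := cw) (by omega) i
        have h3 := sigSwitch_succ_le (T := T) (P := P) (cw := cw) i
        rw [Finset.mem_coe, Finset.mem_filter, Finset.mem_Icc]
        exact ⟨⟨by omega, by omega⟩, h1.2.2⟩
      · intro i hi j hj hij
        rw [Finset.mem_coe, Finset.mem_range] at hi hj
        rcases lt_trichotomy i j with h | h | h
        · exact absurd hij (hle i hi j hj h).ne
        · exact h
        · exact absurd hij (hle j hj i hi h).ne'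

lemma sum_sigSwitch_sub [NeZero K] (hT : 1 ≤ T) :
    ∑ i ∈ Finset.range (numSigSwitches T P cw + 1),
      ((sigSwitch T P cw (i + 1) : ℝ) - sigSwitch T P cw i) = T - 1 := by
  rw [Finset.sum_range_sub (fun i => (sigSwitch T P cw i : ℝ)), sigSwitch_numSigSwitches_succ hT]
  simp [sigSwitch]

/-- Cauchy-Schwarz for the lengths of the phases. -/
lemma sum_sqrt_sigSwitch_le [NeZero K] (hT : 2 ≤ T) :
    ∑ i ∈ Finset.range (numSigSwitches T P cw + 1),
      √((sigSwitch T P cw (i + 1) : ℝ) - sigSwitch T P cw i) ≤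
      2 * √((max (numSigSwitches T P cw) 1 : ℕ) * (T : ℝ)) := by
  have hnn : ∀ i ∈ Finset.range (numSigSwitches T P cw + 1),
      (0 : ℝ) ≤ (sigSwitch T P cw (i + 1) : ℝ) - sigSwitch T P cw i := fun i hi => by
    rw [Finset.mem_range] at hi
    exact sub_nonneg.2 (by exact_mod_cast (sigSwitch_strictMono hT (Nat.lt_succ_self i) (by omega)).le)
  have h1 := sq_sum_le_card_mul_sum_sq (s := Finset.range (numSigSwitches T P cw + 1))
    (f := fun i => √((sigSwitch T P cw (i + 1) : ℝ) - sigSwitch T P cw i))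
  rw [Finset.sum_congr rfl fun i hi => Real.sq_sqrt (hnn i hi), sum_sigSwitch_sub (by omega),
    Finset.card_range] at h1
  have hTr : (2 : ℝ) ≤ T := by exact_mod_cast hT
  have hm : ((numSigSwitches T P cw + 1 : ℕ) : ℝ) ≤ 2 * (max (numSigSwitches T P cw) 1 : ℕ) := by
    exact_mod_cast (by omega : numSigSwitches T P cw + 1 ≤ 2 * max (numSigSwitches T P cw) 1)
  set m : ℝ := ((max (numSigSwitches T P cw) 1 : ℕ) : ℝ)
  have hm0 : 0 ≤ m := by positivity
  refine abs_le_of_sq_le_sq' ?_ (by positivity) |>.2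
  rw [mul_pow, Real.sq_sqrt (by positivity)]
  nlinarith

/-- The lengths add up to `T - 1 ≥ T / 2`, and a sum of squares of nonnegative numbers is at most
the square of their sum. This lets the phase sum absorb additive constants. -/
lemma sqrt_le_sum_sqrt_sigSwitch [NeZero K] (hT : 2 ≤ T) :
    √(T : ℝ) ≤ 2 * ∑ i ∈ Finset.range (numSigSwitches T P cw + 1),
      √((sigSwitch T P cw (i + 1) : ℝ) - sigSwitch T P cw i) := by
  have hnn : ∀ i ∈ Finset.range (numSigSwitches T P cw + 1),
      (0 : ℝ) ≤ (sigSwitch T P cw (i + 1) : ℝ) - sigSwitch T P cw i := fun i hi => by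
    rw [Finset.mem_range] at hi
    exact sub_nonneg.2 (by exact_mod_cast (sigSwitch_strictMono hT (Nat.lt_succ_self i) (by omega)).le)
  have h1 := Finset.sum_sq_le_sq_sum_of_nonneg (s := Finset.range (numSigSwitches T P cw + 1))
    (f := fun i => √((sigSwitch T P cw (i + 1) : ℝ) - sigSwitch T P cw i))
    (fun i _ => Real.sqrt_nonneg _)
  rw [Finset.sum_congr rfl fun i hi => Real.sq_sqrt (hnn i hi), sum_sigSwitch_sub (by omega)] at h1
  have hTr : (2 : ℝ) ≤ T := by exact_mod_cast hT
  have h0 : 0 ≤ ∑ i ∈ Finset.range (numSigSwitches T P cw + 1),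
      √((sigSwitch T P cw (i + 1) : ℝ) - sigSwitch T P cw i) :=
    Finset.sum_nonneg fun i _ => Real.sqrt_nonneg _
  refine Real.sqrt_le_iff.2 ⟨by positivity, ?_⟩
  nlinarith

end Switches

/-! ## Elimination and concentration -/

lemma half_le_log {T : ℕ} (hT : 2 ≤ T) : (1 / 2 : ℝ) ≤ Real.log T := by
  have h1 : Real.log 2 ≤ Real.log T := Real.log_le_log (by norm_num) (by exact_mod_cast hT)
  have := Real.log_two_gt_d9
  linarith

section Elimination
variable {K : ℕ} {C : ℝ} {T : ℕ} {obs obs' : ℕ → Obs K} {lo lo' t t' : ℕ} {a : Fin K}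

lemma Eliminated.mono (h : Eliminated C T obs lo t a) (h1 : lo' ≤ lo) (h2 : t ≤ t') :
    Eliminated C T obs lo' t' a := by
  obtain ⟨s₁, s₂, h3, h4, h5, h6⟩ := h
  exact ⟨s₁, s₂, h1.trans h3, h4, h5.trans_le h2, h6⟩

lemma Eliminated.congr (h : Eliminated C T obs lo t a) (ho : ∀ s < t, obs s = obs' s) :
    Eliminated C T obs' lo t a := by
  obtain ⟨s₁, s₂, h3, h4, h5, a', h6⟩ := h
  refine ⟨s₁, s₂, h3, h4, h5, a', ?_⟩
  rw [Finset.sum_congr rfl fun s hs => by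
    rw [← ho s (by rw [Finset.mem_Icc] at hs; omega)]]
  exact h6

lemma eliminated_congr (ho : ∀ s < t, obs s = obs' s) :
    Eliminated C T obs lo t a ↔ Eliminated C T obs' lo t a :=
  ⟨fun h => h.congr ho, fun h => h.congr fun s hs => (ho s hs).symm⟩

end Elimination

/-- The conditional mean of the estimate of `δ(a, b)` when the arms are drawn from `A`. -/
def condMean {K : ℕ} (P : PrefMatrix K) (A : Finset (Fin K)) (a b : Fin K) : ℝ :=
  if a ∈ A ∧ b ∈ A then P.gap a b else -(1 / 2)

/-- When one of the two arms is inactive, the estimate is constantly `-1/2`, the least possible gap.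
Sums of estimates over rounds with an inactive arm can thus only understate a loss, so inactivity
never causes a false elimination. -/
lemma condMean_le_gap {K : ℕ} (P : PrefMatrix K) (A : Finset (Fin K)) (a b : Fin K) :
    condMean P A a b ≤ P.gap a b := by
  unfold condMean
  split_ifs
  · exact le_rfl
  · exact (abs_le.1 (P.abs_gap_le a b)).1

/-- All sums of estimates are close to the sums of their conditional means. -/
def Concentrated {K : ℕ} (T : ℕ) (P : ℕ → PrefMatrix K) (obs : ℕ → Obs K) : Prop :=
  ∀ (s₁ s₂ : ℕ) (a b : Fin K), 1 ≤ s₁ → s₁ < s₂ → s₂ ≤ T →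
    |∑ s ∈ Finset.Icc s₁ s₂, ((obs s).estimate a b - condMean (P s) (obs s).active a b)| ≤
      10 * Real.log T * K * √(max ((s₂ : ℝ) - (s₁ : ℝ)) ((K : ℝ) ^ 2))

section Concentration
variable {K T : ℕ} {P : ℕ → PrefMatrix K} {cw : ℕ → Fin K} {obs : ℕ → Obs K}

/-- An eliminated arm has large dynamic regret on some interval. -/
lemma Concentrated.exists_regret_of_eliminated [NeZero K] (hc : Concentrated T P obs) (hT : 2 ≤ T)
    (hcw : ∀ t ∈ Finset.Icc 1 T, (P t).IsCondorcetWinner (cw t))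
    (hs : ∀ t ∈ Finset.Icc 1 T, (P t).SST) {lo t : ℕ} {a : Fin K} (hlo : 1 ≤ lo) (ht : t ≤ T + 1)
    (h : Eliminated 20 T obs lo t a) :
    ∃ s₁ s₂ : ℕ, lo ≤ s₁ ∧ s₁ < s₂ ∧ s₂ < t ∧
      √((K : ℝ) * ((s₂ : ℝ) - (s₁ : ℝ))) ≤ ∑ t ∈ Finset.Icc s₁ s₂, (P t).gap (cw t) a := by
  obtain ⟨s₁, s₂, h1, h2, h3, a', h4⟩ := h
  refine ⟨s₁, s₂, h1, h2, h3, ?_⟩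
  -- The elimination constant 20 minus the error constant 10 leaves `10 log T · K · W`, which still
  -- exceeds the threshold of `NoSafeArm`.
  have h5 := (abs_le.1 (hc s₁ s₂ a' a (by omega) h2 (by omega))).2
  rw [Finset.sum_sub_distrib] at h5
  have h6 : ∑ s ∈ Finset.Icc s₁ s₂, condMean (P s) (obs s).active a' a ≤
      ∑ t ∈ Finset.Icc s₁ s₂, (P t).gap (cw t) a := by
    refine Finset.sum_le_sum fun t ht => (condMean_le_gap _ _ _ _).trans ?_
    rw [Finset.mem_Icc] at ht
    have : t ∈ Finset.Icc 1 T := by rw [Finset.mem_Icc]; omega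
    exact (hcw t this).gap_le_gap (hs t this) _ _
  set W := √(max ((s₂ : ℝ) - (s₁ : ℝ)) ((K : ℝ) ^ 2)) with hW
  have hK : (1 : ℝ) ≤ K := by exact_mod_cast NeZero.one_le
  have h7 : √((K : ℝ) * ((s₂ : ℝ) - (s₁ : ℝ))) ≤ K * W := by
    rw [Real.sqrt_mul (by positivity)]
    refine mul_le_mul ?_ (Real.sqrt_le_sqrt (le_max_left _ _)) (Real.sqrt_nonneg _) (by positivity)
    exact Real.sqrt_le_iff.2 ⟨by positivity, by nlinarith⟩
  have hL := half_le_log hT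
  have h8 : K * W ≤ 10 * Real.log T * K * W := by
    have : 0 ≤ K * W := by positivity
    nlinarith
  linarith

/-- An active arm which is beaten clearly by an active arm is eliminated. -/
lemma Concentrated.eliminated (hc : Concentrated T P obs) {lo t s₁ s₂ : ℕ} {a b : Fin K}
    (hlo : 1 ≤ lo) (h1 : lo ≤ s₁) (h2 : s₁ < s₂) (h3 : s₂ < t) (ht : t ≤ T + 1)
    (ha : ∀ s ∈ Finset.Icc s₁ s₂, a ∈ (obs s).active)
    (hb : ∀ s ∈ Finset.Icc s₁ s₂, b ∈ (obs s).active)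
    (h : 30 * Real.log T * K * √(max ((s₂ : ℝ) - (s₁ : ℝ)) ((K : ℝ) ^ 2)) <
      ∑ s ∈ Finset.Icc s₁ s₂, (P s).gap b a) :
    Eliminated 20 T obs lo t a := by
  refine ⟨s₁, s₂, h1, h2, h3, b, ?_⟩
  -- With both arms active the conditional means are the true gaps; 30 minus the error 10 is the
  -- elimination constant 20.
  have h5 := (abs_le.1 (hc s₁ s₂ b a (by omega) h2 (by omega))).1
  rw [Finset.sum_sub_distrib, Finset.sum_congr rfl fun s hs =>
    show condMean (P s) (obs s).active b a = (P s).gap b a from if_pos ⟨hb s hs, ha s hs⟩] at h5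
  linarith

lemma sum_gap_le_card (P : ℕ → PrefMatrix K) (a b : Fin K) {r v : ℕ} (h : r ≤ v) :
    ∑ t ∈ Finset.Icc r v, (P t).gap b a ≤ ((v : ℝ) - r + 1) / 2 := by
  calc _ ≤ ∑ t ∈ Finset.Icc r v, (1 / 2 : ℝ) := Finset.sum_le_sum fun t _ => (P t).gap_le b a
    _ = _ := by
      rw [Finset.sum_const, Nat.card_Icc, nsmul_eq_mul, Nat.cast_sub (by omega)]
      push_cast
      ring

/-- The contrapositive of `Concentrated.eliminated`. The last round is split off because the test at
`v` sees only earlier rounds. For length `n ≤ K²`, where the threshold is capped, the trivial bound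
`n / 2` is enough since `n ≤ K √n`. -/
lemma Concentrated.sum_gap_le [NeZero K] (hc : Concentrated T P obs) (hT : 2 ≤ T) {r v : ℕ}
    {a b : Fin K} (hr : 1 ≤ r) (hrv : r ≤ v) (hv : v ≤ T)
    (ha : ∀ s ∈ Finset.Icc r v, a ∈ (obs s).active)
    (hb : ∀ s ∈ Finset.Icc r v, b ∈ (obs s).active)
    (hel : ¬ Eliminated 20 T obs r v a) :
    ∑ t ∈ Finset.Icc r v, (P t).gap b a ≤ 32 * (Real.log T * K * √((v : ℝ) - r + 1)) := by
  have hL := half_le_log hT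
  have hK : (1 : ℝ) ≤ K := by exact_mod_cast NeZero.one_le
  have hrv' : (r : ℝ) ≤ v := by exact_mod_cast hrv
  set n : ℝ := (v : ℝ) - r + 1 with hn
  have hn1 : 1 ≤ n := by linarith
  have hsn : 1 ≤ √n := Real.one_le_sqrt.2 hn1
  have hLK : 1 / 2 ≤ Real.log T * K := by nlinarith
  have hw : 1 / 2 ≤ Real.log T * K * √n := by nlinarith
  rcases lt_or_ge v (r + 2) with h2 | h2
  · have h3 : (v : ℝ) ≤ r + 1 := by exact_mod_cast Nat.le_of_lt_succ h2
    have := sum_gap_le_card P a b hrv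
    linarith
  rcases le_or_gt n ((K : ℝ) ^ 2) with h3 | h3
  · have h4 : √n ≤ K := Real.sqrt_le_iff.2 ⟨by positivity, h3⟩
    have h5 : √n * √n = n := Real.mul_self_sqrt (by linarith)
    have h6 := sum_gap_le_card P a b hrv
    have h7 : √n * √n ≤ K * √n := mul_le_mul_of_nonneg_right h4 (by positivity)
    nlinarith
  · have h4 : ∑ t ∈ Finset.Icc r (v - 1), (P t).gap b a ≤
        30 * Real.log T * K * √(max (((v - 1 : ℕ) : ℝ) - (r : ℝ)) ((K : ℝ) ^ 2)) := by
      by_contra! h5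
      have hsub : ∀ s, s ∈ Finset.Icc r (v - 1) → s ∈ Finset.Icc r v := fun s hs => by
        rw [Finset.mem_Icc] at hs ⊢; omega
      exact hel (hc.eliminated hr le_rfl (by omega) (by omega) (by omega)
        (fun s hs => ha s (hsub s hs)) (fun s hs => hb s (hsub s hs)) h5)
    have h5 : max (((v - 1 : ℕ) : ℝ) - (r : ℝ)) ((K : ℝ) ^ 2) ≤ n := by
      rw [Nat.cast_sub (by omega)]
      push_cast
      exact max_le (by linarith) h3.le
    have h6 : 30 * Real.log T * K * √(max (((v - 1 : ℕ) : ℝ) - (r : ℝ)) ((K : ℝ) ^ 2)) ≤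
        30 * Real.log T * K * √n :=
      mul_le_mul_of_nonneg_left (Real.sqrt_le_sqrt h5) (by nlinarith)
    obtain ⟨w, rfl⟩ : ∃ w, v = w + 1 := ⟨v - 1, by omega⟩
    rw [Nat.add_sub_cancel] at h4 h6
    rw [Finset.sum_Icc_succ_top (by omega)]
    have := (P (w + 1)).gap_le b a
    linarith

end Concentration

/-! ## Episodes -/

/-- The rounds `e, …, u` of an episode that starts in round `e`, as far as they are described by
the observations, the schedule `B` and the start `own t` of the call which plays round `t`. -/
structure Episode {K : ℕ} (C : ℝ) (T : ℕ) (obs : ℕ → Obs K) (own : ℕ → ℕ) (B : Schedule T)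
    (e u : ℕ) : Prop where
  one_le : 1 ≤ e
  le : e ≤ u
  le_horizon : u ≤ T
  exists_good : ∃ b, ¬ Eliminated C T obs e (u - 1) b
  le_own : ∀ t, e ≤ t → t ≤ u → e ≤ own t
  own_le : ∀ t, e ≤ t → t ≤ u → own t ≤ t
  laminar : ∀ t v, e ≤ t → v ≤ u → own v ≤ t → t ≤ v → own v ≤ own t
  scheduled : ∀ t, e ≤ t → t ≤ u → own t ≠ e →
    ∃ p : Fin (T + 1) × Fin (Nat.clog 2 T), (p.1 : ℕ) = own t ∧ B p = true ∧
      t ≤ own t + 2 ^ ((p.2 : ℕ) + 1)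
  le_own_of_scheduled : ∀ t (p : Fin (T + 1) × Fin (Nat.clog 2 T)), e ≤ t → t ≤ u → B p = true →
    e < (p.1 : ℕ) → (p.1 : ℕ) ≤ t → t ≤ p.1 + 2 ^ ((p.2 : ℕ) + 1) → (p.1 : ℕ) ≤ own t
  mem_active : ∀ t a, e ≤ t → t ≤ u → (a ∈ (obs t).active ↔ ¬ Eliminated C T obs (own t) t a)

/-! ### Nested calls and the gaps of the active arms to a surviving arm -/

namespace Episode
variable {K T : ℕ} {obs : ℕ → Obs K} {own : ℕ → ℕ} {B : Schedule T} {e u : ℕ} {C : ℝ}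

/-- Membership in the active set is decided on `[own t, t)`, so surviving on a larger interval
suffices. This keeps a good arm, and every arm alive for an outer call, active inside all nested
replays. -/
lemma mem_active_of_not_eliminated (h : Episode C T obs own B e u) {t lo hi : ℕ} {a : Fin K}
    (h1 : e ≤ t) (h2 : t ≤ u) (ha : ¬ Eliminated C T obs lo hi a) (hlo : lo ≤ own t) (hhi : t ≤ hi) :
    a ∈ (obs t).active :=
  (h.mem_active t a h1 h2).2 fun h3 => ha (h3.mono hlo hhi)

/-- The starts of the calls which play the rounds of `[e, u)`. -/
def starts (own : ℕ → ℕ) (e u : ℕ) : Finset ℕ := (Finset.Ico e u).image own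

/-- The last round of `[e, u)` played by the call started in `s`. -/
def lastOwn (own : ℕ → ℕ) (e u s : ℕ) : ℕ := ((Finset.Ico e u).filter fun t => own t = s).sup id

lemma le_lastOwn {t : ℕ} (h1 : e ≤ t) (h2 : t < u) : t ≤ lastOwn own e u (own t) :=
  Finset.le_sup (f := id) (by simp [h1, h2])

lemma lastOwn_spec {s : ℕ} (hs : s ∈ starts own e u) :
    e ≤ lastOwn own e u s ∧ lastOwn own e u s < u ∧ own (lastOwn own e u s) = s := by
  obtain ⟨t, ht, hts⟩ := Finset.mem_image.1 hs
  have hne : ((Finset.Ico e u).filter fun t => own t = s).Nonempty := ⟨t, by simp [ht, hts]⟩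
  obtain ⟨v, hv, hvs⟩ := Finset.exists_mem_eq_sup _ hne id
  simp only [Finset.mem_filter, Finset.mem_Ico, id] at hv hvs
  have h2 : lastOwn own e u s = v := hvs
  rw [h2]
  exact ⟨hv.1.1, hv.1.2, hv.2⟩

lemma start_bounds (h : Episode C T obs own B e u) {s : ℕ} (hs : s ∈ starts own e u) :
    e ≤ s ∧ s ≤ lastOwn own e u s := by
  obtain ⟨h1, h2, h3⟩ := lastOwn_spec hs
  have h4 := h.le_own _ h1 h2.le
  have h5 := h.own_le _ h1 h2.le
  omega

/-- By laminarity, between its start and its last own round a call is interrupted only by calls that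
start later. -/
lemma start_le_own (h : Episode C T obs own B e u) {s t : ℕ} (hs : s ∈ starts own e u)
    (h1 : s ≤ t) (h2 : t ≤ lastOwn own e u s) : s ≤ own t := by
  obtain ⟨h3, h4, h5⟩ := lastOwn_spec hs
  have h6 := h.start_bounds hs
  have := h.laminar t _ (by omega) h4.le (by omega) h2
  omega

/-- The calls whose span contains `t`. -/
def chain (own : ℕ → ℕ) (e u t : ℕ) : Finset ℕ :=
  (starts own e u).filter fun s => s ≤ t ∧ t ≤ lastOwn own e u s

lemma own_mem_chain (h : Episode C T obs own B e u) {t : ℕ} (h1 : e ≤ t) (h2 : t < u) :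
    own t ∈ chain own e u t := by
  rw [chain, Finset.mem_filter]
  exact ⟨Finset.mem_image_of_mem _ (by simp [h1, h2]), h.own_le t h1 h2.le, le_lastOwn h1 h2⟩

/-- By `start_le_own`, the call playing round `t` is the latest-started one among those whose span
contains `t`. -/
lemma max'_chain (h : Episode C T obs own B e u) {t : ℕ} (h1 : e ≤ t) (h2 : t < u) :
    (chain own e u t).max' ⟨_, h.own_mem_chain h1 h2⟩ = own t := by
  apply le_antisymm
  · apply Finset.max'_le
    intro s hs
    rw [chain, Finset.mem_filter] at hs
    exact h.start_le_own hs.1 hs.2.1 hs.2.2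
  · exact Finset.le_max' _ _ (h.own_mem_chain h1 h2)

/-- An earlier call that is still open at `s` cannot end in the middle of the span of `s`, again by
laminarity. The parent of a call is thus the same in all rounds of its span, so telescoped terms can
be summed over the whole span. -/
lemma chain_filter_lt (h : Episode C T obs own B e u) {s t : ℕ} (hs : s ∈ chain own e u t) :
    (chain own e u t).filter (· < s) = (chain own e u s).filter (· < s) := by
  rw [chain, Finset.mem_filter] at hs
  ext s'
  simp only [chain, Finset.mem_filter]
  constructor
  · rintro ⟨⟨h1, h2, h3⟩, h4⟩
    exact ⟨⟨h1, h4.le, by omega⟩, h4⟩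
  · rintro ⟨⟨h1, h2, h3⟩, h4⟩
    refine ⟨⟨h1, by omega, ?_⟩, h4⟩
    by_contra! h5
    have h6 := lastOwn_spec h1
    have h7 := lastOwn_spec hs.1
    have h8 := h.start_le_own hs.1 h3 (by omega)
    omega

open Classical in
/-- The arms not eliminated on an interval inside `[s, t)`. -/
def alive (C : ℝ) (T : ℕ) (obs : ℕ → Obs K) (s t : ℕ) : Finset (Fin K) :=
  Finset.univ.filter fun a => ¬ Eliminated C T obs s t a

lemma mem_alive {s t : ℕ} {a : Fin K} : a ∈ alive C T obs s t ↔ ¬ Eliminated C T obs s t a := by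
  simp [alive]

lemma active_eq_alive (h : Episode C T obs own B e u) {t : ℕ} (h1 : e ≤ t) (h2 : t ≤ u) :
    (obs t).active = alive C T obs (own t) t := by
  ext a
  rw [h.mem_active t a h1 h2, mem_alive]

/-- Averages over the arms which are alive with respect to the start `p` of a call, summed over the
span of the call started in `s ≥ p`. -/
lemma sum_average_alive_le [NeZero K] {P : ℕ → PrefMatrix K} (h : Episode 20 T obs own B e u)
    (hc : Concentrated T P obs) (hT : 2 ≤ T) (hK : K ≤ T) {b : Fin K}
    (hb : ¬ Eliminated 20 T obs e (u - 1) b) {p s : ℕ} (hs : s ∈ starts own e u) (hp : p ≤ s) :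
    |∑ t ∈ Finset.Icc s (lastOwn own e u s),
      (∑ a ∈ alive 20 T obs p t, (P t).gap b a) / (alive 20 T obs p t).card| ≤
      96 * Real.log T ^ 2 * K * √((lastOwn own e u s : ℝ) - s + 1) := by
  have hL := half_le_log hT
  obtain ⟨hes, hsl⟩ := h.start_bounds hs
  obtain ⟨-, hlu, -⟩ := lastOwn_spec hs
  have hone := h.one_le
  have huT := h.le_horizon
  set v₀ := lastOwn own e u s with hv₀
  set M : ℝ := 32 * (Real.log T * K * √((v₀ : ℝ) - s + 1)) with hM
  have hM0 : 0 ≤ M := by positivity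
  have hanti : ∀ t t', s ≤ t → t ≤ t' → t' ≤ v₀ → alive 20 T obs p t' ⊆ alive 20 T obs p t := by
    intro t t' _ h1 _ a ha
    rw [mem_alive] at ha ⊢
    exact fun h2 => ha (h2.mono le_rfl h1)
  have hact : ∀ a r v, s ≤ r → v ≤ v₀ → a ∈ alive 20 T obs p v → ∀ t ∈ Finset.Icc r v,
      a ∈ (obs t).active := by
    intro a r v h1 h2 ha t ht
    rw [Finset.mem_Icc] at ht
    refine h.mem_active_of_not_eliminated (by omega) (by omega) (mem_alive.1 ha) ?_ ht.2
    exact hp.trans (h.start_le_own hs (by omega) (by omega))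
  have hbact : ∀ r v, s ≤ r → v ≤ v₀ → ∀ t ∈ Finset.Icc r v, b ∈ (obs t).active := by
    intro r v h1 h2 t ht
    rw [Finset.mem_Icc] at ht
    exact h.mem_active_of_not_eliminated (by omega) (by omega) hb
      (h.le_own t (by omega) (by omega)) (by omega)
  have hmono : ∀ r v : ℕ, s ≤ r → v ≤ v₀ →
      32 * (Real.log T * K * √((v : ℝ) - r + 1)) ≤ M := by
    intro r v h1 h2
    have h1' : (s : ℝ) ≤ r := by exact_mod_cast h1
    have h2' : (v : ℝ) ≤ v₀ := by exact_mod_cast h2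
    refine mul_le_mul_of_nonneg_left (mul_le_mul_of_nonneg_left ?_ (by positivity)) (by norm_num)
    exact Real.sqrt_le_sqrt (by linarith)
  have hup := sum_average_le (fun t => alive 20 T obs p t) (fun a t => (P t).gap b a) hM0
    (p := s) (q := v₀) hanti (fun a r v h1 h2 h3 ha =>
      (hc.sum_gap_le hT (by omega) h2 (by omega) (hact a r v h1 h3 ha) (hbact r v h1 h3)
        fun h4 => mem_alive.1 ha (h4.mono (by omega) le_rfl)).trans (hmono r v h1 h3))
  -- The reverse bound holds because `b` itself is not eliminated. It is needed for the parent
  -- terms, which enter the telescoping sum with a minus sign.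
  have hlow := sum_average_le (fun t => alive 20 T obs p t) (fun a t => -(P t).gap b a) hM0
    (p := s) (q := v₀) hanti (fun a r v h1 h2 h3 ha => by
      simp only [← PrefMatrix.gap_neg]
      exact (hc.sum_gap_le hT (by omega) h2 (by omega) (hbact r v h1 h3) (hact a r v h1 h3 ha)
        fun h4 => hb (h4.mono (by omega) (by omega))).trans (hmono r v h1 h3))
  simp only [Finset.sum_neg_distrib, neg_div] at hlow
  -- The harmonic number is at most `1 + log T` as `K ≤ T`, and `1 ≤ 2 log T`; hence the constant 96
  -- = 32 · 3.
  have hH : (harmonic (alive 20 T obs p s).card : ℝ) ≤ 3 * Real.log T := by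
    have h1 := harmonic_le_one_add_log (alive 20 T obs p s).card
    have h2 : Real.log (alive 20 T obs p s).card ≤ Real.log T := by
      rcases Nat.eq_zero_or_pos (alive 20 T obs p s).card with h0 | h0
      · rw [h0]; simp; linarith
      · refine Real.log_le_log (by exact_mod_cast h0) ?_
        have := Finset.card_le_univ (alive 20 T obs p s)
        rw [Fintype.card_fin] at this
        exact_mod_cast this.trans hK
    linarith
  have h3 := mul_le_mul_of_nonneg_left hH hM0
  have h4 : M * (3 * Real.log T) = 96 * Real.log T ^ 2 * K * √((v₀ : ℝ) - s + 1) := by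
    rw [hM]; ring
  rw [abs_le]
  constructor <;> linarith

/-- The regret against a good arm is bounded by the spans of the calls. -/
lemma sum_average_active_le [NeZero K] {P : ℕ → PrefMatrix K} (h : Episode 20 T obs own B e u)
    (hc : Concentrated T P obs) (hT : 2 ≤ T) (hK : K ≤ T) {b : Fin K}
    (hb : ¬ Eliminated 20 T obs e (u - 1) b) :
    ∑ t ∈ Finset.Ico e u, (∑ a ∈ (obs t).active, (P t).gap b a) / ((obs t).active.card : ℝ) ≤
      192 * Real.log T ^ 2 * K *
        ∑ s ∈ starts own e u, √((lastOwn own e u s : ℝ) - s + 1) := by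
  set G : ℕ → ℕ → ℝ := fun s t =>
    (∑ a ∈ alive 20 T obs s t, (P t).gap b a) / ((alive 20 T obs s t).card : ℝ) with hG
  -- `G s` averages over the arms alive for the call `s`, `G' s` over those alive for its parent,
  -- with value 0 for an outermost call. The average of round `t` is `G (own t) t`, which telescopes
  -- along the chain. Each call then pays for two averages over its span, so 192 = 2 · 96.
  set G' : ℕ → ℕ → ℝ := fun s t =>
    if h : ((chain own e u s).filter (· < s)).Nonempty then
      G (((chain own e u s).filter (· < s)).max' h) t else 0 with hG'
  have h1 : ∀ t ∈ Finset.Ico e u,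
      (∑ a ∈ (obs t).active, (P t).gap b a) / ((obs t).active.card : ℝ) =
        ∑ s ∈ chain own e u t, (G s t - G' s t) := by
    intro t ht
    rw [Finset.mem_Ico] at ht
    rw [h.active_eq_alive ht.1 ht.2.le]
    have := sum_sub_pred_eq (fun s => G s t) _ ⟨_, h.own_mem_chain ht.1 ht.2⟩
    rw [h.max'_chain ht.1 ht.2] at this
    rw [show (∑ a ∈ alive 20 T obs (own t) t, (P t).gap b a) /
      ((alive 20 T obs (own t) t).card : ℝ) = G (own t) t from rfl, ← this]
    refine Finset.sum_congr rfl fun s hs => ?_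
    simp only [h.chain_filter_lt hs, hG']
  rw [Finset.sum_congr rfl h1]
  have h2 : ∑ t ∈ Finset.Ico e u, ∑ s ∈ chain own e u t, (G s t - G' s t) =
      ∑ s ∈ starts own e u, ∑ t ∈ Finset.Icc s (lastOwn own e u s), (G s t - G' s t) := by
    refine Finset.sum_comm' fun t s => ?_
    rw [chain, Finset.mem_filter, Finset.mem_Ico, Finset.mem_Icc]
    constructor
    · rintro ⟨-, h3, h4, h5⟩
      exact ⟨⟨h4, h5⟩, h3⟩
    · rintro ⟨⟨h4, h5⟩, h3⟩
      have := h.start_bounds h3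
      have := lastOwn_spec h3
      exact ⟨by omega, h3, h4, h5⟩
  rw [h2, Finset.mul_sum]
  refine Finset.sum_le_sum fun s hs => ?_
  rw [Finset.sum_sub_distrib]
  have h3 := (abs_le.1 (h.sum_average_alive_le hc hT hK hb hs le_rfl)).2
  have h4 : -(96 * Real.log T ^ 2 * K * √((lastOwn own e u s : ℝ) - s + 1)) ≤
      ∑ t ∈ Finset.Icc s (lastOwn own e u s), G' s t := by
    by_cases hne : ((chain own e u s).filter (· < s)).Nonempty
    · have hlt := (Finset.mem_filter.1 (Finset.max'_mem _ hne)).2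
      have := (abs_le.1 (h.sum_average_alive_le hc hT hK hb hs hlt.le)).1
      simp only [hG', dif_pos hne]
      exact this
    · simp only [hG', dif_neg hne, Finset.sum_const_zero]
      have : 0 ≤ 96 * Real.log T ^ 2 * K * √((lastOwn own e u s : ℝ) - s + 1) := by positivity
      linarith
  linarith

end Episode

/-! ## Replay schedules -/

/-- The success probabilities of the schedule of an episode that starts in round `e`. -/
def replayProb (T e : ℕ) (p : Fin (T + 1) × Fin (Nat.clog 2 T)) : unitInterval :=
  if e < (p.1 : ℕ) then invSqrt (2 ^ ((p.2 : ℕ) + 1) * ((p.1 : ℕ) - e)) else 0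

/-- The scheduled replays have a small total weight `√duration` in every initial part of the
episode. -/
def FewReplays (T e : ℕ) (B : Schedule T) : Prop :=
  ∀ n : ℕ, 1 ≤ n → n ≤ T →
    ∑ p ∈ Finset.univ.filter fun p : Fin (T + 1) × Fin (Nat.clog 2 T) =>
      e < (p.1 : ℕ) ∧ (p.1 : ℕ) ≤ e + n ∧ B p = true,
      √(min ((2 : ℝ) ^ ((p.2 : ℕ) + 1)) n / n) ≤ 17 * Real.log T

namespace Episode
variable {K T : ℕ} {obs : ℕ → Obs K} {own : ℕ → ℕ} {B : Schedule T} {e u : ℕ} {C : ℝ}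

/-- Every call except the root comes from a distinct scheduled replay, and its span is at most four
times its duration capped at the episode length `n`. So `FewReplays` at this `n` gives `2 √n · 17
log T`; the root adds `√n ≤ 2 log T · √n`. -/
lemma sum_sqrt_span_le (h : Episode C T obs own B e u) (hT : 2 ≤ T) (hB : FewReplays T e B) :
    ∑ s ∈ starts own e u, √((lastOwn own e u s : ℝ) - s + 1) ≤
      36 * Real.log T * √((u : ℝ) - e) := by
  have hL := half_le_log hT
  have hone := h.one_le
  have huT := h.le_horizon
  rcases eq_or_lt_of_le h.le with heu | heu
  · simp [starts, heu]
  obtain ⟨n, hn⟩ : ∃ n, u = e + n := ⟨u - e, by omega⟩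
  have hn1 : 1 ≤ n := by omega
  have hnr : (1 : ℝ) ≤ n := by exact_mod_cast hn1
  have hue : (u : ℝ) - e = n := by rw [hn]; push_cast; ring
  rw [hue]
  set F := Finset.univ.filter fun p : Fin (T + 1) × Fin (Nat.clog 2 T) =>
      e < (p.1 : ℕ) ∧ (p.1 : ℕ) ≤ e + n ∧ B p = true with hF
  have hspan : ∀ s ∈ starts own e u, (lastOwn own e u s : ℝ) - s + 1 ≤ n := by
    intro s hs
    have h1 := h.start_bounds hs
    have h2 := lastOwn_spec hs
    have : ((lastOwn own e u s : ℕ) : ℝ) + 1 ≤ u := by exact_mod_cast h2.2.1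
    have : (e : ℝ) ≤ s := by exact_mod_cast h1.1
    linarith
  have hex : ∀ s ∈ (starts own e u).erase e, ∃ p ∈ F, (p.1 : ℕ) = s ∧
      √((lastOwn own e u s : ℝ) - s + 1) ≤
        2 * √n * √(min ((2 : ℝ) ^ ((p.2 : ℕ) + 1)) n / n) := by
    intro s hs
    obtain ⟨hse, hs⟩ := Finset.mem_erase.1 hs
    have h1 := h.start_bounds hs
    have h2 := lastOwn_spec hs
    obtain ⟨p, hp1, hp2, hp3⟩ := h.scheduled (lastOwn own e u s) h2.1 h2.2.1.le (by omega)
    rw [h2.2.2] at hp1 hp3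
    refine ⟨p, ?_, hp1, ?_⟩
    · rw [hF, Finset.mem_filter]
      exact ⟨Finset.mem_univ _, by omega, by omega, hp2⟩
    · rw [mul_assoc, ← Real.sqrt_mul (by positivity), mul_div_cancel₀ _ (by positivity)]
      have h3 : ((lastOwn own e u s : ℕ) : ℝ) ≤ s + 2 ^ ((p.2 : ℕ) + 1) := by exact_mod_cast hp3
      have h4 : (2 : ℝ) ≤ 2 ^ ((p.2 : ℕ) + 1) := by
        rw [pow_succ]
        have : (1 : ℝ) ≤ 2 ^ (p.2 : ℕ) := one_le_pow₀ (by norm_num)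
        linarith
      have h5 : (lastOwn own e u s : ℝ) - s + 1 ≤ 2 ^ 2 * min ((2 : ℝ) ^ ((p.2 : ℕ) + 1)) n := by
        rcases min_choice ((2 : ℝ) ^ ((p.2 : ℕ) + 1)) n with h6 | h6 <;> rw [h6]
        · linarith
        · have := hspan s hs
          linarith
      calc _ ≤ √(2 ^ 2 * min ((2 : ℝ) ^ ((p.2 : ℕ) + 1)) n) := Real.sqrt_le_sqrt h5
        _ = _ := by rw [Real.sqrt_mul (by norm_num), Real.sqrt_sq (by norm_num)]
  have : Nonempty (Fin (T + 1) × Fin (Nat.clog 2 T)) :=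
    ⟨(0, ⟨0, Nat.clog_pos (by norm_num) hT⟩)⟩
  choose! f hf using hex
  have hinj : Set.InjOn f ((starts own e u).erase e) := by
    intro s hs s' hs' hss
    have h1 := (hf s hs).2.1
    have h2 := (hf s' hs').2.1
    rw [hss] at h1
    omega
  have hmain : ∑ s ∈ (starts own e u).erase e, √((lastOwn own e u s : ℝ) - s + 1) ≤
      2 * √n * (17 * Real.log T) := by
    calc _ ≤ ∑ s ∈ (starts own e u).erase e,
          2 * √n * √(min ((2 : ℝ) ^ (((f s).2 : ℕ) + 1)) n / n) :=
        Finset.sum_le_sum fun s hs => (hf s hs).2.2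
      _ = 2 * √n * ∑ p ∈ ((starts own e u).erase e).image f,
          √(min ((2 : ℝ) ^ ((p.2 : ℕ) + 1)) n / n) := by
        rw [Finset.sum_image hinj, Finset.mul_sum]
      _ ≤ 2 * √n * ∑ p ∈ F, √(min ((2 : ℝ) ^ ((p.2 : ℕ) + 1)) n / n) := by
        refine mul_le_mul_of_nonneg_left ?_ (by positivity)
        refine Finset.sum_le_sum_of_subset_of_nonneg ?_ fun _ _ _ => Real.sqrt_nonneg _
        intro p hp
        obtain ⟨s, hs, rfl⟩ := Finset.mem_image.1 hp
        exact (hf s hs).1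
      _ ≤ _ := mul_le_mul_of_nonneg_left (hB n hn1 (by omega)) (by positivity)
  have hsplit : ∑ s ∈ starts own e u, √((lastOwn own e u s : ℝ) - s + 1) ≤
      √n + ∑ s ∈ (starts own e u).erase e, √((lastOwn own e u s : ℝ) - s + 1) := by
    by_cases he : e ∈ starts own e u
    · rw [← Finset.add_sum_erase _ _ he]
      gcongr
      exact hspan e he
    · rw [Finset.erase_eq_of_notMem he]
      linarith [Real.sqrt_nonneg (n : ℝ)]
  have h0 := Real.sqrt_nonneg (n : ℝ)
  nlinarith

lemma sum_average_active_le_sqrt [NeZero K] {P : ℕ → PrefMatrix K}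
    (h : Episode 20 T obs own B e u)
    (hc : Concentrated T P obs) (hT : 2 ≤ T) (hK : K ≤ T) (hB : FewReplays T e B) {b : Fin K}
    (hb : ¬ Eliminated 20 T obs e (u - 1) b) :
    ∑ t ∈ Finset.Ico e u, (∑ a ∈ (obs t).active, (P t).gap b a) / ((obs t).active.card : ℝ) ≤
      6912 * Real.log T ^ 3 * K * √((u : ℝ) - e) := by
  have hL := half_le_log hT
  refine (h.sum_average_active_le hc hT hK hb).trans ?_
  have := mul_le_mul_of_nonneg_left (h.sum_sqrt_span_le hT hB)
    (show 0 ≤ 192 * Real.log T ^ 2 * (K : ℝ) by positivity)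
  refine this.trans (le_of_eq ?_)
  ring

end Episode

/-! ## Well-timed replays -/

/-- The weight of the scheduled replays of `W` in rounds of `[lo, hi)`. -/
def replayMass (T e : ℕ) (W : Finset (Fin (T + 1) × Fin (Nat.clog 2 T))) (lo hi : ℕ) : ℝ :=
  ∑ p ∈ W.filter fun p => lo ≤ (p.1 : ℕ) ∧ (p.1 : ℕ) < hi, (replayProb T e p : ℝ)

section Mass
variable {T e : ℕ} {W : Finset (Fin (T + 1) × Fin (Nat.clog 2 T))}

lemma replayMass_nonneg (lo hi : ℕ) : 0 ≤ replayMass T e W lo hi :=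
  Finset.sum_nonneg fun p _ => (replayProb T e p).2.1

lemma replayMass_add_le {lo mid hi : ℕ} (h1 : lo ≤ mid) (h2 : mid ≤ hi) :
    replayMass T e W lo mid + replayMass T e W mid hi ≤ replayMass T e W lo hi := by
  unfold replayMass
  rw [← Finset.sum_union]
  · refine Finset.sum_le_sum_of_subset_of_nonneg ?_ fun p _ _ => (replayProb T e p).2.1
    intro p
    simp only [Finset.mem_union, Finset.mem_filter]
    rintro (⟨h, h3, h4⟩ | ⟨h, h3, h4⟩)
    · exact ⟨h, h3, by omega⟩
    · exact ⟨h, by omega, h4⟩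
  · rw [Finset.disjoint_filter]
    intro p _ h3 h4
    omega

/-- If every replay that starts in the first quarter of a segment and covers it is in `W`, then `W`
has a weight of order `√(length / n)` in the segment. -/
lemma sqrt_le_replayMass {p l n : ℕ} (hl : 8 ≤ l) (hln : p + l ≤ e + n) (hn : n ≤ T)
    (hp : e ≤ p) (hpT : p + l ≤ T + 1)
    (hW : ∀ w : Fin (T + 1) × Fin (Nat.clog 2 T), p < (w.1 : ℕ) → (w.1 : ℕ) ≤ p + l / 4 →
      l ≤ 2 ^ ((w.2 : ℕ) + 1) → w ∈ W) :
    √(l : ℝ) ≤ 12 * √(n : ℝ) * replayMass T e W p (p + l) := by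
  have hc1 : 1 ≤ Nat.clog 2 l := Nat.clog_pos (by norm_num) (by omega)
  have hcT : Nat.clog 2 l ≤ Nat.clog 2 T := Nat.clog_mono_right 2 (by omega)
  -- The least power of two that is at least `l`, hence at most `2 l`. One such replay per round of
  -- the first quarter, each of probability at least `1 / √(2 l n)`, provides the weight.
  let j : Fin (Nat.clog 2 T) := ⟨Nat.clog 2 l - 1, by omega⟩
  have hj : (j : ℕ) + 1 = Nat.clog 2 l := by simp only [j]; omega
  have hlj : l ≤ 2 ^ ((j : ℕ) + 1) := by rw [hj]; exact Nat.le_pow_clog (by norm_num) l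
  have hjl : 2 ^ ((j : ℕ) + 1) ≤ 2 * l := by
    have := Nat.pow_pred_clog_lt_self (b := 2) (by norm_num) (x := l) (by omega)
    have h2 : 2 ^ ((j : ℕ) + 1) = 2 * 2 ^ (Nat.clog 2 l - 1) := by
      rw [pow_succ, mul_comm]
    rw [h2]
    exact Nat.mul_le_mul_left 2 this.le
  let f : ℕ → Fin (T + 1) × Fin (Nat.clog 2 T) := fun s => (Fin.ofNat (T + 1) s, j)
  have hf : ∀ s ∈ Finset.Ioc p (p + l / 4), ((f s).1 : ℕ) = s := by
    intro s hs
    rw [Finset.mem_Ioc] at hs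
    simp only [f, Fin.val_ofNat]
    exact Nat.mod_eq_of_lt (by omega)
  have hinj : Set.InjOn f (Finset.Ioc p (p + l / 4)) := by
    intro s hs s' hs' hss
    have h1 := hf s hs
    have h2 := hf s' hs'
    rw [hss] at h1
    omega
  have hsub : (Finset.Ioc p (p + l / 4)).image f ⊆
      W.filter fun w => p ≤ (w.1 : ℕ) ∧ (w.1 : ℕ) < p + l := by
    intro w hw
    obtain ⟨s, hs, rfl⟩ := Finset.mem_image.1 hw
    have h1 := hf s hs
    rw [Finset.mem_Ioc] at hs
    rw [Finset.mem_filter]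
    exact ⟨hW _ (by omega) (by omega) hlj, by omega, by omega⟩
  have hl0 : (0 : ℝ) < l := by exact_mod_cast (by omega : 0 < l)
  have hn0 : (0 : ℝ) < n := by exact_mod_cast (by omega : 0 < n)
  have hmass : ((l / 4 : ℕ) : ℝ) * (1 / √(2 * l * n)) ≤ replayMass T e W p (p + l) := by
    calc ((l / 4 : ℕ) : ℝ) * (1 / √(2 * l * n)) =
          ∑ s ∈ Finset.Ioc p (p + l / 4), 1 / √(2 * (l : ℝ) * n) := by
          rw [Finset.sum_const, Nat.card_Ioc, nsmul_eq_mul]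
          congr 2
          omega
      _ ≤ ∑ s ∈ Finset.Ioc p (p + l / 4), (replayProb T e (f s) : ℝ) := by
          refine Finset.sum_le_sum fun s hs => ?_
          have h1 := hf s hs
          rw [Finset.mem_Ioc] at hs
          rw [replayProb, if_pos (by omega), h1]
          change _ ≤ 1 / √(((2 ^ ((j : ℕ) + 1) * (s - e) : ℕ)) : ℝ)
          apply one_div_le_one_div_of_le
          · apply Real.sqrt_pos.2
            have : 0 < 2 ^ ((j : ℕ) + 1) * (s - e) := Nat.mul_pos (by positivity) (by omega)
            exact_mod_cast this
          · apply Real.sqrt_le_sqrt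
            have : 2 ^ ((j : ℕ) + 1) * (s - e) ≤ 2 * l * n := Nat.mul_le_mul hjl (by omega)
            exact_mod_cast this
      _ = ∑ w ∈ (Finset.Ioc p (p + l / 4)).image f, (replayProb T e w : ℝ) := by
          rw [Finset.sum_image hinj]
      _ ≤ _ := Finset.sum_le_sum_of_subset_of_nonneg hsub fun w _ _ => (replayProb T e w).2.1
  have h4 : (l : ℝ) / 8 ≤ ((l / 4 : ℕ) : ℝ) := by
    have : l ≤ 8 * (l / 4) := by omega
    have : (l : ℝ) ≤ 8 * ((l / 4 : ℕ) : ℝ) := by exact_mod_cast this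
    linarith
  have h5 : √(2 * l * n) ≤ 3 / 2 * (√l * √n) := by
    rw [Real.sqrt_mul (by positivity), Real.sqrt_mul (by positivity), mul_assoc]
    gcongr
    exact Real.sqrt_le_iff.2 ⟨by norm_num, by norm_num⟩
  have h6 : √(l : ℝ) / (12 * √n) ≤ ((l / 4 : ℕ) : ℝ) * (1 / √(2 * l * n)) := by
    have hs : √(l : ℝ) * √l = l := Real.mul_self_sqrt hl0.le
    have hsl : 0 < √(l : ℝ) := Real.sqrt_pos.2 hl0
    have hsn : 0 < √(n : ℝ) := Real.sqrt_pos.2 hn0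
    calc √(l : ℝ) / (12 * √n) = (l / 8) * (1 / (3 / 2 * (√l * √n))) := by
          rw [← hs]
          field_simp
          rw [Real.sqrt_sq hsl.le]
          ring
      _ ≤ _ := by
          gcongr
  have h7 := h6.trans hmass
  rw [div_le_iff₀ (by positivity)] at h7
  linarith

/-- Either all prefixes of `[p, q)` have a small sum, or `W` is heavy. -/
lemma sum_le_add_replayMass {K : ℕ} [NeZero K] (hT : 2 ≤ T) {x : ℕ → ℝ} (hx : ∀ t, x t ≤ 1 / 2)
    {lo hi n : ℕ}
    (hW : ∀ (w : Fin (T + 1) × Fin (Nat.clog 2 T)) (q : ℕ), e < (w.1 : ℕ) → lo ≤ (w.1 : ℕ) →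
      (w.1 : ℕ) < q → q < hi → q ≤ w.1 + 2 ^ ((w.2 : ℕ) + 1) →
      30 * Real.log T * K * √(max ((q : ℝ) - ((w.1 : ℕ) : ℝ)) ((K : ℝ) ^ 2)) <
        ∑ t ∈ Finset.Icc (w.1 : ℕ) q, x t → w ∈ W)
    (hn : n ≤ T) (hhi : hi ≤ T + 1) (hhn : hi ≤ e + n) (N : ℕ) :
    ∀ p, hi - p ≤ N → lo ≤ p → e ≤ p → p ≤ hi →
    ∑ t ∈ Finset.Ico p hi, x t ≤ 60 * (Real.log T * K * √((hi : ℝ) - p)) +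
      732 * (Real.log T * K * √(n : ℝ)) * replayMass T e W p hi := by
  have hL := half_le_log hT
  have hK : (1 : ℝ) ≤ K := by exact_mod_cast NeZero.one_le
  have hLK : 1 / 2 ≤ Real.log T * K := by nlinarith
  induction N with
  | zero =>
    intro p h1 _ _ h2
    rw [Finset.Ico_eq_empty (by omega), Finset.sum_empty]
    have := replayMass_nonneg (T := T) (e := e) (W := W) p hi
    positivity
  | succ N ih =>
    intro p hpN hlo hep hph
    have hm0 := replayMass_nonneg (T := T) (e := e) (W := W) p hi
    by_cases hbad : ∃ q, p ≤ q ∧ q < hi ∧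
        60 * (Real.log T * K * √((q : ℝ) - p + 1)) < ∑ t ∈ Finset.Icc p q, x t
    swap
    · push Not at hbad
      have h0 : ∑ t ∈ Finset.Ico p hi, x t ≤ 60 * (Real.log T * K * √((hi : ℝ) - p)) := by
        rcases eq_or_lt_of_le hph with rfl | hph
        · simp
        · obtain ⟨q, rfl⟩ : ∃ q, hi = q + 1 := ⟨hi - 1, by omega⟩
          have := hbad q (by omega) (by omega)
          push_cast
          rw [show ((q : ℝ) + 1 - p) = q - p + 1 by ring]
          exact this
      have : 0 ≤ 732 * (Real.log T * K * √(n : ℝ)) * replayMass T e W p hi := by positivity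
      linarith
    classical
    -- Greedy cutting: `q` is the first round at which the prefix sum is too large. The segment `[p,
    -- q]` is charged to the replays starting in it, and the induction continues at `q + 1`.
    obtain ⟨h1, h2, h3⟩ := Nat.find_spec hbad
    have hmin := fun q => Nat.find_min (m := q) hbad
    set q := Nat.find hbad
    obtain ⟨l, hl⟩ : ∃ l, q + 1 = p + l := ⟨q + 1 - p, by omega⟩
    have hlr : (q : ℝ) - p + 1 = l := by
      have : (q : ℝ) + 1 = p + l := by exact_mod_cast hl
      linarith
    rw [hlr] at h3
    have hl1 : (1 : ℝ) ≤ l := by exact_mod_cast (by omega : 1 ≤ l)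
    have hsl1 : 1 ≤ √(l : ℝ) := Real.one_le_sqrt.2 hl1
    have hss : √(l : ℝ) * √l = l := Real.mul_self_sqrt (by linarith)
    have hprefix : ∀ q', p ≤ q' → q' ≤ q →
        ∑ t ∈ Finset.Ico p q', x t ≤ 60 * (Real.log T * K * √((q' : ℝ) - p)) := by
      intro q' h4 h5
      rcases eq_or_lt_of_le h4 with rfl | h4
      · simp
      · obtain ⟨r, rfl⟩ : ∃ r, q' = r + 1 := ⟨q' - 1, by omega⟩
        have := hmin r (by omega)
        push Not at this
        have := this (by omega) (by omega)
        push_cast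
        rw [show ((r : ℝ) + 1 - p) = r - p + 1 by ring]
        exact this
    have hsum_half : ∑ t ∈ Finset.Icc p q, x t ≤ (l : ℝ) / 2 := by
      calc _ ≤ ∑ t ∈ Finset.Icc p q, (1 / 2 : ℝ) := Finset.sum_le_sum fun t _ => hx t
        _ = _ := by
          rw [Finset.sum_const, Nat.card_Icc, nsmul_eq_mul, hl, Nat.add_sub_cancel_left]
          ring
    -- Terms are at most `1/2`, so a bad segment is long; in particular the cap `K²` in the
    -- detection threshold plays no role.
    have hsl : 60 * K ≤ √(l : ℝ) := by
      have h6 : 60 * (Real.log T * K) * √(l : ℝ) ≤ √l / 2 * √l := by linarith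
      have h7 := le_of_mul_le_mul_right h6 (by linarith)
      nlinarith
    have hlK : (K : ℝ) ^ 2 ≤ l := by nlinarith
    have hl8 : 8 ≤ l := by
      have : (8 : ℝ) ≤ l := by nlinarith
      exact_mod_cast this
    have hsplit : ∀ r, p ≤ r → r ≤ q → ∑ t ∈ Finset.Icc p q, x t =
        ∑ t ∈ Finset.Ico p r, x t + ∑ t ∈ Finset.Icc r q, x t := by
      intro r h4 h5
      exact (Finset.sum_Ico_consecutive x h4 (Nat.le_succ_of_le h5)).symm
    -- Before the replay at most `l / 4` rounds have passed, and by minimality of `q` their sum is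
    -- at most `60 √(l/4) = 30 √l` (times `log T · K`). More than `30 √l` remains for the replay,
    -- which is its threshold.
    have hWl : ∀ w : Fin (T + 1) × Fin (Nat.clog 2 T), p < (w.1 : ℕ) → (w.1 : ℕ) ≤ p + l / 4 →
        l ≤ 2 ^ ((w.2 : ℕ) + 1) → w ∈ W := by
      intro w hw1 hw2 hw3
      refine hW w q (by omega) (by omega) (by omega) h2 (by omega) ?_
      have h4 := hsplit w.1 hw1.le (by omega)
      have h5 := hprefix w.1 hw1.le (by omega)
      have h6 : √(((w.1 : ℕ) : ℝ) - p) ≤ √(l : ℝ) / 2 := by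
        refine Real.sqrt_le_iff.2 ⟨by positivity, ?_⟩
        have : 4 * (w.1 : ℕ) ≤ 4 * p + l := by omega
        have : 4 * ((w.1 : ℕ) : ℝ) ≤ 4 * p + l := by exact_mod_cast this
        rw [div_pow, Real.sq_sqrt (by linarith)]
        linarith
      have h7 : √(max ((q : ℝ) - ((w.1 : ℕ) : ℝ)) ((K : ℝ) ^ 2)) ≤ √(l : ℝ) := by
        refine Real.sqrt_le_sqrt (max_le ?_ hlK)
        have : (p : ℝ) < ((w.1 : ℕ) : ℝ) := by exact_mod_cast hw1
        linarith
      have h8 := mul_le_mul_of_nonneg_left h6 (show 0 ≤ 60 * (Real.log T * K) by linarith)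
      have h9 := mul_le_mul_of_nonneg_left h7 (show 0 ≤ 30 * (Real.log T * K) by linarith)
      linarith
    have hmass := sqrt_le_replayMass hl8 (by omega) hn hep (by omega) hWl
    -- Minimality of `q` gives 60 for the rounds before `q`, and round `q` adds at most `1/2`.
    -- Replacing `√l` by `12 √n` times the mass of the segment yields 732 = 61 · 12.
    have hseg : ∑ t ∈ Finset.Icc p q, x t ≤ 61 * (Real.log T * K * √(l : ℝ)) := by
      have h4 := hsplit q h1 le_rfl
      rw [Finset.Icc_self, Finset.sum_singleton] at h4
      have h5 := hprefix q h1 le_rfl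
      have h6 : √((q : ℝ) - p) ≤ √(l : ℝ) := Real.sqrt_le_sqrt (by linarith)
      have h8 := mul_le_mul_of_nonneg_left h6 (show 0 ≤ 60 * (Real.log T * K) by linarith)
      have := hx q
      nlinarith
    have hrec := ih (q + 1) (by omega) (by omega) (by omega) (by omega)
    have h10 : ∑ t ∈ Finset.Ico p hi, x t =
        ∑ t ∈ Finset.Icc p q, x t + ∑ t ∈ Finset.Ico (q + 1) hi, x t :=
      (Finset.sum_Ico_consecutive x (by omega : p ≤ q + 1) (by omega)).symm
    have h11 : √((hi : ℝ) - ((q + 1 : ℕ) : ℝ)) ≤ √((hi : ℝ) - p) := by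
      refine Real.sqrt_le_sqrt ?_
      have : (p : ℝ) ≤ ((q + 1 : ℕ) : ℝ) := by exact_mod_cast (by omega : p ≤ q + 1)
      linarith
    have h12 := mul_le_mul_of_nonneg_left h11 (show 0 ≤ 60 * (Real.log T * K) by linarith)
    have h13 := replayMass_add_le (T := T) (e := e) (W := W) (lo := p) (mid := q + 1) (hi := hi)
      (by omega) (by omega)
    rw [hl] at h13 h12 hrec h10
    have h14 := mul_le_mul_of_nonneg_left h13
      (show 0 ≤ 732 * (Real.log T * K * √(n : ℝ)) by positivity)
    have h15 := mul_le_mul_of_nonneg_left hmass (show 0 ≤ 61 * (Real.log T * K) by linarith)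
    linarith

end Mass

open Classical in
/-- The replays which, if scheduled in an episode that starts in round `e`, reveal before round `r`
that `a` is much worse than the safe arm of the current phase. -/
def wellTimed {K : ℕ} (T e : ℕ) (P : ℕ → PrefMatrix K) (cw safe : ℕ → Fin K) (a : Fin K) (r : ℕ) :
    Finset (Fin (T + 1) × Fin (Nat.clog 2 T)) :=
  Finset.univ.filter fun p => e < (p.1 : ℕ) ∧ ∃ i q : ℕ, i ≤ numSigSwitches T P cw ∧
    sigSwitch T P cw i ≤ (p.1 : ℕ) ∧ (p.1 : ℕ) < q ∧ q < sigSwitch T P cw (i + 1) - 1 ∧ q < r ∧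
    q ≤ p.1 + 2 ^ ((p.2 : ℕ) + 1) ∧
    30 * Real.log T * K * √(max ((q : ℝ) - ((p.1 : ℕ) : ℝ)) ((K : ℝ) ^ 2)) <
      ∑ t ∈ Finset.Icc (p.1 : ℕ) q, (P t).gap (safe i) a

/-- A schedule with few replays, which hits every heavy set of well-timed replays. -/
structure GoodSchedule {K : ℕ} (T e : ℕ) (P : ℕ → PrefMatrix K) (cw safe : ℕ → Fin K)
    (B : Schedule T) : Prop where
  few : FewReplays T e B
  hits : ∀ (a : Fin K) (r : ℕ), r ≤ T →
    ∑ p ∈ wellTimed T e P cw safe a r, (replayProb T e p : ℝ) ≤ 5 * Real.log T ∨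
      ∃ p ∈ wellTimed T e P cw safe a r, B p = true

/-- The arm `safe i` has small dynamic regret on every interval inside phase `i`. -/
def SafeArms {K : ℕ} (T : ℕ) (P : ℕ → PrefMatrix K) (cw safe : ℕ → Fin K) : Prop :=
  ∀ i, i ≤ numSigSwitches T P cw → ∀ s₁ s₂ : ℕ, sigSwitch T P cw i ≤ s₁ → s₁ < s₂ →
    s₂ < sigSwitch T P cw (i + 1) - 1 →
    ∑ t ∈ Finset.Icc s₁ s₂, (P t).gap (cw t) (safe i) < √((K : ℝ) * ((s₂ : ℝ) - (s₁ : ℝ)))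

/-- The mean of `δ(w, a)` over the arms `a` of `A`, or over all arms if `A = ∅`. -/
def meanGap {K : ℕ} (P : PrefMatrix K) (w : Fin K) (A : Finset (Fin K)) : ℝ :=
  if A.Nonempty then (∑ a ∈ A, P.gap w a) / A.card else (∑ a, P.gap w a) / K

section MeanGap
variable {K : ℕ} {P : PrefMatrix K} {w : Fin K} {A : Finset (Fin K)}

lemma meanGap_le_half [NeZero K] : meanGap P w A ≤ 1 / 2 := by
  have key : ∀ B : Finset (Fin K), B.Nonempty → (∑ a ∈ B, P.gap w a) / B.card ≤ 1 / 2 := by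
    intro B hB
    have hc : (0 : ℝ) < B.card := by exact_mod_cast hB.card_pos
    rw [div_le_iff₀ hc]
    calc _ ≤ ∑ _a ∈ B, (1 / 2 : ℝ) := Finset.sum_le_sum fun a _ => P.gap_le w a
      _ = _ := by rw [Finset.sum_const, nsmul_eq_mul, mul_comm]
  unfold meanGap
  split_ifs with h
  · exact key A h
  · have := key Finset.univ Finset.univ_nonempty
    rwa [Finset.card_univ, Fintype.card_fin] at this

lemma meanGap_le_add (hw : P.IsCondorcetWinner w) (hs : P.SST) (ht : P.STI) (hA : A.Nonempty)
    (b : Fin K) : meanGap P w A ≤ 2 * P.gap w b + (∑ a ∈ A, P.gap b a) / A.card := by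
  have hc : (0 : ℝ) < A.card := by exact_mod_cast hA.card_pos
  rw [meanGap, if_pos hA, div_le_iff₀ hc, add_mul, div_mul_cancel₀ _ hc.ne']
  calc _ ≤ ∑ a ∈ A, (2 * P.gap w b + P.gap b a) :=
        Finset.sum_le_sum fun a _ => hw.gap_le_two_mul_gap_add hs ht a b
    _ = _ := by rw [Finset.sum_add_distrib, Finset.sum_const, nsmul_eq_mul]; ring

end MeanGap

/-! ### Regret of the surviving arm and of a whole episode -/

namespace Episode
variable {K T : ℕ} {obs : ℕ → Obs K} {own : ℕ → ℕ} {B : Schedule T} {e u : ℕ}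
  {P : ℕ → PrefMatrix K} {cw safe : ℕ → Fin K}

/-- The well-timed replays for an arm that survives have not been scheduled. -/
lemma sum_wellTimed_le [NeZero K] (h : Episode 20 T obs own B e u) (hc : Concentrated T P obs)
    (hT : 2 ≤ T) (hcw : ∀ t ∈ Finset.Icc 1 T, (P t).IsCondorcetWinner (cw t))
    (hs : ∀ t ∈ Finset.Icc 1 T, (P t).SST) (hsafe : SafeArms T P cw safe)
    (hB : GoodSchedule T e P cw safe B) {b : Fin K}
    (hb : ¬ Eliminated 20 T obs e (u - 1) b) :
    ∑ p ∈ wellTimed T e P cw safe b (u - 1), (replayProb T e p : ℝ) ≤ 5 * Real.log T := by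
  have hone := h.one_le
  have huT := h.le_horizon
  refine (hB.hits b (u - 1) (by omega)).resolve_right ?_
  rintro ⟨p, hp, hBp⟩
  simp only [wellTimed, Finset.mem_filter, Finset.mem_univ, true_and] at hp
  obtain ⟨hep, i, q, hi, h1, h2, h3, h4, h5, h6⟩ := hp
  -- During `[p.1, q]` only the calls started from round `p.1` on play, so the tests look only at
  -- rounds of the current phase. The safe arm passes them, because an elimination would exhibit
  -- large regret inside the phase; `b` passes since it survives. With both active, the loss of `b`
  -- would be detected by `q < u - 1`.
  have hown : ∀ t ∈ Finset.Icc (p.1 : ℕ) q, (p.1 : ℕ) ≤ own t := by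
    intro t ht
    rw [Finset.mem_Icc] at ht
    exact h.le_own_of_scheduled t p (by omega) (by omega) hBp hep ht.1 (by omega)
  refine hb ((hc.eliminated (lo := e) (t := q + 1) hone hep.le h2 (Nat.lt_succ_self q) (by omega)
    ?_ ?_ h6).mono le_rfl (by omega))
  · intro t ht
    have h7 := hown t ht
    rw [Finset.mem_Icc] at ht
    exact h.mem_active_of_not_eliminated (by omega) (by omega) hb (by omega) (by omega)
  · intro t ht
    have h7 := hown t ht
    rw [Finset.mem_Icc] at ht
    rw [h.mem_active t _ (by omega) (by omega)]
    intro h8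
    obtain ⟨s₁, s₂, h9, h10, h11, h12⟩ := hc.exists_regret_of_eliminated hT hcw hs
      (by omega) (by omega) h8
    exact absurd (hsafe i hi s₁ s₂ (by omega) h10 (by omega)) (not_lt.2 h12)

/-- The comparison goes through the safe arm of the phase: its own regret is small by `SafeArms`,
and its gaps to `b` are charged to well-timed replays by `sum_le_add_replayMass`. The last rounds of
phase and episode, about which neither says anything, cost at most `3/2`. -/
lemma sum_gap_phase_le [NeZero K] (h : Episode 20 T obs own B e u) (hT : 2 ≤ T)
    (hcw : ∀ t ∈ Finset.Icc 1 T, (P t).IsCondorcetWinner (cw t))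
    (hs : ∀ t ∈ Finset.Icc 1 T, (P t).SST) (ht : ∀ t ∈ Finset.Icc 1 T, (P t).STI)
    (hsafe : SafeArms T P cw safe) (b : Fin K) {i : ℕ} (hi : i ≤ numSigSwitches T P cw) :
    ∑ t ∈ (Finset.Ico e u).filter fun t => sigSwitch T P cw i ≤ t ∧ t ≤ sigSwitch T P cw (i + 1),
      (P t).gap (cw t) b ≤
      80 * (Real.log T * K * √((sigSwitch T P cw (i + 1) : ℝ) - sigSwitch T P cw i)) +
        732 * (Real.log T * K * √((u : ℝ) - e)) *
          replayMass T e (wellTimed T e P cw safe b (u - 1)) (max e (sigSwitch T P cw i))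
            (min (u - 1) (sigSwitch T P cw (i + 1) - 1)) := by
  have hone := h.one_le
  have huT := h.le_horizon
  have heu := h.le
  have hL := half_le_log hT
  have hK : (1 : ℝ) ≤ K := by exact_mod_cast NeZero.one_le
  have hτ := sigSwitch_lt_succ (sigSwitch_lt (P := P) (cw := cw) hT hi)
  have hτT := sigSwitch_succ_le (T := T) (P := P) (cw := cw) i
  set τ := sigSwitch T P cw i with hτdef
  set τ' := sigSwitch T P cw (i + 1) with hτ'def
  set lo := max e τ with hlo
  set hi' := min (u - 1) (τ' - 1) with hhi
  set W := wellTimed T e P cw safe b (u - 1) with hW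
  have hg1 : (1 : ℝ) ≤ (τ' : ℝ) - τ := by
    have : ((τ : ℕ) : ℝ) + 1 ≤ τ' := by exact_mod_cast hτ
    linarith
  set g : ℝ := (τ' : ℝ) - τ with hg
  have hsg1 : 1 ≤ √g := Real.one_le_sqrt.2 hg1
  have hue : (0 : ℝ) ≤ (u : ℝ) - e := sub_nonneg.2 (by exact_mod_cast heu)
  have hm0 := replayMass_nonneg (T := T) (e := e) (W := W) lo hi'
  have hnn : ∀ t, e ≤ t → t ≤ u → 0 ≤ (P t).gap (cw t) b := fun t h1 h2 =>
    (hcw t (by rw [Finset.mem_Icc]; omega)).gap_nonneg b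
  have hLK : 1 / 2 ≤ Real.log T * K := by nlinarith
  -- the last rounds of the phase and of the episode
  have hsub : ((Finset.Ico e u).filter fun t => τ ≤ t ∧ t ≤ τ') ⊆
      Finset.Ico lo hi' ∪ (({u - 1, τ' - 1, τ'} : Finset ℕ).filter fun t => e ≤ t ∧ t ≤ u) := by
    intro t ht
    simp only [Finset.mem_filter, Finset.mem_Ico, Finset.mem_union, Finset.mem_insert,
      Finset.mem_singleton] at ht ⊢
    omega
  have hsum1 : ∑ t ∈ (Finset.Ico e u).filter (fun t => τ ≤ t ∧ t ≤ τ'), (P t).gap (cw t) b ≤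
      ∑ t ∈ Finset.Ico lo hi', (P t).gap (cw t) b + 3 / 2 := by
    refine (Finset.sum_le_sum_of_subset_of_nonneg hsub fun t h1 _ => ?_).trans ?_
    · rcases Finset.mem_union.1 h1 with h1 | h1
      · rw [Finset.mem_Ico] at h1
        exact hnn t (by omega) (by omega)
      · rw [Finset.mem_filter] at h1
        exact hnn t h1.2.1 h1.2.2
    · have h1 := Finset.sum_union_inter (s₁ := Finset.Ico lo hi')
        (s₂ := (({u - 1, τ' - 1, τ'} : Finset ℕ).filter fun t => e ≤ t ∧ t ≤ u))
        (f := fun t => (P t).gap (cw t) b)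
      have h2 : 0 ≤ ∑ t ∈ Finset.Ico lo hi' ∩
          (({u - 1, τ' - 1, τ'} : Finset ℕ).filter fun t => e ≤ t ∧ t ≤ u),
          (P t).gap (cw t) b := Finset.sum_nonneg fun t h3 => by
        rw [Finset.mem_inter, Finset.mem_filter] at h3
        exact hnn t h3.2.2.1 h3.2.2.2
      have h3 : ∑ t ∈ (({u - 1, τ' - 1, τ'} : Finset ℕ).filter fun t => e ≤ t ∧ t ≤ u),
          (P t).gap (cw t) b ≤ 3 / 2 := by
        have hcard : (({u - 1, τ' - 1, τ'} : Finset ℕ).filter fun t => e ≤ t ∧ t ≤ u).card ≤ 3 :=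
          (Finset.card_filter_le _ _).trans Finset.card_le_three
        have hcard' : ((({u - 1, τ' - 1, τ'} : Finset ℕ).filter
          fun t => e ≤ t ∧ t ≤ u).card : ℝ) ≤ 3 := by exact_mod_cast hcard
        calc _ ≤ ∑ _t ∈ (({u - 1, τ' - 1, τ'} : Finset ℕ).filter fun t => e ≤ t ∧ t ≤ u),
              (1 / 2 : ℝ) := Finset.sum_le_sum fun t _ => (P t).gap_le _ _
          _ ≤ _ := by rw [Finset.sum_const, nsmul_eq_mul]; linarith
      linarith
  have hsum2 : ∑ t ∈ Finset.Ico lo hi', (P t).gap (cw t) b ≤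
      2 * ∑ t ∈ Finset.Ico lo hi', (P t).gap (cw t) (safe i) +
        ∑ t ∈ Finset.Ico lo hi', (P t).gap (safe i) b := by
    rw [Finset.mul_sum, ← Finset.sum_add_distrib]
    refine Finset.sum_le_sum fun t h1 => ?_
    rw [Finset.mem_Ico] at h1
    have h2 : t ∈ Finset.Icc 1 T := by rw [Finset.mem_Icc]; omega
    exact (hcw t h2).gap_le_two_mul_gap_add (hs t h2) (ht t h2) _ _
  rcases lt_or_ge lo hi' with hlt | hge
  swap
  · rw [Finset.Ico_eq_empty (show ¬ lo < hi' by omega), Finset.sum_empty] at hsum1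
    have h1 : 0 ≤ 732 * (Real.log T * K * √((u : ℝ) - e)) * replayMass T e W lo hi' := by positivity
    nlinarith
  have hlohi : (hi' : ℝ) - lo ≤ g := by
    have h1 : (hi' : ℝ) ≤ τ' := by exact_mod_cast (by omega : hi' ≤ τ')
    have h2 : (τ : ℝ) ≤ lo := by exact_mod_cast (by omega : τ ≤ lo)
    linarith
  have hsum3 : ∑ t ∈ Finset.Ico lo hi', (P t).gap (cw t) (safe i) ≤ K * √g + 1 / 2 := by
    obtain ⟨s, hsdef⟩ : ∃ s, hi' = s + 1 := ⟨hi' - 1, by omega⟩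
    rw [hsdef]
    change ∑ t ∈ Finset.Icc lo s, _ ≤ _
    have h0 : 0 ≤ K * √g := by positivity
    rcases eq_or_lt_of_le (show lo ≤ s by omega) with h1 | h1
    · rw [← h1, Finset.Icc_self, Finset.sum_singleton]
      have := (P lo).gap_le (cw lo) (safe i)
      linarith
    · have h2 := hsafe i hi lo s (by omega) h1 (by omega)
      have h3 : √((K : ℝ) * ((s : ℝ) - lo)) ≤ K * √g := by
        have h4 : (s : ℝ) - lo ≤ g := by
          have : (s : ℝ) ≤ hi' := by exact_mod_cast (by omega : s ≤ hi')
          linarith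
        rw [Real.sqrt_mul (by positivity)]
        refine mul_le_mul ?_ (Real.sqrt_le_sqrt h4) (Real.sqrt_nonneg _) (by positivity)
        exact Real.sqrt_le_iff.2 ⟨by positivity, by nlinarith⟩
      linarith
  have hsum4 := sum_le_add_replayMass (T := T) (e := e) (W := W) (K := K) hT
    (x := fun t => (P t).gap (safe i) b) (fun t => (P t).gap_le _ _) (lo := lo) (hi := hi')
    (n := u - e) (by
      intro w q h1 h2 h3 h4 h5 h6
      simp only [hW, wellTimed, Finset.mem_filter, Finset.mem_univ, true_and]
      exact ⟨h1, i, q, hi, by omega, h3, by omega, by omega, h5, h6⟩)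
    (by omega) (by omega) (by omega) (hi' - lo) lo le_rfl le_rfl (by omega) hlt.le
  rw [Nat.cast_sub heu] at hsum4
  have h1 : √((hi' : ℝ) - lo) ≤ √g := Real.sqrt_le_sqrt hlohi
  have h2 := mul_le_mul_of_nonneg_left h1 (show 0 ≤ 60 * (Real.log T * K) by linarith)
  have h3 : 1 / 2 ≤ Real.log T * K * √g := by nlinarith
  have h4 : K * √g ≤ 2 * (Real.log T * K * √g) := by
    have : 0 ≤ K * √g := by positivity
    nlinarith
  linarith

/-- The phases met cover the episode, and a closed phase has one round more than its length, hence
at most twice its length. This converts `√n` into the phase sum, since the root of a sum is at most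
the sum of the roots. -/
lemma sqrt_length_le [NeZero K] (hone : 1 ≤ e) (heu : e ≤ u) (huT : u ≤ T) (hT : 2 ≤ T) :
    √((u : ℝ) - e) ≤ 2 * ∑ i ∈ (Finset.range (numSigSwitches T P cw + 1)).filter
      (fun i => ∃ t ∈ Finset.Icc e u, sigSwitch T P cw i ≤ t ∧ t ≤ sigSwitch T P cw (i + 1)),
      √((sigSwitch T P cw (i + 1) : ℝ) - sigSwitch T P cw i) := by
  set I := (Finset.range (numSigSwitches T P cw + 1)).filter
      (fun i => ∃ t ∈ Finset.Icc e u, sigSwitch T P cw i ≤ t ∧ t ≤ sigSwitch T P cw (i + 1)) with hI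
  have hg : ∀ i ∈ I, (1 : ℝ) ≤ (sigSwitch T P cw (i + 1) : ℝ) - sigSwitch T P cw i := by
    intro i hi
    rw [hI, Finset.mem_filter, Finset.mem_range] at hi
    have h1 := sigSwitch_lt_succ (sigSwitch_lt (P := P) (cw := cw) hT (Nat.le_of_lt_succ hi.1))
    have : (sigSwitch T P cw i : ℝ) + 1 ≤ sigSwitch T P cw (i + 1) := by exact_mod_cast h1
    linarith
  have hcover : Finset.Ico e u ⊆ I.biUnion fun i =>
      Finset.Icc (sigSwitch T P cw i) (sigSwitch T P cw (i + 1)) := by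
    intro t ht
    rw [Finset.mem_Ico] at ht
    obtain ⟨i, hi, h1, h2⟩ := exists_phase (P := P) (cw := cw) hT (t := t) (by omega) (by omega)
    rw [Finset.mem_biUnion]
    refine ⟨i, ?_, by rw [Finset.mem_Icc]; exact ⟨h1, h2⟩⟩
    rw [hI, Finset.mem_filter]
    exact ⟨hi, t, by rw [Finset.mem_Icc]; omega, h1, h2⟩
  have hcard := (Finset.card_le_card hcover).trans Finset.card_biUnion_le
  rw [Nat.card_Ico] at hcard
  have h1 : (u : ℝ) - e ≤ ∑ i ∈ I, 2 * ((sigSwitch T P cw (i + 1) : ℝ) - sigSwitch T P cw i) := by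
    have h2 : ((u - e : ℕ) : ℝ) ≤ ((∑ i ∈ I, (Finset.Icc (sigSwitch T P cw i)
        (sigSwitch T P cw (i + 1))).card : ℕ) : ℝ) := by exact_mod_cast hcard
    rw [Nat.cast_sub heu, Nat.cast_sum] at h2
    refine h2.trans (Finset.sum_le_sum fun i hi => ?_)
    have h3 := hg i hi
    have h4 : sigSwitch T P cw i ≤ sigSwitch T P cw (i + 1) + 1 := by
      have : (sigSwitch T P cw i : ℝ) ≤ sigSwitch T P cw (i + 1) := by linarith
      have : sigSwitch T P cw i ≤ sigSwitch T P cw (i + 1) := by exact_mod_cast this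
      omega
    rw [Nat.card_Icc, Nat.cast_sub h4]
    push_cast
    linarith
  have h2 := Finset.sum_sq_le_sq_sum_of_nonneg (s := I)
    (f := fun i => √((sigSwitch T P cw (i + 1) : ℝ) - sigSwitch T P cw i))
    (fun i _ => Real.sqrt_nonneg _)
  rw [Finset.sum_congr rfl fun i hi => Real.sq_sqrt (zero_le_one.trans (hg i hi))] at h2
  rw [← Finset.mul_sum] at h1
  refine Real.sqrt_le_iff.2 ⟨mul_nonneg (by norm_num) (Finset.sum_nonneg fun i _ =>
    Real.sqrt_nonneg _), ?_⟩
  have h3 := sq_nonneg (∑ i ∈ I, √((sigSwitch T P cw (i + 1) : ℝ) - sigSwitch T P cw i))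
  rw [mul_pow]
  linarith

/-- The regret of one episode. -/
lemma sum_meanGap_le [NeZero K] (h : Episode 20 T obs own B e u) (hc : Concentrated T P obs)
    (hT : 2 ≤ T) (hKT : K ≤ T) (hcw : ∀ t ∈ Finset.Icc 1 T, (P t).IsCondorcetWinner (cw t))
    (hs : ∀ t ∈ Finset.Icc 1 T, (P t).SST) (ht : ∀ t ∈ Finset.Icc 1 T, (P t).STI)
    (hsafe : SafeArms T P cw safe) (hB : GoodSchedule T e P cw safe B) :
    ∑ t ∈ Finset.Icc e u, meanGap (P t) (cw t) (obs t).active ≤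
      50000 * (Real.log T ^ 3 * K) * ∑ i ∈ (Finset.range (numSigSwitches T P cw + 1)).filter
        (fun i => ∃ t ∈ Finset.Icc e u, sigSwitch T P cw i ≤ t ∧ t ≤ sigSwitch T P cw (i + 1)),
        √((sigSwitch T P cw (i + 1) : ℝ) - sigSwitch T P cw i) := by
  obtain ⟨b, hb⟩ := h.exists_good
  have hone := h.one_le
  have huT := h.le_horizon
  have heu := h.le
  have hL := half_le_log hT
  have hK : (1 : ℝ) ≤ K := by exact_mod_cast NeZero.one_le
  have hlen := sqrt_length_le (K := K) (P := P) (cw := cw) hone heu huT hT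
  set τ := fun i => sigSwitch T P cw i with hτ
  set I := (Finset.range (numSigSwitches T P cw + 1)).filter
      (fun i => ∃ t ∈ Finset.Icc e u, sigSwitch T P cw i ≤ t ∧ t ≤ sigSwitch T P cw (i + 1)) with hI
  set Q := ∑ i ∈ I, √((sigSwitch T P cw (i + 1) : ℝ) - sigSwitch T P cw i) with hQ
  have hIle : ∀ i ∈ I, i ≤ numSigSwitches T P cw := fun i hi => by
    rw [hI, Finset.mem_filter, Finset.mem_range] at hi
    exact Nat.le_of_lt_succ hi.1
  have hQ1 : 1 ≤ Q := by
    obtain ⟨i, hi, h1, h2⟩ := exists_phase (P := P) (cw := cw) hT hone (heu.trans huT)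
    have hiI : i ∈ I := by
      rw [hI, Finset.mem_filter]
      exact ⟨hi, e, by rw [Finset.mem_Icc]; omega, h1, h2⟩
    have h3 : 1 ≤ √((sigSwitch T P cw (i + 1) : ℝ) - sigSwitch T P cw i) := by
      have h4 := sigSwitch_lt_succ (sigSwitch_lt (P := P) (cw := cw) hT (hIle i hiI))
      have : (sigSwitch T P cw i : ℝ) + 1 ≤ sigSwitch T P cw (i + 1) := by exact_mod_cast h4
      exact Real.one_le_sqrt.2 (by linarith)
    exact h3.trans (Finset.single_le_sum (f := fun i =>
      √((sigSwitch T P cw (i + 1) : ℝ) - sigSwitch T P cw i))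
      (fun i _ => Real.sqrt_nonneg _) hiI)
  -- regret of the surviving arm
  have hA : ∑ t ∈ Finset.Ico e u, (P t).gap (cw t) b ≤
      80 * (Real.log T * K * Q) + 732 * (Real.log T * K * √((u : ℝ) - e)) * (5 * Real.log T) := by
    set W := wellTimed T e P cw safe b (u - 1) with hW
    set F := fun i => (Finset.Ico e u).filter fun t =>
      sigSwitch T P cw i ≤ t ∧ t ≤ sigSwitch T P cw (i + 1) with hF
    have hnn : ∀ t ∈ Finset.Ico e u, 0 ≤ (P t).gap (cw t) b := fun t h1 => by
      rw [Finset.mem_Ico] at h1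
      exact (hcw t (by rw [Finset.mem_Icc]; omega)).gap_nonneg b
    have hcov : ∑ t ∈ Finset.Ico e u, (P t).gap (cw t) b ≤
        ∑ i ∈ I, ∑ t ∈ F i, (P t).gap (cw t) b := by
      have h1 : ∀ i ∈ I, ∑ t ∈ F i, (P t).gap (cw t) b = ∑ t ∈ Finset.Ico e u,
          if sigSwitch T P cw i ≤ t ∧ t ≤ sigSwitch T P cw (i + 1) then (P t).gap (cw t) b
            else 0 := fun i _ => by rw [hF, Finset.sum_filter]
      rw [Finset.sum_congr rfl h1, Finset.sum_comm]
      refine Finset.sum_le_sum fun t ht' => ?_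
      have ht'' := ht'
      rw [Finset.mem_Ico] at ht''
      obtain ⟨i, hi, h2, h3⟩ := exists_phase (P := P) (cw := cw) hT (t := t) (by omega) (by omega)
      have hiI : i ∈ I := by
        rw [hI, Finset.mem_filter]
        exact ⟨hi, t, by rw [Finset.mem_Icc]; omega, h2, h3⟩
      have h4 := Finset.single_le_sum (f := fun i =>
        if sigSwitch T P cw i ≤ t ∧ t ≤ sigSwitch T P cw (i + 1) then (P t).gap (cw t) b else 0)
        (fun i _ => by split_ifs; exacts [hnn t ht', le_rfl]) hiI
      simp only [h2, h3, and_self, if_true] at h4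
      exact h4
    refine hcov.trans ((Finset.sum_le_sum fun i hi =>
      h.sum_gap_phase_le hT hcw hs ht hsafe b (hIle i hi)).trans ?_)
    rw [Finset.sum_add_distrib, ← Finset.mul_sum, ← Finset.mul_sum, ← Finset.mul_sum]
    refine add_le_add le_rfl (mul_le_mul_of_nonneg_left ?_ (by positivity))
    refine le_trans ?_ (h.sum_wellTimed_le hc hT hcw hs hsafe hB hb)
    -- The round ranges of different phases are disjoint, so the weight `5 log T` is shared by all
    -- phases of the episode instead of being paid in each of them.
    unfold replayMass
    rw [← Finset.sum_biUnion]
    · refine Finset.sum_le_sum_of_subset_of_nonneg ?_ fun p _ _ => (replayProb T e p).2.1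
      intro p hp
      obtain ⟨i, -, hp⟩ := Finset.mem_biUnion.1 hp
      exact (Finset.mem_filter.1 hp).1
    · intro i hi j hj hij
      rw [Function.onFun, Finset.disjoint_filter]
      intro p _ h1 h2
      have key : ∀ i j, i < j → j ≤ numSigSwitches T P cw →
          sigSwitch T P cw (i + 1) ≤ sigSwitch T P cw j := by
        intro i j hij hj
        rcases eq_or_lt_of_le (Nat.succ_le_of_lt hij) with h | h
        · exact (congrArg _ h).le
        · exact (sigSwitch_strictMono hT h (by omega)).le
      rcases lt_or_gt_of_ne hij with h3 | h3
      · have := key i j h3 (hIle j hj)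
        omega
      · have := key j i h3 (hIle i hi)
        omega
  -- regret against the surviving arm
  have hBd := h.sum_average_active_le_sqrt hc hT hKT hB.few hb
  -- Survival of `b` on `[e, u - 1)` makes it active only up to round `u - 1`. In round `u` the
  -- active set may be empty, so this round gets the trivial bound.
  have hsplit : ∑ t ∈ Finset.Icc e u, meanGap (P t) (cw t) (obs t).active ≤
      ∑ t ∈ Finset.Ico e u, (2 * (P t).gap (cw t) b +
        (∑ a ∈ (obs t).active, (P t).gap b a) / ((obs t).active.card : ℝ)) + 1 / 2 := by
    rw [← Finset.Ico_insert_right heu, Finset.sum_insert (by simp), add_comm]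
    refine add_le_add (Finset.sum_le_sum fun t ht' => ?_) meanGap_le_half
    rw [Finset.mem_Ico] at ht'
    have h2 : t ∈ Finset.Icc 1 T := by rw [Finset.mem_Icc]; omega
    refine meanGap_le_add (hcw t h2) (hs t h2) (ht t h2) ⟨b, ?_⟩ b
    exact h.mem_active_of_not_eliminated ht'.1 ht'.2.le hb (h.le_own t ht'.1 ht'.2.le) (by omega)
  rw [Finset.sum_add_distrib, ← Finset.mul_sum] at hsplit
  have hL0 : 0 ≤ Real.log T := by linarith
  have h1 : Real.log T ≤ 4 * Real.log T ^ 3 := by nlinarith [sq_nonneg (Real.log T)]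
  have h2 : Real.log T ^ 2 ≤ 2 * Real.log T ^ 3 := by nlinarith [sq_nonneg (Real.log T)]
  have h3 : 1 ≤ 8 * Real.log T ^ 3 := by nlinarith [sq_nonneg (Real.log T)]
  have hKQ : 1 ≤ K * Q := by nlinarith
  have e1 : Real.log T * K * Q ≤ 4 * (Real.log T ^ 3 * K * Q) := by nlinarith
  have e2 : Real.log T ^ 2 * (K * √((u : ℝ) - e)) ≤ 4 * (Real.log T ^ 3 * K * Q) := by
    calc _ ≤ (2 * Real.log T ^ 3) * (K * (2 * Q)) := by gcongr
      _ = _ := by ring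
  have e3 : Real.log T ^ 3 * K * √((u : ℝ) - e) ≤ 2 * (Real.log T ^ 3 * K * Q) := by
    calc _ ≤ Real.log T ^ 3 * K * (2 * Q) := by gcongr
      _ = _ := by ring
  have e4 : 1 ≤ 8 * (Real.log T ^ 3 * K * Q) := by
    have : 0 ≤ Real.log T ^ 3 := by positivity
    nlinarith
  have e5 : 0 ≤ Real.log T ^ 3 * K * Q := by linarith
  linarith

end Episode

/-! ## Reachable states -/

variable {K T : ℕ}

/-- The start of the running call. -/
def State.topStart (σ : State K T) : ℕ := (σ.stack.head?.map Call.start).getD 0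

/-- Only calls that have run out are popped, so a replay still within its duration is never lost
from the stack. -/
lemma resume_spec (C : ℝ) (obs : ℕ → Obs K) (t : ℕ) (l : List (Call K))
    (h : ∃ f ∈ l, t ≤ f.start + f.dur) :
    ∃ (l₁ : List (Call K)) (f : Call K) (fs : List (Call K)), l = l₁ ++ f :: fs ∧
      t ≤ f.start + f.dur ∧ (∀ g ∈ l₁, g.start + g.dur < t) ∧
      resume C T obs t l = (f :: fs, survivors C T obs f.start t f.loc) := by
  induction l with
  | nil => simp at h
  | cons f fs ih =>
    by_cases hf : t ≤ f.start + f.dur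
    · exact ⟨[], f, fs, rfl, hf, by simp, by simp [resume, hf]⟩
    · obtain ⟨g, hg, hgt⟩ := h
      rcases List.mem_cons.1 hg with rfl | hg
      · exact absurd hgt hf
      obtain ⟨l₁, f', fs', h1, h2, h3, h4⟩ := ih ⟨g, hg, hgt⟩
      refine ⟨f :: l₁, f', fs', by rw [h1]; rfl, h2, ?_, ?_⟩
      · intro g hg
        rcases List.mem_cons.1 hg with rfl | hg
        exacts [not_le.1 hf, h3 g hg]
      · rw [resume, if_neg hf, h4]

/-- What one round does to the state, up to the random choices. -/
structure Step (C : ℝ) (t : ℕ) (σ σ' : State K T) : Prop where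
  obs_eq : ∃ o : Obs K, o.active = σ.active ∧ σ'.obs = Function.update σ.obs t o
  next : (survivors C T σ'.obs σ.epStart t σ.good = ∅ ∧ σ'.epStart = t + 1 ∧
      σ'.good = Finset.univ ∧ σ'.stack = [⟨t + 1, T + 1 - (t + 1), Finset.univ⟩] ∧
      σ'.active = Finset.univ) ∨
    (survivors C T σ'.obs σ.epStart t σ.good ≠ ∅ ∧ σ'.epStart = σ.epStart ∧ σ'.sched = σ.sched ∧
      σ'.good = survivors C T σ'.obs σ.epStart t σ.good ∧
      ((∃ m, scheduledChild σ.sched (t + 1) = some m ∧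
          σ'.stack = ⟨t + 1, m, Finset.univ⟩ :: saveLocal σ.active σ.stack ∧
          σ'.active = Finset.univ) ∨
        (scheduledChild σ.sched (t + 1) = none ∧
          (σ'.stack, σ'.active) = resume C T σ'.obs (t + 1) (saveLocal σ.active σ.stack))))

lemma step_of_mem_support_afterDuel {C : ℝ} {t : ℕ} {σ σ' : State K T} {o : Obs K}
    (ho : o.active = σ.active) (h : σ' ∈ (afterDuel C t σ o).support) : Step C t σ σ' := by
  unfold afterDuel at h
  simp only at h
  split_ifs at h with hg
  · rw [newEpisode, PMF.support_map] at h
    obtain ⟨B, -, rfl⟩ := h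
    exact ⟨⟨o, ho, rfl⟩, Or.inl ⟨hg, rfl, rfl, rfl, rfl⟩⟩
  · split at h
    · rename_i m hm
      rw [PMF.support_pure, Set.mem_singleton_iff] at h
      subst h
      exact ⟨⟨o, ho, rfl⟩, Or.inr ⟨hg, rfl, rfl, rfl, Or.inl ⟨m, hm, rfl, rfl⟩⟩⟩
    · rename_i hm
      rw [PMF.support_pure, Set.mem_singleton_iff] at h
      subst h
      exact ⟨⟨o, ho, rfl⟩, Or.inr ⟨hg, rfl, rfl, rfl, Or.inr ⟨hm, rfl⟩⟩⟩

lemma step_of_mem_support_playRound [NeZero K] {C : ℝ} {P : ℕ → PrefMatrix K} {t : ℕ}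
    {σ σ' : State K T} (h : σ' ∈ (playRound C P t σ).support) : Step C t σ σ' := by
  simp only [playRound, PMF.mem_support_bind_iff] at h
  obtain ⟨a, -, b, -, o, -, h⟩ := h
  exact step_of_mem_support_afterDuel rfl h

lemma scheduledChild_some {B : Schedule T} {t m : ℕ} (h : scheduledChild B t = some m) :
    (∃ p : Fin (T + 1) × Fin (Nat.clog 2 T), (p.1 : ℕ) = t ∧ B p = true ∧
      m = 2 ^ ((p.2 : ℕ) + 1)) ∧
    ∀ p : Fin (T + 1) × Fin (Nat.clog 2 T), (p.1 : ℕ) = t → B p = true →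
      2 ^ ((p.2 : ℕ) + 1) ≤ m := by
  unfold scheduledChild at h
  simp only at h
  split_ifs at h with hne
  rw [Option.some.injEq] at h
  constructor
  · have := Finset.max'_mem _ hne
    rw [h, Finset.mem_image] at this
    obtain ⟨p, hp, hpm⟩ := this
    rw [Finset.mem_filter] at hp
    exact ⟨p, hp.2.1, hp.2.2, hpm.symm⟩
  · intro p h1 h2
    rw [← h]
    refine Finset.le_max' _ _ ?_
    rw [Finset.mem_image]
    exact ⟨p, Finset.mem_filter.2 ⟨Finset.mem_univ p, h1, h2⟩, rfl⟩

lemma scheduledChild_none {B : Schedule T} {t : ℕ} (h : scheduledChild B t = none)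
    (p : Fin (T + 1) × Fin (Nat.clog 2 T)) (hp : (p.1 : ℕ) = t) : B p ≠ true := by
  intro hB
  unfold scheduledChild at h
  simp only at h
  split_ifs at h with hne
  exact hne ⟨_, Finset.mem_image_of_mem _ (Finset.mem_filter.2 ⟨Finset.mem_univ p, hp, hB⟩)⟩

/-- The state before round `t`, where `own v` is the start of the call that plays round `v`. -/
structure Inv (C : ℝ) (own : ℕ → ℕ) (t : ℕ) (σ : State K T) : Prop where
  one_le : 1 ≤ σ.epStart
  le : σ.epStart ≤ t
  good_eq : σ.good = Episode.alive C T σ.obs σ.epStart (t - 1)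
  good_nonempty : σ.good.Nonempty
  sorted : σ.stack.Pairwise fun f g => g.start < f.start
  bounds : ∀ f ∈ σ.stack, σ.epStart ≤ f.start ∧ f.start ≤ t
  base : ∃ f ∈ σ.stack, f.start = σ.epStart ∧ T + 1 ≤ f.start + f.dur
  scheduled : ∀ f ∈ σ.stack, f.start = σ.epStart ∨
    ∃ p : Fin (T + 1) × Fin (Nat.clog 2 T), (p.1 : ℕ) = f.start ∧ σ.sched p = true ∧
      f.dur = 2 ^ ((p.2 : ℕ) + 1)
  top : ∃ f fs, σ.stack = f :: fs ∧ own t = f.start ∧ t ≤ f.start + f.dur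
  active_eq : σ.active = Episode.alive C T σ.obs (own t) t
  loc : ∀ f ∈ σ.stack, ∀ a, ¬ Eliminated C T σ.obs f.start t a → a ∈ f.loc
  nested : ∀ f ∈ σ.stack, ∀ v, f.start ≤ v → v ≤ t → f.start ≤ own v
  runs : ∀ p : Fin (T + 1) × Fin (Nat.clog 2 T), σ.sched p = true → σ.epStart < (p.1 : ℕ) →
    (p.1 : ℕ) ≤ t → t ≤ p.1 + 2 ^ ((p.2 : ℕ) + 1) →
    ∃ f ∈ σ.stack, f.start = (p.1 : ℕ) ∧ (p.1 : ℕ) + 2 ^ ((p.2 : ℕ) + 1) ≤ f.start + f.dur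

lemma alive_eq_univ {C : ℝ} {obs : ℕ → Obs K} {lo hi : ℕ} (h : hi ≤ lo + 1) :
    Episode.alive C T obs lo hi = Finset.univ := by
  refine Finset.eq_univ_of_forall fun a => Episode.mem_alive.2 ?_
  rintro ⟨s₁, s₂, h5, h6, h7, -⟩
  omega

/-- The invariant at the start of an episode. -/
lemma inv_newEpisode [NeZero K] {C : ℝ} {own : ℕ → ℕ} {t : ℕ} {σ : State K T} (ht : 1 ≤ t)
    (htT : t ≤ T + 1)
    (h1 : σ.epStart = t) (h2 : σ.good = Finset.univ) (h3 : σ.stack = [⟨t, T + 1 - t, Finset.univ⟩])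
    (h4 : σ.active = Finset.univ) (hown : own t = σ.topStart) : Inv C own t σ := by
  have hown' : own t = t := by rw [hown, State.topStart, h3]; rfl
  have hal : ∀ lo hi, hi ≤ lo + 1 → Episode.alive C T σ.obs lo hi = Finset.univ :=
    fun lo hi hlh => alive_eq_univ hlh
  refine ⟨h1 ▸ ht, h1.le, ?_, ?_, ?_, ?_, ?_, ?_, ?_, ?_, ?_, ?_, ?_⟩
  · rw [h2, h1, hal _ _ (by omega)]
  · rw [h2]; exact Finset.univ_nonempty
  · rw [h3]; simp
  · rw [h3]; simp [h1]
  · rw [h3, h1]; simp; omega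
  · rw [h3]; simp [h1]
  · exact ⟨_, _, h3, hown', by simp only; omega⟩
  · rw [h4, hown', hal _ _ (by omega)]
  · rw [h3]; simp
  · rw [h3]
    intro f hf v hv1 hv2
    rw [List.mem_singleton] at hf
    subst hf
    have : v = t := le_antisymm hv2 hv1
    rw [this, hown']
  · intro p _ h5 h6
    omega

/-- The round starts an episode, pushes a child, or returns to the innermost live call. On return
the field `loc` matters: saved sets contain all arms alive for their call, so filtering them gives
exactly the alive arms. The field `runs` survives a push because the child of longest duration is
chosen, which covers the shorter ones scheduled in the same round. -/
lemma Inv.step [NeZero K] {C : ℝ} {own : ℕ → ℕ} {t : ℕ} {σ σ' : State K T} (h : Inv C own t σ)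
    (hs : Step C t σ σ') (htT : t ≤ T) (hown : own (t + 1) = σ'.topStart) :
    Inv C own (t + 1) σ' := by
  have ht1 : 1 ≤ t := h.one_le.trans h.le
  obtain ⟨o, ho, hobs⟩ := hs.obs_eq
  have hcongr : ∀ lo a, Eliminated C T σ.obs lo t a ↔ Eliminated C T σ'.obs lo t a := fun lo a =>
    eliminated_congr fun s hst => by rw [hobs, Function.update_of_ne (by omega)]
  have hcongr' : ∀ lo a, Eliminated C T σ.obs lo (t - 1) a ↔ Eliminated C T σ'.obs lo (t - 1) a :=
    fun lo a => eliminated_congr fun s hst => by rw [hobs, Function.update_of_ne (by omega)]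
  rcases hs.next with ⟨-, h1, h2, h3, h4⟩ | ⟨hne, hep, hsch, hgood, hcase⟩
  · exact inv_newEpisode (by omega) (by omega) h1 h2 h3 h4 hown
  have hgood' : σ'.good = Episode.alive C T σ'.obs σ'.epStart (t + 1 - 1) := by
    rw [hgood, hep, Nat.add_sub_cancel]
    ext a
    simp only [survivors, Finset.mem_filter, Episode.mem_alive, h.good_eq]
    refine ⟨fun h5 => h5.2, fun h5 => ⟨fun h6 => h5 ?_, h5⟩⟩
    exact ((hcongr' _ _).1 h6).mono le_rfl (by omega)
  have hgne : σ'.good.Nonempty := by rw [hgood]; exact Finset.nonempty_iff_ne_empty.2 hne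
  obtain ⟨f₀, fs₀, hst, hown0, htop⟩ := h.top
  set f₁ : Call K := { f₀ with loc := σ.active } with hf₁
  have hsave : saveLocal σ.active σ.stack = f₁ :: fs₀ := by rw [hst]; rfl
  rw [hsave] at hcase
  -- the saved stack
  have hback : ∀ f ∈ f₁ :: fs₀, ∃ g ∈ σ.stack, f.start = g.start ∧ f.dur = g.dur := by
    intro f hf
    rcases List.mem_cons.1 hf with rfl | hf
    · exact ⟨f₀, by rw [hst]; simp, rfl, rfl⟩
    · exact ⟨f, by rw [hst]; simp [hf], rfl, rfl⟩
  have hforth : ∀ g ∈ σ.stack, ∃ f ∈ f₁ :: fs₀, f.start = g.start ∧ f.dur = g.dur := by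
    intro g hg
    rw [hst] at hg
    rcases List.mem_cons.1 hg with rfl | hg
    · exact ⟨f₁, by simp, rfl, rfl⟩
    · exact ⟨g, by simp [hg], rfl, rfl⟩
  have hsorted : (f₁ :: fs₀).Pairwise fun f g => g.start < f.start := by
    have := h.sorted
    rw [hst, List.pairwise_cons] at this
    rw [List.pairwise_cons]
    exact this
  have hloc : ∀ f ∈ f₁ :: fs₀, ∀ a, ¬ Eliminated C T σ'.obs f.start (t + 1) a → a ∈ f.loc := by
    intro f hf a ha
    have ha' : ¬ Eliminated C T σ.obs f.start t a := fun h5 =>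
      ha (((hcongr _ _).1 h5).mono le_rfl (by omega))
    rcases List.mem_cons.1 hf with rfl | hf
    · change a ∈ σ.active
      rw [h.active_eq, Episode.mem_alive, hown0]
      exact ha'
    · exact h.loc f (by rw [hst]; simp [hf]) a ha'
  have hnested : ∀ f ∈ f₁ :: fs₀, ∀ v, f.start ≤ v → v ≤ t → f.start ≤ own v := by
    intro f hf v h5 h6
    obtain ⟨g, hg, hgs, -⟩ := hback f hf
    rw [hgs] at h5 ⊢
    exact h.nested g hg v h5 h6
  have hbounds : ∀ f ∈ f₁ :: fs₀, σ'.epStart ≤ f.start ∧ f.start ≤ t := by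
    intro f hf
    obtain ⟨g, hg, hgs, -⟩ := hback f hf
    rw [hgs, hep]
    exact h.bounds g hg
  have hsched : ∀ f ∈ f₁ :: fs₀, f.start = σ'.epStart ∨
      ∃ p : Fin (T + 1) × Fin (Nat.clog 2 T), (p.1 : ℕ) = f.start ∧ σ'.sched p = true ∧
        f.dur = 2 ^ ((p.2 : ℕ) + 1) := by
    intro f hf
    obtain ⟨g, hg, hgs, hgd⟩ := hback f hf
    rw [hgs, hgd, hep, hsch]
    exact h.scheduled g hg
  have hbase : ∃ f ∈ f₁ :: fs₀, f.start = σ'.epStart ∧ T + 1 ≤ f.start + f.dur := by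
    obtain ⟨g, hg, h5, h6⟩ := h.base
    obtain ⟨f, hf, hfs, hfd⟩ := hforth g hg
    exact ⟨f, hf, by rw [hfs, h5, hep], by rw [hfs, hfd]; exact h6⟩
  have hruns : ∀ p : Fin (T + 1) × Fin (Nat.clog 2 T), σ'.sched p = true →
      σ'.epStart < (p.1 : ℕ) → (p.1 : ℕ) ≤ t → t + 1 ≤ p.1 + 2 ^ ((p.2 : ℕ) + 1) →
      ∃ f ∈ f₁ :: fs₀, f.start = (p.1 : ℕ) ∧
        (p.1 : ℕ) + 2 ^ ((p.2 : ℕ) + 1) ≤ f.start + f.dur := by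
    intro p h5 h6 h7 h8
    rw [hsch] at h5
    rw [hep] at h6
    obtain ⟨g, hg, h9, h10⟩ := h.runs p h5 h6 h7 (by omega)
    obtain ⟨f, hf, hfs, hfd⟩ := hforth g hg
    exact ⟨f, hf, by rw [hfs, h9], by rw [hfs, hfd]; exact h10⟩
  rcases hcase with ⟨m, hm, hstack, hact⟩ | ⟨hm, hres⟩
  · have hown' : own (t + 1) = t + 1 := by rw [hown, State.topStart, hstack]; rfl
    obtain ⟨⟨p₀, hp0, hpB, hpm⟩, hmax⟩ := scheduledChild_some hm
    refine ⟨hep ▸ h.one_le, by rw [hep]; exact h.le.trans (by omega), hgood', hgne, ?_, ?_, ?_, ?_,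
      ?_, ?_, ?_, ?_, ?_⟩
    · rw [hstack, List.pairwise_cons]
      refine ⟨fun f hf => ?_, hsorted⟩
      have := (hbounds f hf).2
      change f.start < t + 1
      omega
    · rw [hstack]
      intro f hf
      rcases List.mem_cons.1 hf with rfl | hf
      · exact ⟨by rw [hep]; exact h.le.trans (by simp), le_rfl⟩
      · exact ⟨(hbounds f hf).1, (hbounds f hf).2.trans (by omega)⟩
    · obtain ⟨f, hf, h5⟩ := hbase
      exact ⟨f, by rw [hstack]; exact List.mem_cons_of_mem _ hf, h5⟩
    · rw [hstack]
      intro f hf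
      rcases List.mem_cons.1 hf with rfl | hf
      · exact Or.inr ⟨p₀, hp0, by rw [hsch]; exact hpB, hpm⟩
      · exact hsched f hf
    · exact ⟨_, _, hstack, hown', by simp only; omega⟩
    · rw [hact, hown']
      exact (alive_eq_univ (by omega)).symm
    · rw [hstack]
      intro f hf a ha
      rcases List.mem_cons.1 hf with rfl | hf
      · exact Finset.mem_univ a
      · exact hloc f hf a ha
    · rw [hstack]
      intro f hf v h5 h6
      rcases List.mem_cons.1 hf with rfl | hf
      · have : v = t + 1 := le_antisymm h6 h5
        rw [this, hown']
      · rcases Nat.lt_or_ge t v with h7 | h7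
        · have : v = t + 1 := by omega
          rw [this, hown']
          exact (hbounds f hf).2.trans (by omega)
        · exact hnested f hf v h5 h7
    · rw [hstack]
      intro p h5 h6 h7 h8
      rcases Nat.lt_or_ge t p.1 with h9 | h9
      · have h10 : (p.1 : ℕ) = t + 1 := by omega
        refine ⟨_, List.mem_cons_self, h10.symm, ?_⟩
        rw [hsch] at h5
        have := hmax p h10 h5
        simp only
        omega
      · obtain ⟨f, hf, h10⟩ := hruns p h5 h6 h9 h8
        exact ⟨f, List.mem_cons_of_mem _ hf, h10⟩
  · obtain ⟨l₁, f, fs, hl, hlive, hdead, hr⟩ := resume_spec (T := T) C σ'.obs (t + 1) (f₁ :: fs₀) (by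
      obtain ⟨f, hf, -, h5⟩ := hbase
      exact ⟨f, hf, by omega⟩)
    rw [hr, Prod.mk.injEq] at hres
    obtain ⟨hstack, hact⟩ := hres
    have hsub : ∀ g ∈ f :: fs, g ∈ f₁ :: fs₀ := fun g hg => by
      rw [hl]; exact List.mem_append_right _ hg
    have hlive' : ∀ g ∈ f₁ :: fs₀, t + 1 ≤ g.start + g.dur → g ∈ f :: fs := by
      intro g hg h5
      rw [hl] at hg
      rcases List.mem_append.1 hg with hg | hg
      · have := hdead g hg
        omega
      · exact hg
    have hown' : own (t + 1) = f.start := by rw [hown, State.topStart, hstack]; rfl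
    have hsorted' : (f :: fs).Pairwise fun f g => g.start < f.start := by
      rw [hl, List.pairwise_append] at hsorted
      exact hsorted.2.1
    refine ⟨hep ▸ h.one_le, by rw [hep]; exact h.le.trans (by omega), hgood', hgne, ?_, ?_, ?_, ?_,
      ?_, ?_, ?_, ?_, ?_⟩
    · rw [hstack]; exact hsorted'
    · rw [hstack]
      intro g hg
      exact ⟨(hbounds g (hsub g hg)).1, (hbounds g (hsub g hg)).2.trans (by omega)⟩
    · obtain ⟨g, hg, h5, h6⟩ := hbase
      exact ⟨g, by rw [hstack]; exact hlive' g hg (by omega), h5, h6⟩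
    · rw [hstack]
      exact fun g hg => hsched g (hsub g hg)
    · exact ⟨f, fs, hstack, hown', hlive⟩
    · rw [hact, hown']
      ext a
      simp only [survivors, Finset.mem_filter, Episode.mem_alive]
      exact ⟨fun h5 => h5.2, fun h5 => ⟨hloc f (hsub f (by simp)) a h5, h5⟩⟩
    · rw [hstack]
      exact fun g hg => hloc g (hsub g hg)
    · rw [hstack]
      intro g hg v h5 h6
      rcases Nat.lt_or_ge t v with h7 | h7
      · have : v = t + 1 := by omega
        rw [this, hown']
        rcases List.mem_cons.1 hg with rfl | hg
        · exact le_rfl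
        · rw [List.pairwise_cons] at hsorted'
          exact (hsorted'.1 g hg).le
      · exact hnested g (hsub g hg) v h5 h7
    · rw [hstack]
      intro p h5 h6 h7 h8
      rcases Nat.lt_or_ge t p.1 with h9 | h9
      · rw [hsch] at h5
        exact absurd h5 (scheduledChild_none hm p (by omega))
      · obtain ⟨g, hg, h10, h11⟩ := hruns p h5 h6 h9 h8
        exact ⟨g, hlive' g hg (by omega), h10, h11⟩

/-! ## Paths of the algorithm -/

variable {K T : ℕ}

/-- A sequence of states, `w k` being the state after `k` rounds. -/
structure IsPath (C : ℝ) (w : ℕ → State K T) : Prop where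
  epStart_zero : (w 0).epStart = 1
  good_zero : (w 0).good = Finset.univ
  stack_zero : (w 0).stack = [⟨1, T + 1 - 1, Finset.univ⟩]
  active_zero : (w 0).active = Finset.univ
  step : ∀ k < T, Step C (k + 1) (w k) (w (k + 1))

/-- The start of the call that plays round `t`. -/
def ownOf (w : ℕ → State K T) (t : ℕ) : ℕ := (w (t - 1)).topStart

/-- The start of the episode of round `t`. -/
def epOf (w : ℕ → State K T) (t : ℕ) : ℕ := (w (t - 1)).epStart

namespace IsPath
variable {C : ℝ} {w : ℕ → State K T}

lemma inv [NeZero K] (h : IsPath C w) {k : ℕ} (hk : k ≤ T) : Inv C (ownOf w) (k + 1) (w k) := by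
  induction k with
  | zero =>
    exact inv_newEpisode (by omega) (by omega) h.epStart_zero h.good_zero h.stack_zero
      h.active_zero rfl
  | succ k ih => exact (ih (by omega)).step (h.step k hk) hk rfl

/-- Entry `s` is written in round `s` and never changed later; therefore every elimination test can
be read off the final record. -/
lemma obs_eq_of_le (h : IsPath C w) {k s j : ℕ} (hsk : s ≤ k) (hkj : k ≤ j) (hj : j ≤ T) :
    (w k).obs s = (w j).obs s := by
  induction j, hkj using Nat.le_induction with
  | base => rfl
  | succ n hn ih =>
    obtain ⟨o, -, ho⟩ := (h.step n (by omega)).obs_eq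
    rw [ih (by omega), ho, Function.update_of_ne (by omega)]

lemma obs_eq (h : IsPath C w) {k s : ℕ} (hsk : s ≤ k) (hk : k ≤ T) :
    (w k).obs s = (w T).obs s :=
  h.obs_eq_of_le hsk hk le_rfl

lemma active_eq (h : IsPath C w) {k : ℕ} (hk : k < T) :
    ((w T).obs (k + 1)).active = (w k).active := by
  obtain ⟨o, ho, ho'⟩ := (h.step k hk).obs_eq
  rw [← h.obs_eq le_rfl hk, ho', Function.update_self, ho]

lemma eliminated_iff (h : IsPath C w) {k lo t : ℕ} {a : Fin K} (ht : t ≤ k + 1) (hk : k ≤ T) :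
    Eliminated C T (w k).obs lo t a ↔ Eliminated C T (w T).obs lo t a :=
  eliminated_congr fun _ hs => h.obs_eq (by omega) hk

lemma epOf_succ [NeZero K] (h : IsPath C w) {t : ℕ} (h1 : 1 ≤ t) (h2 : t < T) :
    (epOf w (t + 1) = epOf w t ∧ (w t).sched = (w (t - 1)).sched) ∨
      (epOf w (t + 1) = t + 1 ∧ ∀ a, Eliminated C T (w T).obs (epOf w t) t a) := by
  obtain ⟨k, rfl⟩ : ∃ k, t = k + 1 := ⟨t - 1, by omega⟩
  have hi := h.inv (k := k) (by omega)
  rcases (h.step k (by omega)).next with ⟨h3, h4, -⟩ | ⟨-, h4, h5, -⟩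
  · refine Or.inr ⟨h4, fun a => ?_⟩
    by_contra h6
    have h7 : a ∈ survivors C T (w (k + 1)).obs (w k).epStart (k + 1) (w k).good := by
      simp only [survivors, Finset.mem_filter, hi.good_eq, Episode.mem_alive]
      constructor
      · rw [h.eliminated_iff (by omega) (by omega)]
        exact fun h8 => h6 (h8.mono le_rfl (by omega))
      · rw [h.eliminated_iff (by omega) (by omega)]
        exact h6
    rw [h3] at h7
    simp at h7
  · exact Or.inl ⟨h4, h5⟩

lemma epOf_le [NeZero K] (h : IsPath C w) {t : ℕ} (h1 : 1 ≤ t) (h2 : t ≤ T) :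
    1 ≤ epOf w t ∧ epOf w t ≤ t := by
  obtain ⟨k, rfl⟩ : ∃ k, t = k + 1 := ⟨t - 1, by omega⟩
  have hi := h.inv (k := k) (by omega)
  exact ⟨hi.one_le, hi.le⟩

lemma epOf_mono [NeZero K] (h : IsPath C w) {s t : ℕ} (h1 : 1 ≤ s) (h2 : s ≤ t) (h3 : t ≤ T) :
    epOf w s ≤ epOf w t := by
  induction t, h2 using Nat.le_induction with
  | base => exact le_rfl
  | succ t ht ih =>
    have h4 := ih (by omega)
    have h5 := (h.epOf_le (t := t) (by omega) (by omega)).2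
    rcases h.epOf_succ (t := t) (by omega) (by omega) with h6 | h6 <;> omega

lemma epOf_epOf [NeZero K] (h : IsPath C w) {t : ℕ} (h1 : 1 ≤ t) (h2 : t ≤ T) :
    epOf w (epOf w t) = epOf w t := by
  induction t, h1 using Nat.le_induction with
  | base =>
    have : epOf w 1 = 1 := h.epStart_zero
    rw [this, this]
  | succ t ht ih =>
    rcases h.epOf_succ (t := t) (by omega) (by omega) with h6 | h6
    · rw [h6.1, ih (by omega)]
    · rw [h6.1, h6.1]

lemma sched_eq [NeZero K] (h : IsPath C w) {e t : ℕ} (h1 : 1 ≤ e) (h2 : e ≤ t) (h3 : t ≤ T)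
    (h4 : epOf w t = e) : (w (t - 1)).sched = (w (e - 1)).sched := by
  induction t, h2 using Nat.le_induction with
  | base => rfl
  | succ t ht ih =>
    rcases h.epOf_succ (t := t) (by omega) (by omega) with h6 | h6
    · rw [Nat.add_sub_cancel, h6.2]
      exact ih (by omega) (by omega)
    · omega

/-- Collects the invariants of the single rounds into a description of the episode in terms of the
final record. The good set before round `u` has been tested on `[e, u - 1)` only, which is where the
surviving arm comes from. -/
lemma episode [NeZero K] (h : IsPath C w) {e u : ℕ} (h1 : 1 ≤ e) (h2 : e ≤ u) (h3 : u ≤ T)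
    (hep : ∀ t, e ≤ t → t ≤ u → epOf w t = e) :
    Episode C T (w T).obs (ownOf w) (w (e - 1)).sched e u := by
  have hinv : ∀ t, e ≤ t → t ≤ u → Inv C (ownOf w) t (w (t - 1)) := by
    intro t h4 h5
    have := h.inv (k := t - 1) (by omega)
    rwa [Nat.sub_add_cancel (by omega)] at this
  have hst : ∀ t, e ≤ t → t ≤ u → (w (t - 1)).epStart = e := hep
  have hown : ∀ t, e ≤ t → t ≤ u → ∃ f ∈ (w (t - 1)).stack, ownOf w t = f.start ∧
      t ≤ f.start + f.dur := by
    intro t h4 h5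
    obtain ⟨f, fs, h6, h7, h8⟩ := (hinv t h4 h5).top
    exact ⟨f, by rw [h6]; simp, h7, h8⟩
  refine ⟨h1, h2, h3, ?_, ?_, ?_, ?_, ?_, ?_, ?_⟩
  · have hi := hinv u h2 le_rfl
    obtain ⟨b, hb⟩ := hi.good_nonempty
    rw [hi.good_eq, Episode.mem_alive, h.eliminated_iff (by omega) (by omega), hst u h2 le_rfl] at hb
    exact ⟨b, hb⟩
  · intro t h4 h5
    obtain ⟨f, hf, h6, -⟩ := hown t h4 h5
    rw [h6, ← hst t h4 h5]
    exact ((hinv t h4 h5).bounds f hf).1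
  · intro t h4 h5
    obtain ⟨f, hf, h6, -⟩ := hown t h4 h5
    rw [h6]
    exact ((hinv t h4 h5).bounds f hf).2
  · intro t v h4 h5 h6 h7
    obtain ⟨f, hf, h8, -⟩ := hown v (h4.trans h7) h5
    rw [h8] at h6 ⊢
    exact (hinv v (h4.trans h7) h5).nested f hf t h6 h7
  · intro t h4 h5 h6
    obtain ⟨f, hf, h7, h8⟩ := hown t h4 h5
    rcases (hinv t h4 h5).scheduled f hf with h9 | ⟨p, h9, h10, h11⟩
    · exact absurd (by rw [h7, h9, hst t h4 h5]) h6
    · refine ⟨p, by rw [h9, h7], ?_, by rw [h7, ← h11]; exact h8⟩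
      rwa [h.sched_eq h1 h4 (h5.trans h3) (hep t h4 h5)] at h10
  · intro t p h4 h5 h6 h7 h8 h9
    rw [← h.sched_eq h1 h4 (h5.trans h3) (hep t h4 h5)] at h6
    obtain ⟨f, hf, h10, h11⟩ := (hinv t h4 h5).runs p h6 (by rw [hst t h4 h5]; exact h7) h8 h9
    rw [← h10]
    exact (hinv t h4 h5).nested f hf t (by omega) le_rfl
  · intro t a h4 h5
    have h6 := h.active_eq (k := t - 1) (by omega)
    rw [Nat.sub_add_cancel (by omega)] at h6
    rw [h6, (hinv t h4 h5).active_eq, Episode.mem_alive, h.eliminated_iff (by omega) (by omega)]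

variable {P : ℕ → PrefMatrix K} {cw safe : ℕ → Fin K}

/-- Between the starts of two episodes every arm is eliminated. -/
lemma exists_eliminated [NeZero K] (h : IsPath C w) {x x' : ℕ} (hx : 1 ≤ x) (hxx : x < x')
    (hx' : x' ≤ T)
    (hlt : epOf w x < epOf w x') :
    ∃ t, x ≤ t ∧ t < epOf w x' ∧ epOf w t = epOf w x ∧
      ∀ a, Eliminated C T (w T).obs (epOf w x) t a := by
  by_contra! hcon
  have key : ∀ t, x ≤ t → t ≤ x' → epOf w t = epOf w x := by
    intro t ht
    induction t, ht using Nat.le_induction with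
    | base => intro _; rfl
    | succ t ht ih =>
      intro h2
      have h3 := ih (by omega)
      rcases h.epOf_succ (t := t) (by omega) (by omega) with h4 | h4
      · rw [h4.1, h3]
      · have h5 := h.epOf_mono (s := t + 1) (t := x') (by omega) h2 hx'
        obtain ⟨a, ha⟩ := hcon t ht (by omega) h3
        rw [h3] at h4
        exact absurd (h4.2 a) ha
  have := key x' hxx.le le_rfl
  omega

/-- Some round of the episode started in round `e` lies in phase `i`. -/
def MeetsPhase (T : ℕ) (P : ℕ → PrefMatrix K) (cw : ℕ → Fin K) (w : ℕ → State K T) (i e : ℕ) : Prop :=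
  ∃ t ∈ Finset.Icc 1 T, epOf w t = e ∧ sigSwitch T P cw i ≤ t ∧ t ≤ sigSwitch T P cw (i + 1)

open Classical in
/-- Every phase meets at most two episodes. -/
lemma card_episodes_le_two [NeZero K] {w : ℕ → State K T} (h : IsPath 20 w)
    (hc : Concentrated T P (w T).obs) (hT : 2 ≤ T)
    (hcw : ∀ t ∈ Finset.Icc 1 T, (P t).IsCondorcetWinner (cw t))
    (hs : ∀ t ∈ Finset.Icc 1 T, (P t).SST) (i : ℕ) :
    (((Finset.Icc 1 T).image (epOf w)).filter fun e => MeetsPhase T P cw w i e).card ≤ 2 := by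
  -- With three episodes in one phase, the middle one starts inside the phase and eliminates every
  -- arm before `x₃`. Each elimination certifies large regret, so the phase would have ended before
  -- `x₃`.
  have key : ∀ x₁ x₂ x₃ : ℕ, 1 ≤ x₁ → x₁ ≤ T → 1 ≤ x₂ → x₂ ≤ T → 1 ≤ x₃ → x₃ ≤ T →
      epOf w x₁ < epOf w x₂ → epOf w x₂ < epOf w x₃ →
      sigSwitch T P cw i ≤ x₁ → x₃ ≤ sigSwitch T P cw (i + 1) → False := by
    intro x₁ x₂ x₃ h1 h1' h2 h2' h3 h3' h12 h23 hi hi'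
    have hlt : ∀ x y, 1 ≤ x → x ≤ T → 1 ≤ y → epOf w x < epOf w y → x < y := by
      intro x y hx hx' hy hxy
      by_contra! h4
      have := h.epOf_mono hy h4 hx'
      omega
    have hx₂ := h.epOf_le h2 h2'
    have hx₃ := h.epOf_le h3 h3'
    have h5 : x₁ < epOf w x₂ := hlt _ _ h1 h1' hx₂.1 (by rw [h.epOf_epOf h2 h2']; exact h12)
    obtain ⟨t, ht1, ht2, -, ht3⟩ := h.exists_eliminated h2 (hlt _ _ h2 h2' h3 h23) h3' h23
    have hns : NoSafeArm P cw (epOf w x₂) t := fun a =>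
      hc.exists_regret_of_eliminated hT hcw hs hx₂.1 (by omega) (ht3 a)
    have := sigSwitch_succ_le_of_noSafeArm (T := T) (i := i) (by omega) (by omega)
      (hns.mono (show sigSwitch T P cw i ≤ epOf w x₂ by omega) le_rfl)
    omega
  by_contra! hcard
  obtain ⟨a, b, c, ha, hb, hc', hab, hac, hbc⟩ := Finset.two_lt_card_iff.1 hcard
  simp only [Finset.mem_filter, MeetsPhase, Finset.mem_Icc] at ha hb hc'
  obtain ⟨-, xa, ⟨ha1, ha2⟩, rfl, ha3, ha4⟩ := ha
  obtain ⟨-, xb, ⟨hb1, hb2⟩, rfl, hb3, hb4⟩ := hb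
  obtain ⟨-, xc, ⟨hc1, hc2⟩, rfl, hc3, hc4⟩ := hc'
  rcases lt_or_gt_of_ne hab with h1 | h1 <;> rcases lt_or_gt_of_ne hac with h2 | h2 <;>
    rcases lt_or_gt_of_ne hbc with h3 | h3
  · exact key xa xb xc ha1 ha2 hb1 hb2 hc1 hc2 h1 h3 ha3 hc4
  · exact key xa xc xb ha1 ha2 hc1 hc2 hb1 hb2 h2 h3 ha3 hb4
  · omega
  · exact key xc xa xb hc1 hc2 ha1 ha2 hb1 hb2 h2 h1 hc3 hb4
  · exact key xb xa xc hb1 hb2 ha1 ha2 hc1 hc2 h1 h2 hb3 hc4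
  · omega
  · exact key xb xc xa hb1 hb2 hc1 hc2 ha1 ha2 h3 h2 hb3 ha4
  · exact key xc xb xa hc1 hc2 hb1 hb2 ha1 ha2 h3 h1 hc3 ha4

open Classical in
/-- The regret of all rounds. -/
lemma sum_meanGap_le [NeZero K] {w : ℕ → State K T} (h : IsPath 20 w)
    (hc : Concentrated T P (w T).obs) (hT : 2 ≤ T) (hKT : K ≤ T)
    (hcw : ∀ t ∈ Finset.Icc 1 T, (P t).IsCondorcetWinner (cw t))
    (hs : ∀ t ∈ Finset.Icc 1 T, (P t).SST) (ht : ∀ t ∈ Finset.Icc 1 T, (P t).STI)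
    (hsafe : SafeArms T P cw safe)
    (hB : ∀ k < T, (w k).epStart = k + 1 → GoodSchedule T (k + 1) P cw safe (w k).sched) :
    ∑ t ∈ Finset.Icc 1 T, meanGap (P t) (cw t) ((w T).obs t).active ≤
      100000 * (Real.log T ^ 3 * K) * ∑ i ∈ Finset.range (numSigSwitches T P cw + 1),
        √((sigSwitch T P cw (i + 1) : ℝ) - sigSwitch T P cw i) := by
  have hL := half_le_log hT
  set St := (Finset.Icc 1 T).image (epOf w) with hSt
  set R := Finset.range (numSigSwitches T P cw + 1) with hR
  set g : ℕ → ℝ := fun i => √((sigSwitch T P cw (i + 1) : ℝ) - sigSwitch T P cw i) with hg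
  have hep : ∀ e ∈ St, ∑ t ∈ (Finset.Icc 1 T).filter (fun t => epOf w t = e),
      meanGap (P t) (cw t) ((w T).obs t).active ≤
      50000 * (Real.log T ^ 3 * K) * ∑ i ∈ R.filter (fun i => MeetsPhase T P cw w i e), g i := by
    intro e he
    obtain ⟨x, hx, hxe⟩ := Finset.mem_image.1 he
    rw [Finset.mem_Icc] at hx
    have hle := h.epOf_le hx.1 hx.2
    have hee : epOf w e = e := by rw [← hxe, h.epOf_epOf hx.1 hx.2]
    have hne : ((Finset.Icc 1 T).filter fun t => epOf w t = e).Nonempty :=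
      ⟨x, by simp [hx, hxe]⟩
    set u := ((Finset.Icc 1 T).filter fun t => epOf w t = e).max' hne with hu
    have humem := Finset.max'_mem _ hne
    rw [← hu, Finset.mem_filter, Finset.mem_Icc] at humem
    have heu : e ≤ u := by
      rw [hu]
      refine Finset.le_max' _ _ ?_
      rw [Finset.mem_filter, Finset.mem_Icc]
      exact ⟨by omega, hee⟩
    have hint : ∀ t, e ≤ t → t ≤ u → epOf w t = e := by
      intro t h1 h2
      have h3 := h.epOf_mono (s := e) (t := t) (by omega) h1 (by omega)
      have h4 := h.epOf_mono (s := t) (t := u) (by omega) h2 (by omega)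
      omega
    have hset : (Finset.Icc 1 T).filter (fun t => epOf w t = e) = Finset.Icc e u := by
      ext t
      rw [Finset.mem_filter, Finset.mem_Icc, Finset.mem_Icc]
      constructor
      · rintro ⟨h1, h2⟩
        refine ⟨by rw [← h2]; exact (h.epOf_le h1.1 h1.2).2, ?_⟩
        rw [hu]
        exact Finset.le_max' _ _ (by rw [Finset.mem_filter, Finset.mem_Icc]; exact ⟨h1, h2⟩)
      · rintro ⟨h1, h2⟩
        exact ⟨by omega, hint t h1 h2⟩
    have hE := h.episode (by omega) heu humem.1.2 hint
    have hgood := hB (e - 1) (by omega) (by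
      rw [Nat.sub_add_cancel (by omega)]
      exact hee)
    rw [Nat.sub_add_cancel (by omega)] at hgood
    rw [hset]
    refine (hE.sum_meanGap_le hc hT hKT hcw hs ht hsafe hgood).trans ?_
    refine mul_le_mul_of_nonneg_left ?_ (by positivity)
    refine Finset.sum_le_sum_of_subset_of_nonneg ?_ fun i _ _ => Real.sqrt_nonneg _
    intro i hi
    rw [Finset.mem_filter] at hi ⊢
    obtain ⟨hi1, t, ht1, ht2⟩ := hi
    rw [Finset.mem_Icc] at ht1
    exact ⟨hi1, t, by rw [Finset.mem_Icc]; omega, hint t ht1.1 ht1.2, ht2⟩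
  have hfib : ∑ t ∈ Finset.Icc 1 T, meanGap (P t) (cw t) ((w T).obs t).active =
      ∑ e ∈ St, ∑ t ∈ (Finset.Icc 1 T).filter (fun t => epOf w t = e),
        meanGap (P t) (cw t) ((w T).obs t).active :=
    (Finset.sum_fiberwise_of_maps_to (fun t ht' => Finset.mem_image_of_mem _ ht') _).symm
  rw [hfib]
  refine (Finset.sum_le_sum hep).trans ?_
  rw [← Finset.mul_sum]
  have hswap : ∑ e ∈ St, ∑ i ∈ R.filter (fun i => MeetsPhase T P cw w i e), g i =
      ∑ i ∈ R, ((St.filter fun e => MeetsPhase T P cw w i e).card : ℝ) * g i := by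
    simp only [Finset.sum_filter]
    rw [Finset.sum_comm]
    refine Finset.sum_congr rfl fun i _ => ?_
    rw [← Finset.sum_filter, Finset.sum_const, nsmul_eq_mul]
  have htwo : ∑ i ∈ R, ((St.filter fun e => MeetsPhase T P cw w i e).card : ℝ) * g i ≤
      2 * ∑ i ∈ R, g i := by
    rw [Finset.mul_sum]
    refine Finset.sum_le_sum fun i _ => mul_le_mul_of_nonneg_right ?_ (Real.sqrt_nonneg _)
    exact_mod_cast h.card_episodes_le_two hc hT hcw hs i
  rw [hswap]
  have := mul_le_mul_of_nonneg_left htwo (show 0 ≤ 50000 * (Real.log T ^ 3 * (K : ℝ)) by positivity)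
  linarith

end IsPath

/-! ## Expectations -/

section Expect
variable {α β ι : Type*}

/-- The expectation of a nonnegative function under a discrete law. -/
def expect (p : PMF α) (f : α → ℝ≥0∞) : ℝ≥0∞ := ∑' a, p a * f a

lemma expect_mono_of_support {p : PMF α} {f g : α → ℝ≥0∞} (h : ∀ a ∈ p.support, f a ≤ g a) :
    expect p f ≤ expect p g := by
  refine ENNReal.tsum_le_tsum fun a => ?_
  by_cases ha : p a = 0
  · simp [ha]
  · exact mul_le_mul_right (h a ((p.mem_support_iff a).2 ha)) _

lemma expect_mono {p : PMF α} {f g : α → ℝ≥0∞} (h : ∀ a, f a ≤ g a) : expect p f ≤ expect p g :=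
  expect_mono_of_support fun a _ => h a

lemma expect_congr_of_support {p : PMF α} {f g : α → ℝ≥0∞} (h : ∀ a ∈ p.support, f a = g a) :
    expect p f = expect p g :=
  le_antisymm (expect_mono_of_support fun a ha => (h a ha).le)
    (expect_mono_of_support fun a ha => (h a ha).ge)

lemma expect_const (p : PMF α) (c : ℝ≥0∞) : expect p (fun _ => c) = c := by
  rw [expect, ENNReal.tsum_mul_right, p.tsum_coe, one_mul]

lemma expect_mul_right (p : PMF α) (f : α → ℝ≥0∞) (c : ℝ≥0∞) :
    expect p (fun a => f a * c) = expect p f * c := by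
  simp only [expect, ← mul_assoc]
  rw [ENNReal.tsum_mul_right]

lemma expect_mul_left (p : PMF α) (f : α → ℝ≥0∞) (c : ℝ≥0∞) :
    expect p (fun a => c * f a) = c * expect p f := by
  simp only [mul_comm c]
  exact expect_mul_right p f c

lemma expect_add (p : PMF α) (f g : α → ℝ≥0∞) :
    expect p (fun a => f a + g a) = expect p f + expect p g := by
  simp only [expect, mul_add]
  exact ENNReal.tsum_add

lemma expect_sum (p : PMF α) (s : Finset ι) (f : ι → α → ℝ≥0∞) :
    expect p (fun a => ∑ i ∈ s, f i a) = ∑ i ∈ s, expect p (f i) := by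
  classical
  induction s using Finset.induction_on with
  | empty => simpa using expect_const p 0
  | insert i s hi ih =>
    simp only [Finset.sum_insert hi]
    rw [expect_add, ih]

lemma expect_pure (a : α) (f : α → ℝ≥0∞) : expect (PMF.pure a) f = f a := by
  rw [expect, tsum_eq_single a]
  · simp
  · intro b hb
    simp [hb]

lemma expect_bind (p : PMF α) (k : α → PMF β) (f : β → ℝ≥0∞) :
    expect (p.bind k) f = expect p fun a => expect (k a) f := by
  simp only [expect, PMF.bind_apply, ← ENNReal.tsum_mul_right, ← ENNReal.tsum_mul_left, mul_assoc]
  exact ENNReal.tsum_comm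

lemma expect_map (p : PMF α) (k : α → β) (f : β → ℝ≥0∞) :
    expect (p.map k) f = expect p fun a => f (k a) := by
  rw [← PMF.bind_pure_comp, expect_bind]
  simp only [Function.comp, expect_pure]

lemma expect_fintype [Fintype α] (p : PMF α) (f : α → ℝ≥0∞) : expect p f = ∑ a, p a * f a :=
  tsum_fintype _

open Classical in
/-- The probability of an event. -/
def prob (p : PMF α) (Q : α → Prop) : ℝ≥0∞ := expect p fun a => if Q a then 1 else 0

lemma prob_le_expect {p : PMF α} {Q : α → Prop} {f : α → ℝ≥0∞}
    (h : ∀ a ∈ p.support, Q a → 1 ≤ f a) : prob p Q ≤ expect p f := by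
  refine expect_mono_of_support fun a ha => ?_
  split_ifs with hQ
  exacts [h a ha hQ, zero_le]

lemma prob_mono_of_support {p : PMF α} {Q R : α → Prop} (h : ∀ a ∈ p.support, Q a → R a) :
    prob p Q ≤ prob p R := by
  refine expect_mono_of_support fun a ha => ?_
  split_ifs with h1 h2
  exacts [le_rfl, absurd (h a ha h1) h2, zero_le, le_rfl]

lemma prob_or_le (p : PMF α) (Q R : α → Prop) : prob p (fun a => Q a ∨ R a) ≤ prob p Q + prob p R := by
  rw [prob, prob, prob, ← expect_add]
  refine expect_mono fun a => ?_
  by_cases h1 : Q a <;> by_cases h2 : R a <;> simp [h1, h2]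

lemma prob_exists_le (p : PMF α) (s : Finset ι) (Q : ι → α → Prop) :
    prob p (fun a => ∃ i ∈ s, Q i a) ≤ ∑ i ∈ s, prob p (Q i) := by
  classical
  simp only [prob]
  rw [← expect_sum]
  refine expect_mono fun a => ?_
  split_ifs with h
  · obtain ⟨i, hi, hQ⟩ := h
    refine le_trans ?_ (Finset.single_le_sum (f := fun i => if Q i a then (1 : ℝ≥0∞) else 0)
      (fun _ _ => zero_le) hi)
    simp [hQ]
  · exact zero_le

end Expect

/-! ## The law of the path -/

section PathLaw
variable {K : ℕ} [NeZero K] (C : ℝ) (T : ℕ) (P : ℕ → PrefMatrix K)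

/-- The law of the sequence of states after `0, …, n` rounds. -/
def pathLaw : ℕ → PMF (ℕ → State K T)
  | 0 => (newEpisode 1 fun _ => ⟨∅, 0, 0, false⟩).map fun σ _ => σ
  | n + 1 => (pathLaw n).bind fun w =>
      (playRound C P (n + 1) (w n)).map fun σ => Function.update w (n + 1) σ

variable {C T P}

/-- The algorithm only keeps its current state. Recording all states does not change the law of the
last one, so the regret can be computed on paths, where the deterministic analysis applies. -/
lemma pathLaw_map (n : ℕ) : (pathLaw C T P n).map (fun w => w n) = anaconda C T P n := by
  induction n with
  | zero =>
    rw [pathLaw, PMF.map_comp, anaconda]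
    exact PMF.map_id _
  | succ n ih =>
    rw [pathLaw, PMF.map_bind, anaconda, ← ih, PMF.bind_map]
    congr 1
    funext w
    rw [PMF.map_comp]
    have : (fun w : ℕ → State K T => w (n + 1)) ∘ (fun σ => Function.update w (n + 1) σ) = id :=
      funext fun σ => Function.update_self _ _ _
    rw [this, PMF.map_id]
    rfl

lemma expect_pathLaw_succ (n : ℕ) (f : (ℕ → State K T) → ℝ≥0∞) :
    expect (pathLaw C T P (n + 1)) f = expect (pathLaw C T P n) fun w =>
      expect (playRound C P (n + 1) (w n)) fun σ => f (Function.update w (n + 1) σ) := by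
  rw [pathLaw, expect_bind]
  simp only [expect_map]

lemma isPath_of_mem_support {w : ℕ → State K T} (h : w ∈ (pathLaw C T P T).support) :
    IsPath C w := by
  have key : ∀ n, ∀ w ∈ (pathLaw C T P n).support, (w 0).epStart = 1 ∧
      (w 0).good = Finset.univ ∧ (w 0).stack = [⟨1, T + 1 - 1, Finset.univ⟩] ∧
      (w 0).active = Finset.univ ∧ ∀ k < n, Step C (k + 1) (w k) (w (k + 1)) := by
    intro n
    induction n with
    | zero =>
      intro w hw
      rw [pathLaw, newEpisode, PMF.map_comp, PMF.support_map] at hw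
      obtain ⟨B, -, rfl⟩ := hw
      exact ⟨rfl, rfl, rfl, rfl, fun k hk => by omega⟩
    | succ n ih =>
      intro w hw
      rw [pathLaw, PMF.mem_support_bind_iff] at hw
      obtain ⟨w', hw', hw⟩ := hw
      rw [PMF.support_map] at hw
      obtain ⟨σ, hσ, rfl⟩ := hw
      obtain ⟨h1, h2, h3, h4, h5⟩ := ih w' hw'
      simp only [Function.update_of_ne (show (0 : ℕ) ≠ n + 1 by omega)]
      refine ⟨h1, h2, h3, h4, fun k hk => ?_⟩
      rw [Function.update_of_ne (by omega)]
      rcases Nat.lt_or_ge k n with hkn | hkn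
      · rw [Function.update_of_ne (by omega)]
        exact h5 k hkn
      · obtain rfl : k = n := by omega
        rw [Function.update_self]
        exact step_of_mem_support_playRound hσ
  obtain ⟨h1, h2, h3, h4, h5⟩ := key T w h
  exact ⟨h1, h2, h3, h4, h5⟩

/-- Bounds for the conditional expectations of the single rounds add up. -/
lemma expect_pathLaw_sum_le {φ : ℕ → State K T → State K T → ℝ≥0∞} {ψ : ℕ → State K T → ℝ≥0∞}
    (n : ℕ) (h : ∀ k < n, ∀ σ, expect (playRound C P (k + 1) σ) (φ k σ) ≤ ψ k σ) :
    expect (pathLaw C T P n) (fun w => ∑ k ∈ Finset.range n, φ k (w k) (w (k + 1))) ≤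
      expect (pathLaw C T P n) (fun w => ∑ k ∈ Finset.range n, ψ k (w k)) := by
  induction n with
  | zero => simp
  | succ n ih =>
    have e1 : ∀ (w : ℕ → State K T) (σ : State K T),
        ∑ k ∈ Finset.range (n + 1), φ k (Function.update w (n + 1) σ k)
          (Function.update w (n + 1) σ (k + 1)) =
        ∑ k ∈ Finset.range n, φ k (w k) (w (k + 1)) + φ n (w n) σ := by
      intro w σ
      rw [Finset.sum_range_succ, Function.update_of_ne (by omega), Function.update_self]
      congr 1
      refine Finset.sum_congr rfl fun k hk => ?_
      rw [Finset.mem_range] at hk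
      rw [Function.update_of_ne (by omega), Function.update_of_ne (by omega)]
    have e2 : ∀ (w : ℕ → State K T) (σ : State K T),
        ∑ k ∈ Finset.range (n + 1), ψ k (Function.update w (n + 1) σ k) =
        ∑ k ∈ Finset.range n, ψ k (w k) + ψ n (w n) := by
      intro w σ
      rw [Finset.sum_range_succ, Function.update_of_ne (by omega)]
      congr 1
      refine Finset.sum_congr rfl fun k hk => ?_
      rw [Finset.mem_range] at hk
      rw [Function.update_of_ne (by omega)]
    rw [expect_pathLaw_succ, expect_pathLaw_succ]
    simp only [e1, e2, expect_add, expect_const]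
    exact add_le_add (ih fun k hk => h k (by omega)) (expect_mono fun w => h n n.lt_succ_self (w n))

/-- Bounds for the conditional expectations of the single rounds multiply. -/
lemma expect_pathLaw_prod_le {φ : ℕ → State K T → State K T → ℝ≥0∞} {c : ℕ → ℝ≥0∞}
    (h : ∀ k σ, expect (playRound C P (k + 1) σ) (φ k σ) ≤ c k) (n : ℕ) :
    expect (pathLaw C T P n) (fun w => ∏ k ∈ Finset.range n, φ k (w k) (w (k + 1))) ≤
      ∏ k ∈ Finset.range n, c k := by
  induction n with
  | zero => simpa using (expect_const (pathLaw C T P 0) 1).le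
  | succ n ih =>
    have e1 : ∀ (w : ℕ → State K T) (σ : State K T),
        ∏ k ∈ Finset.range (n + 1), φ k (Function.update w (n + 1) σ k)
          (Function.update w (n + 1) σ (k + 1)) =
        (∏ k ∈ Finset.range n, φ k (w k) (w (k + 1))) * φ n (w n) σ := by
      intro w σ
      rw [Finset.prod_range_succ, Function.update_of_ne (by omega), Function.update_self]
      congr 1
      refine Finset.prod_congr rfl fun k hk => ?_
      rw [Finset.mem_range] at hk
      rw [Function.update_of_ne (by omega), Function.update_of_ne (by omega)]
    rw [expect_pathLaw_succ, Finset.prod_range_succ]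
    simp only [e1, expect_mul_left]
    refine (expect_mono fun w : ℕ → State K T => mul_le_mul_right (h n (w n))
      (∏ k ∈ Finset.range n, φ k (w k) (w (k + 1)))).trans ?_
    rw [expect_mul_right]
    exact mul_le_mul_left ih _

lemma expect_pathLaw_zero (n : ℕ) (f : State K T → ℝ≥0∞) :
    expect (pathLaw C T P n) (fun w => f (w 0)) =
      expect (newEpisode 1 fun _ => ⟨∅, 0, 0, false⟩) f := by
  induction n with
  | zero => rw [pathLaw, expect_map]
  | succ n ih =>
    rw [expect_pathLaw_succ]
    simp only [Function.update_of_ne (show (0 : ℕ) ≠ n + 1 by omega), expect_const]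
    exact ih

end PathLaw

/-! ## A single round -/

lemma obs_of_mem_support_afterDuel {K T : ℕ} {C : ℝ} {t : ℕ} {σ σ' : State K T} {o : Obs K}
    (h : σ' ∈ (afterDuel C t σ o).support) : σ'.obs t = o := by
  unfold afterDuel at h
  simp only at h
  split_ifs at h with hg
  · rw [newEpisode, PMF.support_map] at h
    obtain ⟨B, -, rfl⟩ := h
    exact Function.update_self _ _ _
  · split at h <;>
    · rw [PMF.support_pure, Set.mem_singleton_iff] at h
      subst h
      exact Function.update_self _ _ _

section Round
variable {K T : ℕ} [NeZero K] {C : ℝ} {P : ℕ → PrefMatrix K}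

/-- The arms among which the algorithm draws. -/
def drawSet (A : Finset (Fin K)) : Finset (Fin K) := if A.Nonempty then A else Finset.univ

lemma drawSet_nonempty (A : Finset (Fin K)) : (drawSet A).Nonempty := by
  unfold drawSet
  split_ifs with h
  exacts [h, Finset.univ_nonempty]

lemma uniformArm_eq (A : Finset (Fin K)) :
    uniformArm A = PMF.uniformOfFinset (drawSet A) (drawSet_nonempty A) := by
  unfold uniformArm
  split_ifs with h
  · congr 1
    simp [drawSet, h]
  · congr 1
    simp [drawSet, h]

lemma expect_uniformArm (A : Finset (Fin K)) {g : Fin K → ℝ} (hg : ∀ a, 0 ≤ g a) :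
    expect (uniformArm A) (fun a => ENNReal.ofReal (g a)) =
      ENNReal.ofReal ((∑ a ∈ drawSet A, g a) / (drawSet A).card) := by
  have hc : (0 : ℝ) < (drawSet A).card := by exact_mod_cast (drawSet_nonempty A).card_pos
  rw [expect_fintype, uniformArm_eq]
  simp only [PMF.uniformOfFinset_apply, ite_mul, zero_mul]
  rw [← Finset.sum_filter, Finset.filter_mem_eq_inter, Finset.univ_inter, ← Finset.mul_sum,
    ← ENNReal.ofReal_sum_of_nonneg (fun a _ => hg a), div_eq_inv_mul,
    ENNReal.ofReal_mul (by positivity), ENNReal.ofReal_inv_of_pos hc, ENNReal.ofReal_natCast]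

lemma expect_coin (q : unitInterval) {g : Bool → ℝ} (hg : ∀ o, 0 ≤ g o) :
    expect (coin q) (fun o => ENNReal.ofReal (g o)) =
      ENNReal.ofReal ((q : ℝ) * g true + (1 - (q : ℝ)) * g false) := by
  have h1 := q.2.1
  have h2 : 0 ≤ 1 - (q : ℝ) := sub_nonneg.2 q.2.2
  rw [expect_fintype, Fintype.sum_bool]
  simp only [coin, PMF.ofFintype_apply, cond_true, cond_false]
  rw [← ENNReal.ofReal_mul h1, ← ENNReal.ofReal_mul h2,
    ← ENNReal.ofReal_add (mul_nonneg h1 (hg _)) (mul_nonneg h2 (hg _))]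

/-- What happens after the duel does not alter entry `t`, so only the two arm draws and the coin
contribute. -/
lemma expect_playRound_obs {t : ℕ} {σ : State K T} {g : Obs K → ℝ} (hg : ∀ o, 0 ≤ g o) :
    expect (playRound C P t σ) (fun σ' => ENNReal.ofReal (g (σ'.obs t))) =
      ENNReal.ofReal ((∑ a ∈ drawSet σ.active, (∑ b ∈ drawSet σ.active,
        (((P t).prob a b : ℝ) * g ⟨σ.active, a, b, true⟩ +
          (1 - ((P t).prob a b : ℝ)) * g ⟨σ.active, a, b, false⟩)) / (drawSet σ.active).card) /
        (drawSet σ.active).card) := by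
  have h1 : ∀ o : Obs K, expect (afterDuel C t σ o) (fun σ' => ENNReal.ofReal (g (σ'.obs t))) =
      ENNReal.ofReal (g o) := by
    intro o
    rw [expect_congr_of_support (g := fun _ => ENNReal.ofReal (g o)) fun σ' hσ' => by
      rw [obs_of_mem_support_afterDuel hσ'], expect_const]
  have hq : ∀ a b, 0 ≤ ((P t).prob a b : ℝ) * g ⟨σ.active, a, b, true⟩ +
      (1 - ((P t).prob a b : ℝ)) * g ⟨σ.active, a, b, false⟩ := fun a b =>
    add_nonneg (mul_nonneg ((P t).prob a b).2.1 (hg _))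
      (mul_nonneg (sub_nonneg.2 ((P t).prob a b).2.2) (hg _))
  simp only [playRound, expect_bind, h1]
  have h2 : ∀ a b, expect (coin ((P t).prob a b))
      (fun o => ENNReal.ofReal (g ⟨σ.active, a, b, o⟩)) =
      ENNReal.ofReal (((P t).prob a b : ℝ) * g ⟨σ.active, a, b, true⟩ +
        (1 - ((P t).prob a b : ℝ)) * g ⟨σ.active, a, b, false⟩) := fun a b =>
    expect_coin _ (g := fun o => g ⟨σ.active, a, b, o⟩) fun o => hg _
  simp only [h2]
  simp only [fun a => expect_uniformArm σ.active (hq a)]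
  exact expect_uniformArm _ fun a => div_nonneg (Finset.sum_nonneg fun b _ => hq a b) (by positivity)

/-- The expected regret of a round. -/
lemma expect_playRound_regret {t : ℕ} {σ : State K T} {w : Fin K}
    (hw : (P t).IsCondorcetWinner w) :
    expect (playRound C P t σ) (fun σ' => ENNReal.ofReal
      (((P t).gap w (σ'.obs t).fst + (P t).gap w (σ'.obs t).snd) / 2)) =
      ENNReal.ofReal (meanGap (P t) w σ.active) := by
  rw [expect_playRound_obs (g := fun o => ((P t).gap w o.fst + (P t).gap w o.snd) / 2)
    fun o => by linarith [hw.gap_nonneg o.fst, hw.gap_nonneg o.snd]]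
  congr 1
  have hc : (0 : ℝ) < (drawSet σ.active).card := by
    exact_mod_cast (drawSet_nonempty σ.active).card_pos
  have h1 : meanGap (P t) w σ.active =
      (∑ a ∈ drawSet σ.active, (P t).gap w a) / (drawSet σ.active).card := by
    unfold meanGap drawSet
    split_ifs
    · rfl
    · rw [Finset.card_univ, Fintype.card_fin]
  rw [h1]
  set A := drawSet σ.active
  have h2 : ∀ a ∈ A, (∑ b ∈ A, (((P t).prob a b : ℝ) * (((P t).gap w a + (P t).gap w b) / 2) +
      (1 - ((P t).prob a b : ℝ)) * (((P t).gap w a + (P t).gap w b) / 2))) / (A.card : ℝ) =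
      (P t).gap w a / 2 + (∑ b ∈ A, (P t).gap w b) / A.card / 2 := by
    intro a _
    rw [Finset.sum_congr rfl fun b _ => show _ = (P t).gap w a / 2 + (P t).gap w b / 2 by ring,
      Finset.sum_add_distrib, Finset.sum_const, nsmul_eq_mul, ← Finset.sum_div]
    field_simp
  rw [Finset.sum_congr rfl h2, Finset.sum_add_distrib, Finset.sum_const, nsmul_eq_mul,
    ← Finset.sum_div]
  field_simp
  ring

lemma exp_le_one_add_sq {x : ℝ} (hx : |x| ≤ 1) : Real.exp x ≤ 1 + x + x ^ 2 := by
  have := (abs_le.1 (Real.abs_exp_sub_one_sub_id_le hx)).2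
  linarith

/-- The exponential moments of a centered two-point variable with values in a bounded interval. -/
lemma two_point_exp_le {N q ρ l V : ℝ} (hN : 0 ≤ N) (hρ : 0 ≤ ρ) (hρ1 : ρ ≤ 1)
    (hq : q = ρ * N) (hV : q * N ≤ V) (hl : |l| * N ≤ 1) :
    ρ * Real.exp (l * (N - q)) + (1 - ρ) * Real.exp (l * (-q)) ≤ Real.exp (l ^ 2 * V) := by
  have hqN : q ≤ N := by rw [hq]; nlinarith
  have hq0 : 0 ≤ q := by rw [hq]; positivity
  have h1 : |l * (N - q)| ≤ 1 := by
    rw [abs_mul, abs_of_nonneg (sub_nonneg.2 hqN)]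
    exact (mul_le_mul_of_nonneg_left (by linarith) (abs_nonneg l)).trans hl
  have h2 : |l * (-q)| ≤ 1 := by
    rw [abs_mul, abs_neg, abs_of_nonneg hq0]
    exact (mul_le_mul_of_nonneg_left hqN (abs_nonneg l)).trans hl
  have h3 := mul_le_mul_of_nonneg_left (exp_le_one_add_sq h1) hρ
  have h4 := mul_le_mul_of_nonneg_left (exp_le_one_add_sq h2) (sub_nonneg.2 hρ1)
  have h5 := Real.add_one_le_exp (l ^ 2 * V)
  have h6 : l ^ 2 * (q * N) ≤ l ^ 2 * V := mul_le_mul_of_nonneg_left hV (sq_nonneg l)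
  have h7 : 0 ≤ l ^ 2 * q ^ 2 := by positivity
  -- The variable is centered, so the linear terms cancel; its variance is `q N - q²`.
  have h8 : ρ * (1 + l * (N - q) + (l * (N - q)) ^ 2) +
      (1 - ρ) * (1 + l * (-q) + (l * (-q)) ^ 2) = 1 + l ^ 2 * (q * N) - l ^ 2 * q ^ 2 := by
    rw [hq]; ring
  linarith

/-- The exponential moments of the error of the estimate in one round. -/
lemma expect_playRound_exp_le {t : ℕ} {σ : State K T} (a b : Fin K) {l : ℝ}
    (hl : |l| * (K : ℝ) ^ 2 ≤ 1) :
    expect (playRound C P t σ) (fun σ' => ENNReal.ofReal (Real.exp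
      (l * ((σ'.obs t).estimate a b - condMean (P t) (σ'.obs t).active a b)))) ≤
      ENNReal.ofReal (Real.exp (l ^ 2 * (K : ℝ) ^ 2)) := by
  rw [expect_playRound_obs (g := fun o => Real.exp
    (l * (o.estimate a b - condMean (P t) o.active a b))) fun o => (Real.exp_pos _).le]
  apply ENNReal.ofReal_le_ofReal
  have hc : (0 : ℝ) < (drawSet σ.active).card := by
    exact_mod_cast (drawSet_nonempty σ.active).card_pos
  have hcK : ((drawSet σ.active).card : ℝ) ≤ K := by
    have := Finset.card_le_univ (drawSet σ.active)
    rw [Fintype.card_fin] at this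
    exact_mod_cast this
  by_cases hab : a ∈ σ.active ∧ b ∈ σ.active
  · have hA : drawSet σ.active = σ.active := if_pos ⟨a, hab.1⟩
    rw [hA] at hc hcK ⊢
    set A := σ.active
    set N : ℝ := (A.card : ℝ) ^ 2 with hN
    have hN0 : 0 < N := by positivity
    have hN1 : 1 ≤ N := by
      have : (1 : ℝ) ≤ A.card := by exact_mod_cast Nat.one_le_iff_ne_zero.2 (by
        intro h0; rw [h0] at hc; simp at hc)
      rw [hN]; nlinarith
    set q : ℝ := ((P t).prob a b : ℝ) with hq
    have hq0 : 0 ≤ q := ((P t).prob a b).2.1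
    have hq1 : q ≤ 1 := ((P t).prob a b).2.2
    have hNK : N ≤ (K : ℝ) ^ 2 := pow_le_pow_left₀ hc.le hcK 2
    -- With both arms active the error is `N - q` with probability `q / N` and `-q` otherwise, where
    -- `N = |A|²`; its variance is at most `q N ≤ K²`.
    have hterm : ∀ a' b', (((P t).prob a' b' : ℝ) *
        Real.exp (l * ((⟨A, a', b', true⟩ : Obs K).estimate a b - condMean (P t) A a b)) +
        (1 - ((P t).prob a' b' : ℝ)) *
        Real.exp (l * ((⟨A, a', b', false⟩ : Obs K).estimate a b - condMean (P t) A a b))) =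
        Real.exp (l * (-q)) + if a' = a then (if b' = b then
          q * (Real.exp (l * (N - q)) - Real.exp (l * (-q))) else 0) else 0 := by
      intro a' b'
      have hm : condMean (P t) A a b = q - 1 / 2 := if_pos hab
      rw [hm]
      by_cases h1 : a' = a
      · by_cases h2 : b' = b
        · subst h1 h2
          simp only [Obs.estimate, and_self, if_true, Bool.false_eq_true, and_false, if_false]
          rw [show (A.card : ℝ) ^ 2 * 1 - 1 / 2 - (q - 1 / 2) = N - q by rw [hN]; ring,
            show (A.card : ℝ) ^ 2 * 0 - 1 / 2 - (q - 1 / 2) = -q by ring]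
          ring
        · simp only [Obs.estimate, h1, h2, if_true, false_and, and_false, if_false]
          rw [show (A.card : ℝ) ^ 2 * 0 - 1 / 2 - (q - 1 / 2) = -q by ring]
          ring
      · simp only [Obs.estimate, h1, false_and, if_false]
        rw [show (A.card : ℝ) ^ 2 * 0 - 1 / 2 - (q - 1 / 2) = -q by ring]
        ring
    simp only [hterm, Finset.sum_add_distrib, Finset.sum_const, nsmul_eq_mul, add_div]
    have hsum : ∀ a' ∈ A, (A.card : ℝ) * Real.exp (l * (-q)) / A.card +
        (∑ b' ∈ A, if a' = a then (if b' = b then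
          q * (Real.exp (l * (N - q)) - Real.exp (l * (-q))) else 0) else 0) / A.card =
        Real.exp (l * (-q)) + if a' = a then
          q * (Real.exp (l * (N - q)) - Real.exp (l * (-q))) / A.card else 0 := by
      intro a' _
      rw [mul_div_cancel_left₀ _ hc.ne']
      split_ifs with h1
      · rw [Finset.sum_ite_eq' A b, if_pos hab.2]
      · simp
    have hsum' := Finset.sum_congr rfl hsum
    rw [Finset.sum_add_distrib, Finset.sum_add_distrib, Finset.sum_const, nsmul_eq_mul,
      Finset.sum_const, nsmul_eq_mul, Finset.sum_ite_eq' A a, if_pos hab.1] at hsum'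
    rw [← add_div, hsum', add_div, mul_div_cancel_left₀ _ hc.ne', div_div, ← sq, ← hN]
    have h2 := two_point_exp_le (N := N) (q := q) (ρ := q / N) (l := l) (V := (K : ℝ) ^ 2) hN0.le
      (by positivity) ((div_le_one hN0).2 (hq1.trans hN1)) (by field_simp) (by nlinarith)
      ((mul_le_mul_of_nonneg_left hNK (abs_nonneg l)).trans hl)
    refine le_trans (le_of_eq ?_) h2
    field_simp
    ring
  -- Here the error is identically zero. For an empty active set arms are drawn from all of `[K]`,
  -- but then the factor `|A|²` vanishes.
  · have hone : ∀ a' ∈ drawSet σ.active, ∀ b' ∈ drawSet σ.active, ∀ o : Bool,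
        Real.exp (l * ((⟨σ.active, a', b', o⟩ : Obs K).estimate a b -
          condMean (P t) σ.active a b)) = 1 := by
      intro a' ha' b' hb' o
      rw [condMean, if_neg hab]
      have : (⟨σ.active, a', b', o⟩ : Obs K).estimate a b = -(1 / 2) := by
        by_cases hne : σ.active.Nonempty
        · rw [drawSet, if_pos hne] at ha' hb'
          have : ¬ (a' = a ∧ b' = b ∧ o = true) := by
            rintro ⟨rfl, rfl, -⟩
            exact hab ⟨ha', hb'⟩
          simp [Obs.estimate, this]
        · rw [Finset.not_nonempty_iff_eq_empty] at hne
          simp [Obs.estimate, hne]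
      rw [this]
      simp
    have : (∑ a' ∈ drawSet σ.active, (∑ b' ∈ drawSet σ.active,
        (((P t).prob a' b' : ℝ) * Real.exp (l * ((⟨σ.active, a', b', true⟩ : Obs K).estimate a b -
          condMean (P t) σ.active a b)) +
          (1 - ((P t).prob a' b' : ℝ)) * Real.exp (l *
            ((⟨σ.active, a', b', false⟩ : Obs K).estimate a b - condMean (P t) σ.active a b)))) /
          ((drawSet σ.active).card : ℝ)) / ((drawSet σ.active).card : ℝ) = 1 := by
      rw [Finset.sum_congr rfl fun a' ha' => by
        rw [Finset.sum_congr rfl fun b' hb' => by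
          rw [hone a' ha' b' hb', hone a' ha' b' hb',
            show ((P t).prob a' b' : ℝ) * 1 + (1 - ((P t).prob a' b' : ℝ)) * 1 = 1 by ring]]]
      simp only [Finset.sum_const, nsmul_eq_mul, mul_one]
      field_simp
    rw [this]
    exact Real.one_le_exp (by positivity)

end Round

/-! ## Good schedules are likely -/

section Coins
variable {ι : Type} [Fintype ι] [DecidableEq ι]

lemma expect_independentCoins_prod (q : ι → unitInterval) (g : ι → Bool → ℝ≥0∞) :
    expect (independentCoins q) (fun B => ∏ i, g i (B i)) = ∏ i, expect (coin (q i)) (g i) := by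
  rw [expect_fintype]
  simp only [independentCoins, PMF.ofFintype_apply, ← Finset.prod_mul_distrib, expect_fintype]
  have h := Finset.prod_univ_sum (fun _ : ι => (Finset.univ : Finset Bool))
    (fun i b => coin (q i) b * g i b)
  rw [Fintype.piFinset_univ] at h
  exact h.symm

/-- A Chernoff bound for weighted sums of independent Bernoulli variables. -/
lemma prob_independentCoins_sum_le (q : ι → unitInterval) (x : ι → ℝ) (hx : ∀ i, 0 ≤ x i)
    (hx1 : ∀ i, x i ≤ 1) (c : ℝ) :
    prob (independentCoins q) (fun B => c < ∑ i, if B i = true then x i else 0) ≤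
      ENNReal.ofReal (Real.exp (2 * ∑ i, (q i : ℝ) * x i - c)) := by
  have h1 : prob (independentCoins q) (fun B => c < ∑ i, if B i = true then x i else 0) ≤
      expect (independentCoins q) fun B => ENNReal.ofReal (Real.exp (-c)) *
        ∏ i, ENNReal.ofReal (Real.exp (if B i = true then x i else 0)) := by
    refine prob_le_expect fun B _ hB => ?_
    rw [← ENNReal.ofReal_prod_of_nonneg fun i _ => (Real.exp_pos _).le, ← Real.exp_sum,
      ← ENNReal.ofReal_mul (Real.exp_pos _).le, ← Real.exp_add]
    exact ENNReal.one_le_ofReal.2 (Real.one_le_exp (by linarith))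
  refine h1.trans ?_
  rw [expect_mul_left, expect_independentCoins_prod q
    (fun i o => ENNReal.ofReal (Real.exp (if o = true then x i else 0)))]
  have h2 : ∀ i, expect (coin (q i)) (fun o => ENNReal.ofReal (Real.exp (if o = true then x i else 0)))
      ≤ ENNReal.ofReal (Real.exp (2 * ((q i : ℝ) * x i))) := by
    intro i
    rw [expect_coin (q i) (g := fun o => Real.exp (if o = true then x i else 0))
      fun o => (Real.exp_pos _).le]
    apply ENNReal.ofReal_le_ofReal
    have h3 := exp_le_one_add_sq (x := x i) (by rw [abs_of_nonneg (hx i)]; exact hx1 i)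
    have h4 : Real.exp (x i) ≤ 1 + 2 * x i := by nlinarith [hx i, hx1 i]
    have h5 := Real.add_one_le_exp (2 * ((q i : ℝ) * x i))
    have h6 := mul_le_mul_of_nonneg_left h4 (q i).2.1
    simp only [if_true, Bool.false_eq_true, if_false, Real.exp_zero]
    linarith
  refine (mul_le_mul_right (Finset.prod_le_prod' fun i _ => h2 i) _).trans (le_of_eq ?_)
  rw [← ENNReal.ofReal_prod_of_nonneg fun i _ => (Real.exp_pos _).le, ← Real.exp_sum,
    ← ENNReal.ofReal_mul (Real.exp_pos _).le, ← Real.exp_add, ← Finset.mul_sum]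
  congr 2
  ring

/-- The probability that independent Bernoulli variables all fail. -/
lemma prob_independentCoins_none_le (q : ι → unitInterval) (W : Finset ι) :
    prob (independentCoins q) (fun B => ¬ ∃ i ∈ W, B i = true) ≤
      ENNReal.ofReal (Real.exp (-∑ i ∈ W, (q i : ℝ))) := by
  have h1 : prob (independentCoins q) (fun B => ¬ ∃ i ∈ W, B i = true) ≤
      expect (independentCoins q) fun B =>
        ∏ i, ENNReal.ofReal (if i ∈ W ∧ B i = true then 0 else 1) := by
    refine prob_le_expect fun B _ hB => ?_
    push Not at hB
    rw [Finset.prod_eq_one fun i _ => ?_]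
    rw [if_neg (fun h => hB i h.1 h.2), ENNReal.ofReal_one]
  refine h1.trans ?_
  rw [expect_independentCoins_prod q
    (fun i o => ENNReal.ofReal (if i ∈ W ∧ o = true then 0 else 1))]
  have h2 : ∀ i, expect (coin (q i)) (fun o => ENNReal.ofReal (if i ∈ W ∧ o = true then 0 else 1))
      ≤ ENNReal.ofReal (Real.exp (if i ∈ W then -(q i : ℝ) else 0)) := by
    intro i
    rw [expect_coin (q i) (g := fun o => if i ∈ W ∧ o = true then 0 else 1)
      fun o => by split_ifs <;> norm_num]
    apply ENNReal.ofReal_le_ofReal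
    have h5 := Real.add_one_le_exp (-(q i : ℝ))
    by_cases hi : i ∈ W
    · simp only [hi, and_self, if_true, Bool.false_eq_true, and_false, if_false]
      linarith
    · simp [hi]
  refine (Finset.prod_le_prod' fun i _ => h2 i).trans (le_of_eq ?_)
  rw [← ENNReal.ofReal_prod_of_nonneg fun i _ => (Real.exp_pos _).le, ← Real.exp_sum,
    Finset.sum_ite_mem, Finset.univ_inter, Finset.sum_neg_distrib]

end Coins

lemma sum_range_inv_sqrt_le (n : ℕ) : ∑ i ∈ Finset.range n, 1 / √((i : ℝ) + 1) ≤ 2 * √(n : ℝ) := by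
  induction n with
  | zero => simp
  | succ n ih =>
    rw [Finset.sum_range_succ]
    push_cast
    have h1 : 0 < √((n : ℝ) + 1) := Real.sqrt_pos.2 (by positivity)
    have h2 : √((n : ℝ) + 1) * √((n : ℝ) + 1) = n + 1 := Real.mul_self_sqrt (by positivity)
    have h3 : √(n : ℝ) * √(n : ℝ) = n := Real.mul_self_sqrt (by positivity)
    have h4 : 1 / √((n : ℝ) + 1) ≤ 2 * √((n : ℝ) + 1) - 2 * √(n : ℝ) := by
      rw [div_le_iff₀ h1]
      nlinarith [sq_nonneg (√((n : ℝ) + 1) - √(n : ℝ))]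
    linarith

lemma clog_le_log {T : ℕ} (hT : 2 ≤ T) : (Nat.clog 2 T : ℝ) ≤ 3 * Real.log T := by
  have h1 := Nat.pow_pred_clog_lt_self (b := 2) (by norm_num) (x := T) (by omega)
  have hc1 : 1 ≤ Nat.clog 2 T := Nat.clog_pos (by norm_num) hT
  have h2 : ((2 : ℝ) ^ (Nat.clog 2 T - 1)) ≤ T := by exact_mod_cast h1.le
  have h3 := Real.log_le_log (by positivity) h2
  rw [Real.log_pow, Nat.cast_sub hc1] at h3
  have h4 := Real.log_two_gt_d9
  have h5 : Real.log 2 ≤ Real.log T := Real.log_le_log (by norm_num) (by exact_mod_cast hT)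
  have h6 : (1 : ℝ) ≤ Nat.clog 2 T := by exact_mod_cast hc1
  push_cast at h3
  nlinarith

section Schedules
variable {K T : ℕ}

/-- The expected weight of the scheduled replays. -/
lemma sum_replayProb_mul_le {e n : ℕ} (hT : 2 ≤ T) (hn : 1 ≤ n) :
    ∑ p : Fin (T + 1) × Fin (Nat.clog 2 T), (replayProb T e p : ℝ) *
      (if e < (p.1 : ℕ) ∧ (p.1 : ℕ) ≤ e + n then √(min ((2 : ℝ) ^ ((p.2 : ℕ) + 1)) n / n) else 0) ≤
      6 * Real.log T := by
  have hn0 : (0 : ℝ) < n := by exact_mod_cast hn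
  have hsn : 0 < √(n : ℝ) := Real.sqrt_pos.2 hn0
  rw [Fintype.sum_prod_type_right]
  -- The duration `m` cancels: `1/√(m (s - e))` times `√(m / n)` leaves `1/√(n (s - e))`, whose sum
  -- over `n` rounds is at most 2. The number of durations gives the logarithm.
  have key : ∀ j : Fin (Nat.clog 2 T), ∑ s : Fin (T + 1), (replayProb T e (s, j) : ℝ) *
      (if e < (s : ℕ) ∧ (s : ℕ) ≤ e + n then √(min ((2 : ℝ) ^ ((j : ℕ) + 1)) n / n) else 0) ≤ 2 := by
    intro j
    have hterm : ∀ s : Fin (T + 1), (replayProb T e (s, j) : ℝ) *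
        (if e < (s : ℕ) ∧ (s : ℕ) ≤ e + n then √(min ((2 : ℝ) ^ ((j : ℕ) + 1)) n / n) else 0) ≤
        if (s : ℕ) ∈ Finset.Ico (e + 1) (e + n + 1) then 1 / √(n : ℝ) * (1 / √(((s : ℕ) : ℝ) - e))
          else 0 := by
      intro s
      by_cases hs : e < (s : ℕ) ∧ (s : ℕ) ≤ e + n
      · rw [if_pos hs, if_pos (by rw [Finset.mem_Ico]; omega), replayProb, if_pos hs.1]
        change 1 / √(((2 ^ ((j : ℕ) + 1) * ((s : ℕ) - e) : ℕ)) : ℝ) * _ ≤ _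
        have hse : (0 : ℝ) < ((s : ℕ) : ℝ) - e := sub_pos.2 (by exact_mod_cast hs.1)
        have hm : (0 : ℝ) < (2 : ℝ) ^ ((j : ℕ) + 1) := by positivity
        push_cast [Nat.cast_sub hs.1.le]
        rw [Real.sqrt_mul hm.le, Real.sqrt_div' _ hn0.le]
        have h1 : √(min ((2 : ℝ) ^ ((j : ℕ) + 1)) n) ≤ √((2 : ℝ) ^ ((j : ℕ) + 1)) :=
          Real.sqrt_le_sqrt (min_le_left _ _)
        have h2 : 0 < √((2 : ℝ) ^ ((j : ℕ) + 1)) := Real.sqrt_pos.2 hm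
        have h3 : 0 < √(((s : ℕ) : ℝ) - e) := Real.sqrt_pos.2 hse
        calc _ ≤ 1 / (√((2 : ℝ) ^ ((j : ℕ) + 1)) * √(((s : ℕ) : ℝ) - e)) *
              (√((2 : ℝ) ^ ((j : ℕ) + 1)) / √(n : ℝ)) := by gcongr
          _ = _ := by field_simp
      · rw [if_neg hs, mul_zero]
        split_ifs <;> positivity
    calc _ ≤ ∑ s : Fin (T + 1), _ := Finset.sum_le_sum fun s _ => hterm s
      _ = ∑ s ∈ Finset.range (T + 1), if s ∈ Finset.Ico (e + 1) (e + n + 1) then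
          1 / √(n : ℝ) * (1 / √((s : ℝ) - e)) else 0 :=
        Fin.sum_univ_eq_sum_range (fun s => if s ∈ Finset.Ico (e + 1) (e + n + 1) then
          1 / √(n : ℝ) * (1 / √((s : ℝ) - e)) else 0) (T + 1)
      _ ≤ ∑ s ∈ Finset.Ico (e + 1) (e + n + 1), 1 / √(n : ℝ) * (1 / √((s : ℝ) - e)) := by
        rw [Finset.sum_ite_mem]
        exact Finset.sum_le_sum_of_subset_of_nonneg Finset.inter_subset_right
          fun _ _ _ => by positivity
      _ = 1 / √(n : ℝ) * ∑ i ∈ Finset.range n, 1 / √((i : ℝ) + 1) := by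
        rw [← Finset.mul_sum, Finset.sum_Ico_eq_sum_range]
        congr 1
        rw [show e + n + 1 - (e + 1) = n by omega]
        refine Finset.sum_congr rfl fun i _ => ?_
        push_cast
        congr 2
        ring
      _ ≤ 1 / √(n : ℝ) * (2 * √(n : ℝ)) := by
        gcongr
        exact sum_range_inv_sqrt_le n
      _ = 2 := by field_simp
  calc _ ≤ ∑ _j : Fin (Nat.clog 2 T), (2 : ℝ) := Finset.sum_le_sum fun j _ => key j
    _ = 2 * (Nat.clog 2 T : ℝ) := by
      rw [Finset.sum_const, Finset.card_univ, Fintype.card_fin, nsmul_eq_mul, mul_comm]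
    _ ≤ _ := by linarith [clog_le_log hT]

/-- The Chernoff bound with mean at most `6 log T` has exponent `2 · 6 - 17 = -5` (times `log T`);
the factor `T` is a union over the lengths `n`. -/
lemma prob_not_fewReplays_le (e : ℕ) (hT : 2 ≤ T) :
    prob (sampleSchedule T e) (fun B => ¬ FewReplays T e B) ≤
      T * ENNReal.ofReal (Real.exp (-(5 * Real.log T))) := by
  have h1 : prob (sampleSchedule T e) (fun B => ¬ FewReplays T e B) ≤
      prob (sampleSchedule T e) (fun B => ∃ n ∈ Finset.Icc 1 T, 17 * Real.log T <
        ∑ p : Fin (T + 1) × Fin (Nat.clog 2 T), if B p = true then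
          (if e < (p.1 : ℕ) ∧ (p.1 : ℕ) ≤ e + n then √(min ((2 : ℝ) ^ ((p.2 : ℕ) + 1)) n / n)
            else 0) else 0) := by
    refine prob_mono_of_support fun B _ hB => ?_
    unfold FewReplays at hB
    push Not at hB
    obtain ⟨n, hn1, hnT, hn⟩ := hB
    refine ⟨n, Finset.mem_Icc.2 ⟨hn1, hnT⟩, hn.trans_le (le_of_eq ?_)⟩
    rw [Finset.sum_filter]
    refine Finset.sum_congr rfl fun p _ => ?_
    by_cases h2 : B p = true <;> simp [h2]
  refine h1.trans ((prob_exists_le _ _ _).trans ?_)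
  have h2 : ∀ n ∈ Finset.Icc 1 T, prob (sampleSchedule T e) (fun B => 17 * Real.log T <
        ∑ p : Fin (T + 1) × Fin (Nat.clog 2 T), if B p = true then
          (if e < (p.1 : ℕ) ∧ (p.1 : ℕ) ≤ e + n then √(min ((2 : ℝ) ^ ((p.2 : ℕ) + 1)) n / n)
            else 0) else 0) ≤ ENNReal.ofReal (Real.exp (-(5 * Real.log T))) := by
    intro n hn
    rw [Finset.mem_Icc] at hn
    have hn0 : (0 : ℝ) < n := by exact_mod_cast hn.1
    refine (prob_independentCoins_sum_le (replayProb T e) _ (fun p => ?_) (fun p => ?_) _).trans ?_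
    · split_ifs <;> positivity
    · split_ifs
      · exact Real.sqrt_le_one.2 ((div_le_one hn0).2 (min_le_right _ _))
      · exact zero_le_one
    · apply ENNReal.ofReal_le_ofReal
      apply Real.exp_le_exp.2
      linarith [sum_replayProb_mul_le (e := e) hT hn.1]
  refine (Finset.sum_le_card_nsmul _ _ _ h2).trans (le_of_eq ?_)
  rw [Nat.card_Icc, Nat.add_sub_cancel, nsmul_eq_mul]

/-- The sets `wellTimed` depend on `e`, the environment, an arm and a round, but not on the random
choices. Each one heavier than `5 log T` is missed with probability at most `T⁻⁵`, and there are
only `K (T + 1)` of them. -/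
lemma prob_not_goodSchedule_le (e : ℕ) (hT : 2 ≤ T) (hKT : K ≤ T) (P : ℕ → PrefMatrix K)
    (cw safe : ℕ → Fin K) :
    prob (sampleSchedule T e) (fun B => ¬ GoodSchedule T e P cw safe B) ≤
      ENNReal.ofReal (3 * ((T : ℝ) ^ 3)⁻¹) := by
  have hT2 : (2 : ℝ) ≤ T := by exact_mod_cast hT
  have hKT' : (K : ℝ) ≤ T := by exact_mod_cast hKT
  have hexp : Real.exp (-(5 * Real.log T)) = ((T : ℝ) ^ 5)⁻¹ := by
    rw [Real.exp_neg, show 5 * Real.log T = Real.log ((T : ℝ) ^ 5) by rw [Real.log_pow]; norm_num,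
      Real.exp_log (by positivity)]
  have h1 : prob (sampleSchedule T e) (fun B => ¬ GoodSchedule T e P cw safe B) ≤
      prob (sampleSchedule T e) (fun B => ¬ FewReplays T e B ∨
        ∃ i ∈ (Finset.univ : Finset (Fin K)) ×ˢ Finset.range (T + 1),
          5 * Real.log T < ∑ p ∈ wellTimed T e P cw safe i.1 i.2, (replayProb T e p : ℝ) ∧
          ¬ ∃ p ∈ wellTimed T e P cw safe i.1 i.2, B p = true) := by
    refine prob_mono_of_support fun B _ hB => ?_
    by_contra h2
    push Not at h2
    refine hB ⟨h2.1, fun a r hr => ?_⟩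
    by_contra h3
    rw [not_or, not_le] at h3
    obtain ⟨p, hp⟩ := h2.2 (a, r)
      (Finset.mem_product.2 ⟨Finset.mem_univ _, Finset.mem_range.2 (by simp only; omega)⟩) h3.1
    exact h3.2 ⟨p, hp⟩
  have h2 : ∀ i ∈ (Finset.univ : Finset (Fin K)) ×ˢ Finset.range (T + 1),
      prob (sampleSchedule T e) (fun B =>
          5 * Real.log T < ∑ p ∈ wellTimed T e P cw safe i.1 i.2, (replayProb T e p : ℝ) ∧
          ¬ ∃ p ∈ wellTimed T e P cw safe i.1 i.2, B p = true) ≤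
      ENNReal.ofReal (Real.exp (-(5 * Real.log T))) := by
    intro i _
    by_cases h3 : 5 * Real.log T < ∑ p ∈ wellTimed T e P cw safe i.1 i.2, (replayProb T e p : ℝ)
    · refine (prob_mono_of_support fun B _ hB => hB.2).trans
        ((prob_independentCoins_none_le (replayProb T e) _).trans ?_)
      exact ENNReal.ofReal_le_ofReal (Real.exp_le_exp.2 (by linarith))
    · refine (prob_le_expect (f := fun _ => 0) fun B _ hB => absurd hB.1 h3).trans ?_
      rw [expect_const]
      exact zero_le
  refine h1.trans ((prob_or_le _ _ _).trans ((add_le_add (prob_not_fewReplays_le e hT)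
    ((prob_exists_le _ _ _).trans (Finset.sum_le_card_nsmul _ _ _ h2))).trans ?_))
  rw [Finset.card_product, Finset.card_univ, Fintype.card_fin, Finset.card_range, nsmul_eq_mul,
    ← add_mul, hexp, ← Nat.cast_add, ← ENNReal.ofReal_natCast, ← ENNReal.ofReal_mul (by positivity)]
  apply ENNReal.ofReal_le_ofReal
  rw [← div_eq_mul_inv, ← div_eq_mul_inv, div_le_div_iff₀ (by positivity) (by positivity)]
  push_cast
  have h3 : (T : ℝ) + K * (T + 1) ≤ 3 * T ^ 2 := by nlinarith
  calc ((T : ℝ) + K * (T + 1)) * T ^ 3 ≤ 3 * T ^ 2 * T ^ 3 := by gcongr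
    _ = _ := by ring

end Schedules

/-! ## Bad schedules and bad estimates are unlikely -/

lemma expect_newEpisode {K T t : ℕ} {obs : ℕ → Obs K} {f : State K T → ℝ≥0∞} {g : Schedule T → ℝ≥0∞}
    (h : ∀ σ : State K T, σ.epStart = t → f σ ≤ g σ.sched) :
    expect (newEpisode t obs) f ≤ expect (sampleSchedule T t) g := by
  rw [newEpisode, expect_map]
  exact expect_mono fun B => h _ rfl

section BadEvents
variable {K T : ℕ} [NeZero K] {C : ℝ} {P : ℕ → PrefMatrix K}

/-- A round starts a new episode with a schedule of a given kind with at most the probability of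
these schedules. -/
lemma prob_playRound_newEpisode_le {t : ℕ} (σ : State K T) (Q : Schedule T → Prop) :
    prob (playRound C P t σ) (fun σ' => σ.epStart ≠ t + 1 ∧ σ'.epStart = t + 1 ∧ Q σ'.sched) ≤
      prob (sampleSchedule T (t + 1)) Q := by
  have h1 : ∀ o, prob (afterDuel C t σ o)
      (fun σ' => σ.epStart ≠ t + 1 ∧ σ'.epStart = t + 1 ∧ Q σ'.sched) ≤
      prob (sampleSchedule T (t + 1)) Q := by
    intro o
    by_cases h0 : σ.epStart = t + 1
    · refine (prob_le_expect (f := fun _ => 0) fun σ' _ h => absurd h0 h.1).trans ?_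
      rw [expect_const]
      exact zero_le
    unfold afterDuel
    simp only
    split_ifs with hg
    · refine expect_newEpisode fun σ' _ => ?_
      split_ifs with h2 h3
      exacts [le_rfl, absurd h2.2.2 h3, zero_le, le_rfl]
    · split <;>
      · refine (prob_le_expect (f := fun _ => 0) fun σ' hσ' h => ?_).trans ?_
        · rw [PMF.support_pure, Set.mem_singleton_iff] at hσ'
          subst hσ'
          exact absurd h.2.1 h0
        · rw [expect_const]
          exact zero_le
  unfold prob at h1 ⊢
  unfold playRound
  simp only [expect_bind]
  calc _ ≤ expect (uniformArm σ.active) fun a => expect (uniformArm σ.active) fun b =>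
        expect (coin ((P t).prob a b)) fun _ => prob (sampleSchedule T (t + 1)) Q :=
        expect_mono fun a => expect_mono fun b => expect_mono fun o => h1 _
    _ = _ := by simp only [expect_const]; rfl

/-- Schedules are drawn afresh whatever the past was, so the bound `3 T⁻³` holds conditionally for
each possible starting round, and these are summed. -/
lemma prob_badSchedule_le (hT : 2 ≤ T) (hKT : K ≤ T) (cw safe : ℕ → Fin K) :
    prob (pathLaw C T P T) (fun w => ∃ k < T, (w k).epStart = k + 1 ∧
      ¬ GoodSchedule T (k + 1) P cw safe (w k).sched) ≤ ENNReal.ofReal (6 * ((T : ℝ) ^ 2)⁻¹) := by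
  classical
  set δ := ENNReal.ofReal (3 * ((T : ℝ) ^ 3)⁻¹) with hδ
  set φ : ℕ → State K T → State K T → ℝ≥0∞ := fun k σ σ' =>
    if σ.epStart ≠ k + 2 ∧ σ'.epStart = k + 2 ∧ ¬ GoodSchedule T (k + 2) P cw safe σ'.sched
      then 1 else 0 with hφ
  set f₀ : State K T → ℝ≥0∞ := fun σ =>
    if σ.epStart = 1 ∧ ¬ GoodSchedule T 1 P cw safe σ.sched then 1 else 0 with hf₀
  have h1 : prob (pathLaw C T P T) (fun w => ∃ k < T, (w k).epStart = k + 1 ∧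
      ¬ GoodSchedule T (k + 1) P cw safe (w k).sched) ≤
      expect (pathLaw C T P T) (fun w => f₀ (w 0) +
        ∑ k ∈ Finset.range T, φ k (w k) (w (k + 1))) := by
    refine prob_le_expect fun w hw h => ?_
    obtain ⟨k, hk, h2, h3⟩ := h
    cases k with
    | zero =>
      refine le_trans (le_of_eq ?_) le_self_add
      exact (if_pos ⟨h2, h3⟩).symm
    | succ k =>
      refine le_trans ?_ le_add_self
      refine le_trans (le_of_eq ?_) (Finset.single_le_sum
        (f := fun k => φ k (w k) (w (k + 1))) (fun _ _ => zero_le)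
        (Finset.mem_range.2 (by omega : k < T)))
      -- The episode before this round started by round `k + 1`, so one that starts in round `k + 2`
      -- has just drawn its schedule.
      have hi := (isPath_of_mem_support hw).inv (k := k) (by omega)
      have := hi.le
      exact (if_pos ⟨by omega, h2, h3⟩).symm
  refine h1.trans ?_
  rw [expect_add, expect_pathLaw_zero]
  have h2 : expect (newEpisode 1 fun _ => ⟨∅, 0, 0, false⟩) f₀ ≤ δ := by
    refine le_trans (expect_newEpisode
      (g := fun B => if ¬ GoodSchedule T 1 P cw safe B then 1 else 0) fun σ hσ => ?_) ?_
    · simp only [hf₀, hσ, true_and, le_refl]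
    · have := prob_not_goodSchedule_le 1 hT hKT P cw safe
      unfold prob at this
      refine le_of_eq_of_le ?_ this
      congr! 2
      beta_reduce
      congr
  have h3 : expect (pathLaw C T P T) (fun w => ∑ k ∈ Finset.range T, φ k (w k) (w (k + 1))) ≤
      expect (pathLaw C T P T) (fun w => ∑ _k ∈ Finset.range T, δ) := by
    refine expect_pathLaw_sum_le (ψ := fun _ _ => δ) T fun k hk σ => ?_
    refine le_trans ?_ ((prob_playRound_newEpisode_le (C := C) (P := P) (t := k + 1) σ
      (fun B => ¬ GoodSchedule T (k + 2) P cw safe B)).trans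
      (prob_not_goodSchedule_le (k + 2) hT hKT P cw safe))
    unfold prob
    refine le_of_eq ?_
    congr 1
    funext σ'
    simp only [hφ]
    congr!
  refine (add_le_add h2 h3).trans ?_
  rw [expect_const, Finset.sum_const, Finset.card_range, nsmul_eq_mul, hδ,
    ← ENNReal.ofReal_natCast, ← ENNReal.ofReal_mul (by positivity),
    ← ENNReal.ofReal_add (by positivity) (by positivity)]
  apply ENNReal.ofReal_le_ofReal
  have hT1 : (1 : ℝ) ≤ T := by exact_mod_cast (by omega : 1 ≤ T)
  have hT0 : (0 : ℝ) < T := by linarith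
  rw [show 3 * ((T : ℝ) ^ 3)⁻¹ + T * (3 * ((T : ℝ) ^ 3)⁻¹) = (3 + 3 * T) / T ^ 3 by field_simp,
    show 6 * ((T : ℝ) ^ 2)⁻¹ = 6 / T ^ 2 by ring, div_le_div_iff₀ (by positivity) (by positivity)]
  nlinarith [pow_pos hT0 2, pow_pos hT0 3]

lemma prod_range_ite_ofReal_exp {s₁ s₂ : ℕ} (h1 : 1 ≤ s₁) (h2 : s₂ ≤ T) (y : ℕ → ℝ) :
    ∏ k ∈ Finset.range T, (if k + 1 ∈ Finset.Icc s₁ s₂ then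
      ENNReal.ofReal (Real.exp (y (k + 1))) else 1) =
      ENNReal.ofReal (Real.exp (∑ s ∈ Finset.Icc s₁ s₂, y s)) := by
  have h3 : ∀ k, (if k + 1 ∈ Finset.Icc s₁ s₂ then ENNReal.ofReal (Real.exp (y (k + 1))) else 1) =
      ENNReal.ofReal (Real.exp (if k + 1 ∈ Finset.Icc s₁ s₂ then y (k + 1) else 0)) := by
    intro k
    split_ifs <;> simp
  simp only [h3]
  rw [← ENNReal.ofReal_prod_of_nonneg fun i _ => (Real.exp_pos _).le, ← Real.exp_sum]
  congr 2
  have h4 : ∑ k ∈ Finset.range T, (fun s => if s ∈ Finset.Icc s₁ s₂ then y s else 0) (k + 1) =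
      ∑ s ∈ Finset.Ico 1 (T + 1), if s ∈ Finset.Icc s₁ s₂ then y s else 0 := by
    rw [Finset.sum_Ico_eq_sum_range]
    simp only [Nat.add_sub_cancel, add_comm 1]
  rw [h4, Finset.sum_ite_mem, Finset.inter_eq_right.2]
  intro s hs
  rw [Finset.mem_Icc] at hs
  rw [Finset.mem_Ico]
  omega

/-- A Bernstein bound for the estimates. -/
lemma prob_sum_estimate_le (a b : Fin K) {s₁ s₂ : ℕ} (h1 : 1 ≤ s₁) (h2 : s₁ < s₂) (h3 : s₂ ≤ T)
    (ε : ℝ) (hε : |ε| = 1) (c : ℝ) :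
    prob (pathLaw C T P T) (fun w => c * (K * √(max ((s₂ : ℝ) - (s₁ : ℝ)) ((K : ℝ) ^ 2))) <
      ε * ∑ s ∈ Finset.Icc s₁ s₂,
        (((w s).obs s).estimate a b - condMean (P s) ((w s).obs s).active a b)) ≤
      ENNReal.ofReal (Real.exp (2 - c)) := by
  have hK : (1 : ℝ) ≤ K := by exact_mod_cast NeZero.one_le
  have hn : (1 : ℝ) ≤ (s₂ : ℝ) - s₁ := by
    have : (s₁ : ℝ) + 1 ≤ s₂ := by exact_mod_cast h2
    linarith
  set m : ℝ := max ((s₂ : ℝ) - (s₁ : ℝ)) ((K : ℝ) ^ 2) with hm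
  have hm1 : (s₂ : ℝ) - s₁ ≤ m := le_max_left _ _
  have hm2 : (K : ℝ) ^ 2 ≤ m := le_max_right _ _
  have hm0 : 0 < m := by linarith
  have hsm : (K : ℝ) ≤ √m := Real.le_sqrt_of_sq_le hm2
  have hsm0 : 0 < √m := Real.sqrt_pos.2 hm0
  -- Since `m ≥ K²`, this tilt satisfies `|l| K² ≤ 1`. The variance cost per round is `l² K² = 1 /
  -- m`, and the interval has at most `2 m` rounds, hence the 2 in the exponent.
  set l : ℝ := ε * (1 / (K * √m)) with hl
  have hlabs : |l| = 1 / (K * √m) := by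
    rw [hl, abs_mul, hε, one_mul, abs_of_pos (by positivity)]
  have hlK : |l| * (K : ℝ) ^ 2 ≤ 1 := by
    rw [hlabs, one_div, inv_mul_le_iff₀ (by positivity)]
    nlinarith
  have hl2 : l ^ 2 * (K : ℝ) ^ 2 = 1 / m := by
    rw [← sq_abs, hlabs, div_pow, mul_pow, Real.sq_sqrt hm0.le]
    field_simp
  set X : ℕ → State K T → ℝ := fun s σ =>
    l * ((σ.obs s).estimate a b - condMean (P s) (σ.obs s).active a b) with hX
  have h4 : prob (pathLaw C T P T) (fun w => c * (K * √m) <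
      ε * ∑ s ∈ Finset.Icc s₁ s₂,
        (((w s).obs s).estimate a b - condMean (P s) ((w s).obs s).active a b)) ≤
      expect (pathLaw C T P T) (fun w => ENNReal.ofReal (Real.exp (-c)) *
        ∏ k ∈ Finset.range T, if k + 1 ∈ Finset.Icc s₁ s₂ then
          ENNReal.ofReal (Real.exp (X (k + 1) (w (k + 1)))) else 1) := by
    refine prob_le_expect fun w _ hw => ?_
    rw [prod_range_ite_ofReal_exp (T := T) h1 h3 (fun s => X s (w s)),
      ← ENNReal.ofReal_mul (Real.exp_pos _).le, ← Real.exp_add]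
    refine ENNReal.one_le_ofReal.2 (Real.one_le_exp ?_)
    have h5 : ∑ s ∈ Finset.Icc s₁ s₂, X s (w s) = 1 / (K * √m) * (ε * ∑ s ∈ Finset.Icc s₁ s₂,
        (((w s).obs s).estimate a b - condMean (P s) ((w s).obs s).active a b)) := by
      simp only [hX, hl]
      rw [← Finset.mul_sum]
      ring
    rw [h5]
    have h6 := mul_le_mul_of_nonneg_left hw.le (show 0 ≤ 1 / (K * √m) by positivity)
    have h7 : 1 / (K * √m) * (c * (K * √m)) = c := by field_simp
    linarith
  refine h4.trans ?_
  rw [expect_mul_left]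
  have h5 := expect_pathLaw_prod_le (C := C) (T := T) (P := P)
    (φ := fun k _ σ' => if k + 1 ∈ Finset.Icc s₁ s₂ then
      ENNReal.ofReal (Real.exp (X (k + 1) σ')) else 1)
    (c := fun k => if k + 1 ∈ Finset.Icc s₁ s₂ then ENNReal.ofReal (Real.exp (1 / m)) else 1)
    (fun k σ => by
      split_ifs
      · rw [← hl2]
        exact expect_playRound_exp_le a b hlK
      · exact (expect_const _ _).le) T
  rw [prod_range_ite_ofReal_exp (T := T) h1 h3 (fun _ => 1 / m), Finset.sum_const, Nat.card_Icc,
    nsmul_eq_mul, Nat.cast_sub (by omega)] at h5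
  refine (mul_le_mul_right h5 _).trans ?_
  rw [← ENNReal.ofReal_mul (Real.exp_pos _).le, ← Real.exp_add]
  apply ENNReal.ofReal_le_ofReal
  apply Real.exp_le_exp.2
  have h6 : (((s₂ + 1 : ℕ) : ℝ) - s₁) * (1 / m) ≤ 2 := by
    push_cast
    rw [mul_one_div, div_le_iff₀ hm0]
    linarith
  linarith

/-- A union bound over pairs of endpoints, pairs of arms and two signs, each failing with
probability at most `e² T⁻¹⁰`; here `K ≤ T` enters. -/
lemma prob_not_concentrated_le (hT : 2 ≤ T) (hKT : K ≤ T) :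
    prob (pathLaw C T P T) (fun w => ¬ Concentrated T P (w T).obs) ≤
      ENNReal.ofReal (((T : ℝ) ^ 2)⁻¹) := by
  have hT2 : (2 : ℝ) ≤ T := by exact_mod_cast hT
  have hKT' : (K : ℝ) ≤ T := by exact_mod_cast hKT
  set sgn : Bool → ℝ := fun o => if o = true then 1 else -1 with hsgn
  set Q : (ℕ × ℕ) × (Fin K × Fin K) × Bool → (ℕ → State K T) → Prop := fun i w =>
    i.1.1 < i.1.2 ∧ 10 * Real.log T * (K * √(max ((i.1.2 : ℝ) - (i.1.1 : ℝ)) ((K : ℝ) ^ 2))) <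
      sgn i.2.2 * ∑ s ∈ Finset.Icc i.1.1 i.1.2,
        (((w s).obs s).estimate i.2.1.1 i.2.1.2 -
          condMean (P s) ((w s).obs s).active i.2.1.1 i.2.1.2) with hQ
  set I : Finset ((ℕ × ℕ) × (Fin K × Fin K) × Bool) :=
    (Finset.Icc 1 T ×ˢ Finset.Icc 1 T) ×ˢ Finset.univ with hI
  have h1 : prob (pathLaw C T P T) (fun w => ¬ Concentrated T P (w T).obs) ≤
      prob (pathLaw C T P T) (fun w => ∃ i ∈ I, Q i w) := by
    refine prob_mono_of_support fun w hw h => ?_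
    unfold Concentrated at h
    push Not at h
    obtain ⟨s₁, s₂, a, b, h2, h3, h4, h5⟩ := h
    have h6 : ∑ s ∈ Finset.Icc s₁ s₂, (((w T).obs s).estimate a b -
        condMean (P s) ((w T).obs s).active a b) = ∑ s ∈ Finset.Icc s₁ s₂,
        (((w s).obs s).estimate a b - condMean (P s) ((w s).obs s).active a b) := by
      refine Finset.sum_congr rfl fun s hs => ?_
      rw [Finset.mem_Icc] at hs
      rw [(isPath_of_mem_support hw).obs_eq le_rfl (by omega : s ≤ T)]
    rw [h6, lt_abs] at h5
    have hmem : ∀ o, (((s₁, s₂), ((a, b), o)) : (ℕ × ℕ) × (Fin K × Fin K) × Bool) ∈ I := by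
      intro o
      simp only [hI, Finset.mem_product, Finset.mem_Icc, Finset.mem_univ, and_true]
      omega
    rcases h5 with h5 | h5
    · refine ⟨_, hmem true, h3, ?_⟩
      simp only [hsgn, if_true, one_mul, ← mul_assoc]
      exact h5
    · refine ⟨_, hmem false, h3, ?_⟩
      simp only [hsgn, Bool.false_eq_true, if_false, neg_one_mul, ← mul_assoc]
      exact h5
  have h2 : ∀ i ∈ I, prob (pathLaw C T P T) (Q i) ≤
      ENNReal.ofReal (Real.exp (2 - 10 * Real.log T)) := by
    rintro ⟨⟨s₁, s₂⟩, ⟨⟨a, b⟩, o⟩⟩ hi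
    simp only [hI, Finset.mem_product, Finset.mem_Icc, Finset.mem_univ, and_true] at hi
    by_cases h3 : s₁ < s₂
    · refine (prob_mono_of_support fun w _ h => h.2).trans ?_
      refine prob_sum_estimate_le a b hi.1.1 h3 hi.2.2 (sgn o) ?_ _
      cases o <;> simp [hsgn]
    · refine (prob_le_expect (f := fun _ => 0) fun w _ h => absurd h.1 h3).trans ?_
      rw [expect_const]
      exact zero_le
  refine h1.trans ((prob_exists_le _ _ _).trans ((Finset.sum_le_card_nsmul _ _ _ h2).trans ?_))
  have hcard : I.card = T * T * (K * K * 2) := by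
    simp [hI]
  have hexp : Real.exp (2 - 10 * Real.log T) = Real.exp 2 * ((T : ℝ) ^ 10)⁻¹ := by
    rw [Real.exp_sub, show 10 * Real.log T = Real.log ((T : ℝ) ^ 10) by rw [Real.log_pow]; norm_num,
      Real.exp_log (by positivity), div_eq_mul_inv]
  have he : Real.exp 2 ≤ 8 := by
    have h3 := Real.exp_one_lt_d9
    have h4 : Real.exp 2 = Real.exp 1 * Real.exp 1 := by rw [← Real.exp_add]; norm_num
    have h5 := Real.exp_pos 1
    rw [h4]
    nlinarith
  rw [hcard, hexp, nsmul_eq_mul, ← ENNReal.ofReal_natCast, ← ENNReal.ofReal_mul (by positivity)]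
  apply ENNReal.ofReal_le_ofReal
  push_cast
  calc (T : ℝ) * T * (K * K * 2) * (Real.exp 2 * ((T : ℝ) ^ 10)⁻¹) ≤
        (T : ℝ) * T * (T * T * T) * (T ^ 3 * ((T : ℝ) ^ 10)⁻¹) := by
        have h8 : (8 : ℝ) ≤ T ^ 3 := by nlinarith [sq_nonneg (T : ℝ)]
        gcongr
        linarith
    _ = ((T : ℝ) ^ 2)⁻¹ := by field_simp

end BadEvents

/-! ## The expected regret -/

lemma dynamicRegret_nonneg {K T : ℕ} {P : ℕ → PrefMatrix K} {cw : ℕ → Fin K}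
    (hcw : ∀ t ∈ Finset.Icc 1 T, (P t).IsCondorcetWinner (cw t))
    (h : Fin T → Fin K × Fin K) : 0 ≤ dynamicRegret P cw h := by
  refine Finset.sum_nonneg fun i _ => ?_
  have hi : (i : ℕ) + 1 ∈ Finset.Icc 1 T := by rw [Finset.mem_Icc]; omega
  have := (hcw _ hi).gap_nonneg (h i).1
  have := (hcw _ hi).gap_nonneg (h i).2
  linarith

section Regret
variable {K T : ℕ} [NeZero K] {C : ℝ} {P : ℕ → PrefMatrix K} {cw : ℕ → Fin K}

/-- The expected regret is bounded by the expected means of the gaps over the active sets. -/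
lemma ofReal_expectedRegret_le (hcw : ∀ t ∈ Finset.Icc 1 T, (P t).IsCondorcetWinner (cw t)) :
    ENNReal.ofReal (expectedRegret C T P cw) ≤ expect (pathLaw C T P T) fun w =>
      ENNReal.ofReal (∑ t ∈ Finset.Icc 1 T, meanGap (P t) (cw t) ((w T).obs t).active) := by
  have hcw' : ∀ k < T, (P (k + 1)).IsCondorcetWinner (cw (k + 1)) := fun k hk =>
    hcw _ (by rw [Finset.mem_Icc]; omega)
  have h1 : ENNReal.ofReal (expectedRegret C T P cw) =
      expect (playLaw C T P) fun h => ENNReal.ofReal (dynamicRegret P cw h) := by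
    rw [expect_fintype, expectedRegret, ENNReal.ofReal_sum_of_nonneg fun h _ =>
      mul_nonneg ENNReal.toReal_nonneg (dynamicRegret_nonneg hcw h)]
    refine Finset.sum_congr rfl fun h _ => ?_
    rw [ENNReal.ofReal_mul ENNReal.toReal_nonneg, ENNReal.ofReal_toReal (PMF.apply_ne_top _ _)]
  rw [h1, playLaw, expect_map, ← pathLaw_map, expect_map]
  set φ : ℕ → State K T → State K T → ℝ≥0∞ := fun k _ σ' => ENNReal.ofReal
    (((P (k + 1)).gap (cw (k + 1)) (σ'.obs (k + 1)).fst +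
      (P (k + 1)).gap (cw (k + 1)) (σ'.obs (k + 1)).snd) / 2) with hφ
  have h2 : expect (pathLaw C T P T) (fun w => ENNReal.ofReal (dynamicRegret P cw
      fun i : Fin T => (((w T).obs (i + 1)).fst, ((w T).obs (i + 1)).snd))) =
      expect (pathLaw C T P T) (fun w => ∑ k ∈ Finset.range T, φ k (w k) (w (k + 1))) := by
    refine expect_congr_of_support fun w hw => ?_
    have hnn : ∀ k < T, 0 ≤ ((P (k + 1)).gap (cw (k + 1)) ((w T).obs (k + 1)).fst +
      (P (k + 1)).gap (cw (k + 1)) ((w T).obs (k + 1)).snd) / 2 := fun k hk => by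
      linarith [(hcw' k hk).gap_nonneg ((w T).obs (k + 1)).fst,
        (hcw' k hk).gap_nonneg ((w T).obs (k + 1)).snd]
    rw [dynamicRegret, Fin.sum_univ_eq_sum_range (fun k =>
      ((P (k + 1)).gap (cw (k + 1)) ((w T).obs (k + 1)).fst +
        (P (k + 1)).gap (cw (k + 1)) ((w T).obs (k + 1)).snd) / 2) T,
      ENNReal.ofReal_sum_of_nonneg fun k hk => hnn k (Finset.mem_range.1 hk)]
    refine Finset.sum_congr rfl fun k hk => ?_
    rw [Finset.mem_range] at hk
    simp only [hφ]
    rw [(isPath_of_mem_support hw).obs_eq le_rfl (by omega : k + 1 ≤ T)]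
  rw [h2]
  refine (expect_pathLaw_sum_le (ψ := fun k σ => ENNReal.ofReal
    (meanGap (P (k + 1)) (cw (k + 1)) σ.active)) T fun k hk σ =>
    (expect_playRound_regret (hcw' k hk)).le).trans ?_
  refine expect_mono_of_support fun w hw => le_of_eq ?_
  have hnn : ∀ k < T, 0 ≤ meanGap (P (k + 1)) (cw (k + 1)) (w k).active := by
    intro k hk
    unfold meanGap
    split_ifs <;> exact div_nonneg (Finset.sum_nonneg fun a _ => (hcw' k hk).gap_nonneg a)
      (by positivity)
  rw [← ENNReal.ofReal_sum_of_nonneg fun k hk => hnn k (Finset.mem_range.1 hk)]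
  congr 1
  change _ = ∑ t ∈ Finset.Ico 1 (T + 1), _
  rw [Finset.sum_Ico_eq_sum_range, Nat.add_sub_cancel]
  refine Finset.sum_congr rfl fun k hk => ?_
  rw [Finset.mem_range] at hk
  rw [add_comm 1 k, (isPath_of_mem_support hw).active_eq hk]

lemma sum_meanGap_le_horizon (w : ℕ → State K T) :
    ∑ t ∈ Finset.Icc 1 T, meanGap (P t) (cw t) ((w T).obs t).active ≤ T := by
  calc _ ≤ ∑ _t ∈ Finset.Icc 1 T, (1 : ℝ) :=
        Finset.sum_le_sum fun t _ => meanGap_le_half.trans (by norm_num)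
    _ = T := by simp

/-- The regret bound in terms of the phases. -/
lemma expectedRegret_le (hT : 2 ≤ T)
    (hcw : ∀ t ∈ Finset.Icc 1 T, (P t).IsCondorcetWinner (cw t))
    (hs : ∀ t ∈ Finset.Icc 1 T, (P t).SST) (ht : ∀ t ∈ Finset.Icc 1 T, (P t).STI) :
    expectedRegret 20 T P cw ≤ 200000 * (Real.log T ^ 3 * K) *
      ∑ i ∈ Finset.range (numSigSwitches T P cw + 1),
        √((sigSwitch T P cw (i + 1) : ℝ) - sigSwitch T P cw i) := by
  classical
  set Q := ∑ i ∈ Finset.range (numSigSwitches T P cw + 1),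
        √((sigSwitch T P cw (i + 1) : ℝ) - sigSwitch T P cw i) with hQ
  have hL := half_le_log hT
  have hK : (1 : ℝ) ≤ K := by exact_mod_cast NeZero.one_le
  have hT2 : (2 : ℝ) ≤ T := by exact_mod_cast hT
  have hTQ : √(T : ℝ) ≤ 2 * Q := sqrt_le_sum_sqrt_sigSwitch hT
  have hQ1 : 1 / 2 ≤ Q := by
    have : 1 ≤ √(T : ℝ) := Real.one_le_sqrt.2 (by linarith)
    linarith
  have hL3 : 1 ≤ 8 * Real.log T ^ 3 := by
    nlinarith [sq_nonneg (Real.log T), sq_nonneg (Real.log T - 1 / 2)]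
  have hL3Q : K ≤ 16 * (Real.log T ^ 3 * K * Q) := by
    have h2 : 1 ≤ 16 * (Real.log T ^ 3 * Q) := by nlinarith
    nlinarith
  have hB0 : 0 ≤ 100000 * (Real.log T ^ 3 * K) * Q := by linarith
  have hmain : ENNReal.ofReal (expectedRegret 20 T P cw) ≤
      ENNReal.ofReal (200000 * (Real.log T ^ 3 * K) * Q) := by
    refine (ofReal_expectedRegret_le hcw).trans ?_
    -- For `K > T` the regret is at most `T < K`, which the claimed bound dominates.
    rcases le_or_gt K T with hKT | hKT
    swap
    · refine (expect_mono fun w => ENNReal.ofReal_le_ofReal (sum_meanGap_le_horizon w)).trans ?_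
      rw [expect_const]
      apply ENNReal.ofReal_le_ofReal
      have : (T : ℝ) ≤ K := by exact_mod_cast hKT.le
      linarith
    have hex : ∀ i, ∃ a : Fin K, i ≤ numSigSwitches T P cw → ∀ s₁ s₂ : ℕ,
        sigSwitch T P cw i ≤ s₁ → s₁ < s₂ → s₂ < sigSwitch T P cw (i + 1) - 1 →
        ∑ t ∈ Finset.Icc s₁ s₂, (P t).gap (cw t) a < √((K : ℝ) * ((s₂ : ℝ) - (s₁ : ℝ))) := by
      intro i
      by_cases hi : i ≤ numSigSwitches T P cw
      · obtain ⟨a, ha⟩ := exists_safeArm (P := P) (cw := cw) hT hi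
        exact ⟨a, fun _ => ha⟩
      · exact ⟨0, fun h => absurd h hi⟩
    choose safe hsafe using hex
    set bad₁ : (ℕ → State K T) → Prop := fun w => ¬ Concentrated T P (w T).obs with hbad₁
    set bad₂ : (ℕ → State K T) → Prop := fun w => ∃ k < T, (w k).epStart = k + 1 ∧
      ¬ GoodSchedule T (k + 1) P cw safe (w k).sched with hbad₂
    have h1 : expect (pathLaw 20 T P T) (fun w => ENNReal.ofReal
        (∑ t ∈ Finset.Icc 1 T, meanGap (P t) (cw t) ((w T).obs t).active)) ≤
        expect (pathLaw 20 T P T) (fun w => ENNReal.ofReal (100000 * (Real.log T ^ 3 * K) * Q) +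
          ENNReal.ofReal T * (if bad₁ w ∨ bad₂ w then 1 else 0)) := by
      refine expect_mono_of_support fun w hw => ?_
      split_ifs with hb
      · rw [mul_one]
        exact (ENNReal.ofReal_le_ofReal (sum_meanGap_le_horizon w)).trans le_add_self
      · rw [mul_zero, add_zero]
        apply ENNReal.ofReal_le_ofReal
        rw [not_or] at hb
        have hb1 : Concentrated T P (w T).obs := not_not.1 hb.1
        have hb2 : ∀ k < T, (w k).epStart = k + 1 →
            GoodSchedule T (k + 1) P cw safe (w k).sched := by
          intro k hk h2
          by_contra h3
          exact hb.2 ⟨k, hk, h2, h3⟩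
        exact (isPath_of_mem_support hw).sum_meanGap_le hb1 hT hKT hcw hs ht hsafe hb2
    refine h1.trans ?_
    rw [expect_add, expect_const, expect_mul_left]
    have h2 : expect (pathLaw 20 T P T) (fun w => if bad₁ w ∨ bad₂ w then 1 else 0) ≤
        ENNReal.ofReal (((T : ℝ) ^ 2)⁻¹) + ENNReal.ofReal (6 * ((T : ℝ) ^ 2)⁻¹) := by
      have h3 := (prob_or_le (pathLaw 20 T P T) bad₁ bad₂).trans
        (add_le_add (prob_not_concentrated_le hT hKT) (prob_badSchedule_le hT hKT cw safe))
      unfold prob at h3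
      refine le_of_eq_of_le ?_ h3
      congr!
    refine (add_le_add le_rfl (mul_le_mul_right h2 _)).trans ?_
    rw [← ENNReal.ofReal_add (by positivity) (by positivity), ← ENNReal.ofReal_mul (by positivity),
      ← ENNReal.ofReal_add hB0 (by positivity)]
    apply ENNReal.ofReal_le_ofReal
    -- On the exceptional events the regret is at most `T`, so they cost a constant, which the main
    -- term absorbs.
    have h4 : (T : ℝ) * (((T : ℝ) ^ 2)⁻¹ + 6 * ((T : ℝ) ^ 2)⁻¹) ≤ 7 := by
      rw [show (T : ℝ) * (((T : ℝ) ^ 2)⁻¹ + 6 * ((T : ℝ) ^ 2)⁻¹) = 7 / T by field_simp; norm_num,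
        div_le_iff₀ (by linarith)]
      linarith
    linarith
  exact (ENNReal.ofReal_le_ofReal_iff (by linarith)).1 hmain

end Regret

end DuelingBandit

end

/-! ### Choice of the constants -/

theorem theorem2 :
    ∃ C c : ℝ, 0 < C ∧ 0 < c ∧
      ∀ (K : ℕ) [NeZero K] (T : ℕ), 2 ≤ T →
      ∀ (P : ℕ → DuelingBandit.PrefMatrix K) (cw : ℕ → Fin K),
        (∀ t ∈ Finset.Icc 1 T, (P t).IsCondorcetWinner (cw t)) →
        (∀ t ∈ Finset.Icc 1 T, (P t).SST) →
        (∀ t ∈ Finset.Icc 1 T, (P t).STI) →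
        DuelingBandit.numSigSwitches T P cw ≤ DuelingBandit.numCWSwitches T cw ∧
        DuelingBandit.expectedRegret C T P cw ≤
          c * K * Real.log T ^ 3 *
            ∑ i ∈ Finset.range (DuelingBandit.numSigSwitches T P cw + 1),
              √((DuelingBandit.sigSwitch T P cw (i + 1) : ℝ) -
                (DuelingBandit.sigSwitch T P cw i : ℝ)) ∧
        DuelingBandit.expectedRegret C T P cw ≤
          c * K * Real.log T ^ 3 *
            √((max (DuelingBandit.numSigSwitches T P cw) 1 : ℕ) * (T : ℝ)) := by
  -- 20 is twice the error constant of `Concentrated`; 400000 is 200000 times the factor 2 lost in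
  -- `sum_sqrt_sigSwitch_le`.
  refine ⟨20, 400000, by norm_num, by norm_num, ?_⟩
  intro K _ T hT P cw hcw hs ht
  have h1 := DuelingBandit.expectedRegret_le hT hcw hs ht
  have h2 := DuelingBandit.sum_sqrt_sigSwitch_le (P := P) (cw := cw) hT
  have hL := DuelingBandit.half_le_log hT
  have h3 : 0 ≤ Real.log T ^ 3 * (K : ℝ) := by positivity
  refine ⟨DuelingBandit.numSigSwitches_le_numCWSwitches hT, h1.trans ?_, h1.trans ?_⟩
  · have h4 : 0 ≤ ∑ i ∈ Finset.range (DuelingBandit.numSigSwitches T P cw + 1),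
        √((DuelingBandit.sigSwitch T P cw (i + 1) : ℝ) -
          (DuelingBandit.sigSwitch T P cw i : ℝ)) :=
      Finset.sum_nonneg fun i _ => Real.sqrt_nonneg _
    have h5 := mul_nonneg h3 h4
    linarith
  · have h5 := mul_le_mul_of_nonneg_left h2 h3
    linarith
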